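/- **Theorem (approximate nearest neighbor search under edit distance).** For strings $x,y$ let $\mathrm{ED}(x,y)$ be the smallest number of edits (insertion, deletion or replacement of one character) that turn $x$ into $y$. Let $c\ge 1$ and $C$ be real constants. Consider a set $S$ of $n\ge 1$ strings over an alphabet $\Sigma$, where all strings of $S$ and all query strings have length at most $d$, with $d\ge 1$, $d\le Cn$ and $|\Sigma|\le Cn$. The model is a word RAM with words of $w=\kappa(\lfloor\log_2 n\rfloor+1)$ bits and unit-cost elementary operations. A (static, randomized) data structure consists of a preprocessing, which maps $S$ to a random content of a memory of $s$ words, and of a query algorithm, a fixed program that reads the query $q$ and the memory, may use $s$ further words of scratch memory, and writes a string as its answer. The distance from $q$ to $S$ is not known in advance; no bound on the preprocessing time is claimed. There are a query program $P$ and constants $\kappa,A,k\in\mathbb N$, depending only on $c$ and $C$, such that for all $n,d,\Sigma$ as above there is a data structure with $$s\le A\,n^2(1+\log n)^k=\tilde O(n^2)$$ words such that the following holds for every such $S$ and every query $q$. Let $r$ be the smallest integer for which some $y\in S$ has $\mathrm{ED}(q,y)\le r$, and let $$T=A\,d\,3^r\,n^{1/c}\,(1+\log n)^k=\tilde O(d\,3^r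 n^{1/c}).$$ Then, over the random choices of the preprocessing: 1. with probability $>1/10$ the program $P$ halts on $q$ and returns some $y'\in S$ with $\mathrm{ED}(q,y')\le c\,r$; 2. with probability at least $1-1/n$ the query takes at most $T$ steps; 3. the expected number of steps of the query is at most $T$. -/

import Mathlib

open scoped ENNReal

/-!  A word RAM: registers, a static read-only memory holding the preprocessed data,
a read-only query tape and a read-write scratch memory. All values are words of `w` bits,
programs are finite structured programs, and every elementary operation costs one step. -/
namespace WordRAM

/-- Elementary operations on words. -/
inductive Op
  | add | sub | mul | div | mod | lt | eq

/-- Results are reduced modulo `2 ^ w`; subtraction stops at `0`, comparisons return `1` or `0`. -/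
def Op.eval (w : ℕ) : Op → ℕ → ℕ → ℕ
  | .add, a, b => (a + b) % 2 ^ w
  | .sub, a, b => a - b
  | .mul, a, b => (a * b) % 2 ^ w
  | .div, a, b => a / b
  | .mod, a, b => a % b
  | .lt, a, b => if a < b then 1 % 2 ^ w else 0
  | .eq, a, b => if a = b then 1 % 2 ^ w else 0

/-- Expressions: constants, registers, elementary operations, and indirect reads from the
static data, the query tape and the scratch memory. -/
inductive Expr
  | const (k : ℕ)
  | reg (x : ℕ)
  | op (o : Op) (a b : Expr)
  | data (a : Expr)
  | query (a : Expr)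
  | mem (a : Expr)

/-- Programs. `assign x e` writes a register, `store a e` writes the scratch cell with address `a`;
conditions are true when nonzero. -/
inductive Prog
  | skip
  | assign (x : ℕ) (e : Expr)
  | store (a e : Expr)
  | seq (p q : Prog)
  | ite (e : Expr) (p q : Prog)
  | loop (e : Expr) (p : Prog)

/-- What does not change during a run: the word size, the number of scratch cells,
the static data and the query. -/
structure Env where
  w : ℕ
  space : ℕ
  data : ℕ → ℕ
  query : ℕ → ℕ

/-- What changes during a run: the registers and the scratch memory. -/
structure State where
  reg : ℕ → ℕ
  mem : ℕ → ℕ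

/-- The value of an expression. -/
def Expr.eval (E : Env) (s : State) : Expr → ℕ
  | .const k => k % 2 ^ E.w
  | .reg x => s.reg x
  | .op o a b => o.eval E.w (a.eval E s) (b.eval E s)
  | .data a => E.data (a.eval E s)
  | .query a => E.query (a.eval E s)
  | .mem a => s.mem (a.eval E s)

/-- The number of steps needed to evaluate an expression: one for every node. -/
def Expr.cost : Expr → ℕ
  | .const _ => 1
  | .reg _ => 1
  | .op _ a b => a.cost + b.cost + 1
  | .data a => a.cost + 1
  | .query a => a.cost + 1
  | .mem a => a.cost + 1

/-- Write `v` into register `x`. -/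
def State.setReg (s : State) (x v : ℕ) : State :=
  { s with reg := Function.update s.reg x v }

/-- Write `v` into the scratch cell `a`. Only the cells `0, …, space - 1` exist: writing anywhere
else has no effect. -/
def State.setMem (s : State) (E : Env) (a v : ℕ) : State :=
  if a < E.space then { s with mem := Function.update s.mem a v } else s

/-- `Exec E p s s' t`: in the environment `E`, the program `p`, started in the state `s`, halts in
the state `s'` after exactly `t` steps. -/
inductive Exec (E : Env) : Prog → State → State → ℕ → Prop
  | skip (s : State) : Exec E .skip s s 1
  | assign (s : State) (x : ℕ) (e : Expr) :
      Exec E (.assign x e) s (s.setReg x (e.eval E s)) (e.cost + 1)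
  | store (s : State) (a e : Expr) :
      Exec E (.store a e) s (s.setMem E (a.eval E s) (e.eval E s)) (a.cost + e.cost + 1)
  | seq {p q : Prog} {s s' s'' : State} {t t' : ℕ} :
      Exec E p s s' t → Exec E q s' s'' t' → Exec E (.seq p q) s s'' (t + t')
  | ite_true {e : Expr} {p q : Prog} {s s' : State} {t : ℕ} :
      e.eval E s ≠ 0 → Exec E p s s' t → Exec E (.ite e p q) s s' (e.cost + 1 + t)
  | ite_false {e : Expr} {p q : Prog} {s s' : State} {t : ℕ} :
      e.eval E s = 0 → Exec E q s s' t → Exec E (.ite e p q) s s' (e.cost + 1 + t)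
  | loop_true {e : Expr} {p : Prog} {s s' s'' : State} {t t' : ℕ} :
      e.eval E s ≠ 0 → Exec E p s s' t → Exec E (.loop e p) s' s'' t' →
      Exec E (.loop e p) s s'' (e.cost + 1 + t + t')
  | loop_false {e : Expr} {p : Prog} {s : State} :
      e.eval E s = 0 → Exec E (.loop e p) s s (e.cost + 1)

/-- The string in the scratch cells `0, 1, …`, whose length is in register `0`. -/
def State.output (s : State) : List ℕ :=
  (List.range (s.reg 0)).map s.mem

end WordRAM

/-- One edit: inserting, deleting or replacing one character. -/
inductive Edit {α : Type*} : List α → List α → Prop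
  | insert (u v : List α) (a : α) : Edit (u ++ v) (u ++ a :: v)
  | delete (u v : List α) (a : α) : Edit (u ++ a :: v) (u ++ v)
  | replace (u v : List α) (a b : α) : Edit (u ++ a :: v) (u ++ b :: v)

/-- `Edits k x y`: some sequence of exactly `k` edits turns `x` into `y`. -/
inductive Edits {α : Type*} : ℕ → List α → List α → Prop
  | nil (x : List α) : Edits 0 x x
  | cons {k : ℕ} {x y z : List α} : Edit x y → Edits k y z → Edits (k + 1) x z

/-- The edit distance: the smallest number of edits that turn `x` into `y`. -/
noncomputable def editDist {α : Type*} (x y : List α) : ℕ :=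
  sInf {k : ℕ | Edits k x y}

/-- The minimum in the definition of the edit distance is attained. -/
theorem edits_editDist {α : Type*} (x y : List α) : Edits (editDist x y) x y := by
  have h : ∃ k, Edits k x y := by
    induction x with
    | nil =>
      induction y with
      | nil => exact ⟨0, .nil _⟩
      | cons b y ih =>
        obtain ⟨k, hk⟩ := ih
        have key : ∀ (k : ℕ) (x z : List α), Edits k x z → Edits (k + 1) x (b :: z) := by
          intro k x z h
          induction h with
          | nil x => exact .cons (.insert [] x b) (.nil _)
          | cons e _ ih => exact .cons e ih
        exact ⟨k + 1, key _ _ _ hk⟩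
    | cons a x ih =>
      obtain ⟨k, hk⟩ := ih
      exact ⟨k + 1, .cons (.delete [] x a) hk⟩
  exact Nat.sInf_mem h

/-- The contents of a memory of `s` cells of `w` bits. -/
abbrev Memory (s w : ℕ) : Type := Fin s → Fin (2 ^ w)

/-- The environment of a query `q` to a data structure with static memory `m`; the scratch memory
has as many cells as the static one. Cells that do not exist read as `0`. -/
def queryEnv {s w σ : ℕ} (m : Memory s w) (q : List (Fin σ)) : WordRAM.Env where
  w := w
  space := s
  data := fun i => if h : i < s then (m ⟨i, h⟩ : ℕ) else 0
  query := fun i => if h : i < q.length then (q[i] : ℕ) % 2 ^ w else 0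

/-- A query starts with the length of `q` in register `0` and zeros everywhere else. -/
def queryStart {σ : ℕ} (w : ℕ) (q : List (Fin σ)) : WordRAM.State where
  reg := fun x => if x = 0 then q.length % 2 ^ w else 0
  mem := fun _ => 0

/-- With static memory `m`, the query program `P` halts on `q` with output `y`. -/
def Returns {s w σ : ℕ} (P : WordRAM.Prog) (m : Memory s w) (q y : List (Fin σ)) : Prop :=
  ∃ (st : WordRAM.State) (t : ℕ),
    WordRAM.Exec (queryEnv m q) P (queryStart w q) st t ∧ st.output = y.map Fin.val

/-- The number of steps of the query program `P` on `q` with static memory `m`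
(`⊤` if `P` does not halt). -/
noncomputable def queryTime {s w σ : ℕ} (P : WordRAM.Prog) (m : Memory s w)
    (q : List (Fin σ)) : ℕ∞ :=
  ⨅ (st : WordRAM.State) (t : ℕ)
    (_ : WordRAM.Exec (queryEnv m q) P (queryStart w q) st t), (t : ℕ∞)

/-! ### Edit distance and alignments -/

/-! The data structure is locality-sensitive hashing by a random walk. A walk at character `c` of
its string (or at the end) looks up a random value for the current step and `c`: with probability `a
= α / P` it stays, with probability `a` it drops the character silently, and otherwise it drops and
reveals it. All walks share the random table. While the heads of `x` and `y` agree, the two walks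
move together. When they differ, the walks must both be silent, and then each of the four
combinations of staying and dropping has probability `a²`. If both stay, nothing changes; the other
three combinations correspond to the three kinds of edit. Following one optimal alignment shows that
strings of distance at most `e` collide with probability at least `(a²/(1-a²))^e`
(`pow_le_collProb`). Since each of the three moves lowers the distance by at most one, strings of
distance at least `e` collide with probability at most `(3a²/(1-a²))^e`, up to an error for
unfinished walks (`collProb_le`).

At scale `r` the parameter `a` is chosen with `3a²/(1-a²) ≈ n^(-1/(cr))` (`exists_threshold`). Then
a string farther than `c r` from the query collides with probability about `1/n` at most, and one
within `r` with probability about `3^(-r) n^(-1/c)` at least, so `L = 8·3^r·⌈n^(1/c)⌉` tables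
suffice. They need only be pairwise independent: table `j` uses the values `A + j B` over the field
`ZMod P`, and by Chebyshev's inequality no table has a hit with probability at most `1/4`
(`card_no_hit_le`). What a walk reveals is compressed to a random linear fingerprint in `ZMod n`,
which adds at most `1/n` to the probability of a match (`card_fingerprint_eq`). By Markov's
inequality there are more than `12 L` useless candidates with probability at most `1/4`. So a group
of tables works with probability at least `1/2`, and `2(⌊log₂ n⌋ + 1)` independent groups all fail
with probability at most `1/n`.

As the distance is unknown, the query tries the scales `0, 1, 2, …` in turn, with all groups at each
scale. Every candidate is verified by a banded dynamic program (`band_le_iff`), so an answer found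
at a scale `r' ≤ r` has distance at most `c r' ≤ c r`. Once `3^r n^(1/c)` passes `n`, hashing is
replaced by exhaustive search, which cannot fail. It costs `Õ(d n)` time, so failures of probability
`1/n` contribute only `Õ(d)` to the expected time.

The remaining work is to verify the program by rules for partial programs (`Runs`, culminating in
`nearestProg_runs`) and to bound time, space and word size. `Params.Consistent.build_spec` joins
both sides. -/

/-- `Align k x y`: an alignment of `x` and `y` with exactly `k` errors. -/
inductive Align {α : Type*} : ℕ → List α → List α → Prop
  | nil : Align 0 [] []
  | keep {k : ℕ} {x y : List α} (a : α) : Align k x y → Align k (a :: x) (a :: y)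
  | ins {k : ℕ} {x y : List α} (b : α) : Align k x y → Align (k + 1) x (b :: y)
  | del {k : ℕ} {x y : List α} (a : α) : Align k x y → Align (k + 1) (a :: x) y
  | sub {k : ℕ} {x y : List α} (a b : α) : Align k x y → Align (k + 1) (a :: x) (b :: y)

section EditDistance

variable {α : Type*}

theorem Edit.cons {x y : List α} (h : Edit x y) (c : α) : Edit (c :: x) (c :: y) := by
  cases h with
  | insert u v a => exact Edit.insert (c :: u) v a
  | delete u v a => exact Edit.delete (c :: u) v a
  | replace u v a b => exact Edit.replace (c :: u) v a b

theorem Edits.cons_cons {k : ℕ} {x y : List α} (h : Edits k x y) (c : α) :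
    Edits k (c :: x) (c :: y) := by
  induction h with
  | nil x => exact .nil _
  | cons e _ ih => exact .cons (e.cons c) ih

theorem Edits.trans {k l : ℕ} {x y z : List α} (h : Edits k x y) (h' : Edits l y z) :
    Edits (k + l) x z := by
  induction h with
  | nil x => simpa using h'
  | cons e _ ih =>
    have := Edits.cons e (ih h')
    rwa [Nat.add_right_comm] at this

theorem Align.edits {k : ℕ} {x y : List α} (h : Align k x y) : Edits k x y := by
  induction h with
  | nil => exact .nil _
  | keep a _ ih => exact ih.cons_cons a
  | @ins k x y b _ ih => exact ih.trans (.cons (.insert [] y b) (.nil _))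
  | @del k x y a _ ih => exact .cons (.delete [] x a) ih
  | @sub k x y a b _ ih => exact .cons (.replace [] x a b) (ih.cons_cons b)

theorem Align.refl (x : List α) : Align 0 x x := by
  induction x with
  | nil => exact .nil
  | cons a x ih => exact .keep a ih

theorem Align.symm {k : ℕ} {x y : List α} (h : Align k x y) : Align k y x := by
  induction h with
  | nil => exact .nil
  | keep a _ ih => exact .keep a ih
  | ins b _ ih => exact .del b ih
  | del a _ ih => exact .ins a ih
  | sub a b _ ih => exact .sub b a ih

theorem Edit.cons_right {x y : List α} {a : α} (h : Edit x (a :: y)) :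
    x = y ∨ (∃ c, x = c :: a :: y) ∨ (∃ c, x = c :: y) ∨ ∃ x', x = a :: x' ∧ Edit x' y := by
  generalize hw : a :: y = w at h
  cases h with
  | insert u v c =>
    cases u with
    | nil => simp_all
    | cons e u =>
      simp only [List.cons_append, List.cons.injEq] at hw
      obtain ⟨rfl, rfl⟩ := hw
      exact .inr (.inr (.inr ⟨_, rfl, .insert u v c⟩))
  | delete u v c =>
    cases u with
    | nil => simp_all
    | cons e u =>
      simp only [List.cons_append, List.cons.injEq] at hw
      obtain ⟨rfl, rfl⟩ := hw
      exact .inr (.inr (.inr ⟨_, rfl, .delete u v c⟩))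
  | replace u v c c' =>
    cases u with
    | nil => simp_all
    | cons e u =>
      simp only [List.cons_append, List.cons.injEq] at hw
      obtain ⟨rfl, rfl⟩ := hw
      exact .inr (.inr (.inr ⟨_, rfl, .replace u v c c'⟩))

theorem Edit.nil_right {x : List α} (h : Edit x []) : ∃ c, x = [c] := by
  generalize hw : ([] : List α) = w at h
  cases h with
  | insert u v c => simp at hw
  | delete u v c =>
    obtain ⟨rfl, rfl⟩ := List.append_eq_nil_iff.1 hw.symm
    exact ⟨c, rfl⟩
  | replace u v c c' => simp at hw

/-- An edit in front of an alignment is absorbed by induction on the alignment: it either touches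
the first character, at the price of at most one more error, or is passed on to the rest. In this
way edit sequences, which may touch a place repeatedly, become alignments, which can be taken apart
from the front. -/
theorem Align.edit_left {k : ℕ} {y z : List α} (h : Align k y z) :
    ∀ x, Edit x y → ∃ k' ≤ k + 1, Align k' x z := by
  induction h with
  | nil =>
    intro x hx
    obtain ⟨c, rfl⟩ := hx.nil_right
    exact ⟨1, le_rfl, .del c .nil⟩
  | @keep k y z a h ih =>
    intro x hx
    rcases hx.cons_right with rfl | ⟨c, rfl⟩ | ⟨c, rfl⟩ | ⟨x', rfl, hx'⟩
    · exact ⟨_, le_rfl, .ins a h⟩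
    · exact ⟨_, le_rfl, .del c (.keep a h)⟩
    · exact ⟨_, le_rfl, .sub c a h⟩
    · obtain ⟨k', hk, h'⟩ := ih _ hx'
      exact ⟨k', hk, .keep a h'⟩
  | @ins k y z b h ih =>
    intro x hx
    obtain ⟨k', hk, h'⟩ := ih _ hx
    exact ⟨k' + 1, by omega, .ins b h'⟩
  | @del k y z a h ih =>
    intro x hx
    rcases hx.cons_right with rfl | ⟨c, rfl⟩ | ⟨c, rfl⟩ | ⟨x', rfl, hx'⟩
    · exact ⟨_, by omega, h⟩
    · exact ⟨_, le_rfl, .del c (.del a h)⟩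
    · exact ⟨_, by omega, .del c h⟩
    · obtain ⟨k', hk, h'⟩ := ih _ hx'
      exact ⟨k' + 1, by omega, .del a h'⟩
  | @sub k y z a b h ih =>
    intro x hx
    rcases hx.cons_right with rfl | ⟨c, rfl⟩ | ⟨c, rfl⟩ | ⟨x', rfl, hx'⟩
    · exact ⟨_, by omega, .ins b h⟩
    · exact ⟨_, le_rfl, .del c (.sub a b h)⟩
    · exact ⟨_, by omega, .sub c b h⟩
    · obtain ⟨k', hk, h'⟩ := ih _ hx'
      exact ⟨k' + 1, by omega, .sub a b h'⟩

theorem Edits.align {k : ℕ} {x y : List α} (h : Edits k x y) : ∃ k' ≤ k, Align k' x y := by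
  induction h with
  | nil x => exact ⟨0, le_rfl, .refl x⟩
  | cons e _ ih =>
    obtain ⟨k', hk, h'⟩ := ih
    obtain ⟨k'', hk'', h''⟩ := h'.edit_left _ e
    exact ⟨k'', by omega, h''⟩

theorem editDist_le_iff {x y : List α} {e : ℕ} : editDist x y ≤ e ↔ ∃ k ≤ e, Align k x y := by
  constructor
  · intro h
    obtain ⟨k, hk, h'⟩ := (edits_editDist x y).align
    exact ⟨k, hk.trans h, h'⟩
  · rintro ⟨k, hk, h⟩
    exact (Nat.sInf_le h.edits).trans hk

theorem align_editDist (x y : List α) : ∃ k ≤ editDist x y, Align k x y :=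
  editDist_le_iff.1 le_rfl

theorem Align.editDist_le {k : ℕ} {x y : List α} (h : Align k x y) : editDist x y ≤ k :=
  editDist_le_iff.2 ⟨k, le_rfl, h⟩

theorem editDist_self (x : List α) : editDist x x = 0 :=
  Nat.le_zero.1 (Align.refl x).editDist_le

theorem editDist_cons_self_le (a : α) (x y : List α) :
    editDist (a :: x) (a :: y) ≤ editDist x y := by
  obtain ⟨k, hk, h⟩ := align_editDist x y
  exact (h.keep a).editDist_le.trans hk

theorem editDist_cons_left_le (a : α) (x y : List α) :
    editDist (a :: x) y ≤ editDist x y + 1 := by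
  obtain ⟨k, hk, h⟩ := align_editDist x y
  exact (h.del a).editDist_le.trans (by omega)

theorem editDist_cons_right_le (b : α) (x y : List α) :
    editDist x (b :: y) ≤ editDist x y + 1 := by
  obtain ⟨k, hk, h⟩ := align_editDist x y
  exact (h.ins b).editDist_le.trans (by omega)

theorem editDist_cons_cons_le (a b : α) (x y : List α) :
    editDist (a :: x) (b :: y) ≤ editDist x y + 1 := by
  obtain ⟨k, hk, h⟩ := align_editDist x y
  exact (h.sub a b).editDist_le.trans (by omega)

theorem editDist_tail_left_le (a : α) (x y : List α) :
    editDist x y ≤ editDist (a :: x) y + 1 := by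
  obtain ⟨k, hk, h⟩ := align_editDist (a :: x) y
  obtain ⟨k', hk', h'⟩ := h.edit_left x (.insert [] x a)
  exact h'.editDist_le.trans (by omega)

theorem editDist_comm (x y : List α) : editDist x y = editDist y x := by
  have key : ∀ x y : List α, editDist x y ≤ editDist y x := fun x y => by
    obtain ⟨k, hk, h⟩ := align_editDist y x
    exact h.symm.editDist_le.trans hk
  exact le_antisymm (key _ _) (key _ _)

theorem editDist_tail_right_le (b : α) (x y : List α) :
    editDist x y ≤ editDist x (b :: y) + 1 := by
  rw [editDist_comm, editDist_comm x]
  exact editDist_tail_left_le b y x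

/-- An alignment that starts with an error gains nothing: restoring the character it skipped changes
the distance by at most one, which is what the error cost. -/
theorem editDist_cons_self (a : α) (x y : List α) :
    editDist (a :: x) (a :: y) = editDist x y := by
  refine le_antisymm (editDist_cons_self_le a x y) ?_
  obtain ⟨k, hk, h⟩ := align_editDist (a :: x) (a :: y)
  cases h with
  | keep _ h => exact h.editDist_le.trans hk
  | ins _ h =>
    have := editDist_tail_left_le a x y
    have := h.editDist_le
    omega
  | del _ h =>
    have := editDist_tail_right_le a x y
    have := h.editDist_le
    omega
  | sub _ _ h => have := h.editDist_le; omega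

/-- The three cases are the possible first operations of an optimal alignment. -/
theorem editDist_cons_cons {a b : α} (hab : a ≠ b) {x y : List α} :
    editDist x (b :: y) + 1 ≤ editDist (a :: x) (b :: y) ∨
      editDist (a :: x) y + 1 ≤ editDist (a :: x) (b :: y) ∨
        editDist x y + 1 ≤ editDist (a :: x) (b :: y) := by
  obtain ⟨k, hk, h⟩ := align_editDist (a :: x) (b :: y)
  cases h with
  | keep _ h => exact absurd rfl hab
  | ins _ h => have := h.editDist_le; omega
  | del _ h => have := h.editDist_le; omega
  | sub _ _ h => have := h.editDist_le; omega

theorem editDist_nil_left (y : List α) : editDist [] y = y.length := by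
  induction y with
  | nil => exact editDist_self _
  | cons b y ih =>
    have h1 := editDist_cons_right_le b [] y
    obtain ⟨k, hk, h⟩ := align_editDist [] (b :: y)
    cases h with
    | ins _ h => have := h.editDist_le; simp only [List.length_cons]; omega

theorem editDist_nil_right (x : List α) : editDist x [] = x.length := by
  rw [editDist_comm, editDist_nil_left]

theorem length_le_length_add_editDist (x y : List α) : x.length ≤ y.length + editDist x y := by
  obtain ⟨k, hk, h⟩ := align_editDist x y
  suffices x.length ≤ y.length + k by omega
  clear hk
  induction h <;> simp only [List.length_cons, List.length_nil] <;> omega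

theorem editDist_le_max_length (x y : List α) : editDist x y ≤ max x.length y.length := by
  induction x generalizing y with
  | nil => simp [editDist_nil_left]
  | cons a x ih =>
    cases y with
    | nil => simp [editDist_nil_right]
    | cons b y =>
      have := editDist_cons_cons_le a b x y
      have := ih y
      simp only [List.length_cons]
      omega

theorem Edit.reverse {x y : List α} (h : Edit x y) : Edit x.reverse y.reverse := by
  cases h with
  | insert u v a =>
    simpa using Edit.insert v.reverse u.reverse a
  | delete u v a =>
    simpa using Edit.delete v.reverse u.reverse a
  | replace u v a b =>
    simpa using Edit.replace v.reverse u.reverse a b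

theorem Edits.reverse {k : ℕ} {x y : List α} (h : Edits k x y) :
    Edits k x.reverse y.reverse := by
  induction h with
  | nil x => exact .nil _
  | cons e _ ih => exact .cons e.reverse ih

/-- The dynamic program extends prefixes at their ends, whereas alignments are taken apart at the
front; reversal mediates between the two. -/
theorem editDist_reverse (x y : List α) : editDist x.reverse y.reverse = editDist x y := by
  have key : ∀ x y : List α, editDist x.reverse y.reverse ≤ editDist x y := fun x y =>
    Nat.sInf_le (edits_editDist x y).reverse
  refine le_antisymm (key _ _) ?_
  simpa using key x.reverse y.reverse

end EditDistance

/-! ### The banded dynamic program -/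

/-- One row of the banded dynamic program: position `m` of the new row, computed from the previous
row `v`; `e m` is the cost of aligning the two characters that meet at position `m`. -/
def bandRow (R : ℕ) (e v : ℕ → ℕ) : ℕ → ℕ
  | 0 => R + 1
  | m + 1 => if m + 1 < 2 * R + 2 then
      min (min (v (m + 1) + e (m + 1)) (v (m + 2) + 1)) (bandRow R e v m + 1) else v (m + 1)

/-- The banded dynamic program: position `m` of row `i` is about the prefixes of lengths `i` and
`i + m - (R + 1)`; `e i j` is the cost of aligning character `i` with character `j`. -/
def band (R : ℕ) (e : ℕ → ℕ → ℕ) : ℕ → ℕ → ℕ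
  | 0 => fun m => if m < R + 1 then R + 1 else m - (R + 1)
  | i + 1 => bandRow R (fun m => e i (i + m - (R + 1))) (band R e i)

/-- Positions `0` and `2 * R + 2` border the band. They keep the value `R + 1`, which acts as
infinity and spares special cases at the border. -/
theorem band_zero_right (R : ℕ) (e : ℕ → ℕ → ℕ) (i : ℕ) : band R e i 0 = R + 1 := by
  cases i <;> simp [band, bandRow]

theorem band_last (R : ℕ) (e : ℕ → ℕ → ℕ) (i : ℕ) : band R e i (2 * R + 2) = R + 1 := by
  induction i with
  | zero => simp only [band]; split <;> omega
  | succ i ih => simp [band, bandRow, ih]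

/-- This bound excludes overflow when the cells are stored in words. -/
theorem band_le (R : ℕ) (e : ℕ → ℕ → ℕ) (he : ∀ i j, e i j ≤ 1) (i m : ℕ) (hm : m ≤ 2 * R + 2) :
    band R e i m ≤ R + 1 + i := by
  induction i generalizing m with
  | zero => simp only [band]; split <;> omega
  | succ i ih =>
    cases m with
    | zero => simp [band_zero_right]
    | succ m =>
      have h1 := ih (m + 1) hm
      have h2 := he i (i + (m + 1) - (R + 1))
      simp only [band, bandRow]
      split <;> omega

/-- These cells belong to negative prefix lengths of the second string. There the truncated index in
`band` makes the alignment cost meaningless, but their values exceed `R` all the same. -/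
theorem band_neg (R : ℕ) (e : ℕ → ℕ → ℕ) (i m : ℕ) (h : i + m < R + 1) :
    R + 1 ≤ band R e i m := by
  induction i generalizing m with
  | zero => simp only [band]; split <;> omega
  | succ i ih =>
    induction m with
    | zero => simp [band_zero_right]
    | succ m ihm =>
      have h1 := ih (m + 1) (by omega)
      have h2 := ih (m + 2) (by omega)
      have h3 := ihm (by omega)
      simp only [band] at h3
      simp only [band, bandRow]
      split <;> omega

theorem band_succ (R : ℕ) (e : ℕ → ℕ → ℕ) (i m : ℕ) (h : m < 2 * R + 1) :
    band R e (i + 1) (m + 1) = min (min (band R e i (m + 1) + e i (i + (m + 1) - (R + 1)))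
      (band R e i (m + 2) + 1)) (band R e (i + 1) m + 1) := by
  simp only [band, bandRow]
  rw [if_pos (by omega)]

/-! ### Correctness of the banded dynamic program -/

section Band

variable {α : Type*}

theorem reverse_take_succ (x : List α) (i : ℕ) (h : i < x.length) :
    (x.take (i + 1)).reverse = x[i] :: (x.take i).reverse := by
  rw [List.take_succ_eq_append_getElem h, List.reverse_append]
  rfl

/-- The minimum is attained by one of three neighbours. A value of at most `R` excludes the border
and the negative cells, so the neighbour stands for a genuine pair of prefixes. -/
theorem band_sound (R : ℕ) (e : ℕ → ℕ → ℕ) (q y : List α)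
    (he : ∀ (i j : ℕ) (hi : i < q.length) (hj : j < y.length), e i j = 0 → q[i] = y[j])
    (i j : ℕ) (hi : i ≤ q.length) (hj : j ≤ y.length) (m : ℕ) (hm : m ≤ 2 * R + 2)
    (hmj : i + m = j + R + 1) (hv : band R e i m ≤ R) :
    editDist (q.take i).reverse (y.take j).reverse ≤ band R e i m := by
  induction i generalizing j m with
  | zero =>
    simp only [List.take_zero, List.reverse_nil, editDist_nil_left, List.length_reverse,
      List.length_take]
    simp only [band] at hv ⊢
    split <;> omega
  | succ i ih =>
    induction m generalizing j with
    | zero => simp [band_zero_right] at hv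
    | succ m ihm =>
      rcases Nat.lt_or_ge m (2 * R + 1) with hlt | hge
      swap
      · have : m + 1 = 2 * R + 2 := by omega
        rw [this, band_last] at hv
        omega
      have hrec := band_succ R e i m hlt
      rw [reverse_take_succ q i (by omega)]
      rcases min_choice (min (band R e i (m + 1) + e i (i + (m + 1) - (R + 1)))
        (band R e i (m + 2) + 1)) (band R e (i + 1) m + 1) with h1 | h1
      · rcases min_choice (band R e i (m + 1) + e i (i + (m + 1) - (R + 1)))
          (band R e i (m + 2) + 1) with h2 | h2
        · rw [hrec, h1, h2] at hv ⊢
          cases j with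
          | zero => have := band_neg R e i (m + 1) (by omega); omega
          | succ j =>
            rw [reverse_take_succ y j (by omega)]
            have hij : i + (m + 1) - (R + 1) = j := by omega
            rw [hij] at hv ⊢
            have h3 := ih j (by omega) (by omega) (m + 1) (by omega) (by omega) (by omega)
            rcases Nat.eq_zero_or_pos (e i j) with h0 | h0
            · rw [he i j (by omega) (by omega) h0, editDist_cons_self]
              omega
            · have := editDist_cons_cons_le q[i] y[j] (q.take i).reverse (y.take j).reverse
              omega
        · rw [hrec, h1, h2] at hv ⊢
          have h3 := ih j (by omega) hj (m + 2) (by omega) (by omega) (by omega)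
          have := editDist_cons_left_le q[i] (q.take i).reverse (y.take j).reverse
          omega
      · rw [hrec, h1] at hv ⊢
        cases j with
        | zero => have := band_neg R e (i + 1) m (by omega); omega
        | succ j =>
          have h3 := ihm j (by omega) (by omega) (by omega) (by omega)
          rw [reverse_take_succ q i (by omega)] at h3
          rw [reverse_take_succ y j (by omega)]
          have := editDist_cons_right_le y[j] (q[i] :: (q.take i).reverse) (y.take j).reverse
          omega

/-- An optimal alignment with at most `R` errors stays inside the band, since the lengths of aligned
prefixes differ by at most the number of errors. -/
theorem band_complete (R : ℕ) (e : ℕ → ℕ → ℕ) (q y : List α)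
    (he : ∀ (i j : ℕ) (hi : i < q.length) (hj : j < y.length), q[i] = y[j] → e i j = 0)
    (he1 : ∀ i j, e i j ≤ 1)
    (i j : ℕ) (hi : i ≤ q.length) (hj : j ≤ y.length) (m : ℕ) (hm : m ≤ 2 * R + 2)
    (hmj : i + m = j + R + 1)
    (hv : editDist (q.take i).reverse (y.take j).reverse ≤ R) :
    band R e i m ≤ editDist (q.take i).reverse (y.take j).reverse := by
  induction i generalizing j m with
  | zero =>
    simp only [List.take_zero, List.reverse_nil, editDist_nil_left, List.length_reverse,
      List.length_take]
    simp only [band]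
    split <;> omega
  | succ i ih =>
    induction m generalizing j with
    | zero =>
      have := length_le_length_add_editDist (q.take (i + 1)).reverse (y.take j).reverse
      simp only [List.length_reverse, List.length_take] at this
      omega
    | succ m ihm =>
      rcases Nat.lt_or_ge m (2 * R + 1) with hlt | hge
      swap
      · have := length_le_length_add_editDist (y.take j).reverse (q.take (i + 1)).reverse
        rw [editDist_comm] at this
        simp only [List.length_reverse, List.length_take] at this
        omega
      have hrec := band_succ R e i m hlt
      rw [reverse_take_succ q i (by omega)] at hv ⊢
      cases j with
      | zero =>
        simp only [List.take_zero, List.reverse_nil, editDist_nil_right, List.length_cons,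
          List.length_reverse] at hv ⊢
        have h3 := ih 0 (by omega) (by omega) (m + 2) (by omega) (by omega)
        simp only [List.take_zero, List.reverse_nil, editDist_nil_right, List.length_reverse] at h3
        omega
      | succ j =>
        rw [reverse_take_succ y j (by omega)] at hv ⊢
        by_cases hab : q[i] = y[j]
        · rw [hab, editDist_cons_self] at hv ⊢
          have h3 := ih j (by omega) (by omega) (m + 1) (by omega) (by omega) hv
          have hij : i + (m + 1) - (R + 1) = j := by omega
          have := he i j (by omega) (by omega) hab
          rw [hij] at hrec
          omega
        · rcases editDist_cons_cons hab (x := (q.take i).reverse) (y := (y.take j).reverse)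
            with h | h | h
          · have h3 := ih (j + 1) (by omega) (by omega) (m + 2) (by omega) (by omega)
              (by rw [reverse_take_succ y j (by omega)]; omega)
            rw [reverse_take_succ y j (by omega)] at h3
            omega
          · have h3 := ihm j (by omega) (by omega) (by omega)
              (by rw [reverse_take_succ q i (by omega)]; omega)
            rw [reverse_take_succ q i (by omega)] at h3
            omega
          · have h3 := ih j (by omega) (by omega) (m + 1) (by omega) (by omega) (by omega)
            have hij : i + (m + 1) - (R + 1) = j := by omega
            have := he1 i j
            rw [hij] at hrec
            omega

/-- The banded dynamic program decides whether the edit distance is at most `R`. -/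
theorem band_le_iff (R : ℕ) (e : ℕ → ℕ → ℕ) (q y : List α)
    (he : ∀ (i j : ℕ) (hi : i < q.length) (hj : j < y.length), e i j = 0 ↔ q[i] = y[j])
    (he1 : ∀ i j, e i j ≤ 1) :
    (y.length + R + 1 - q.length < 2 * R + 2 ∧
      band R e q.length (y.length + R + 1 - q.length) < R + 1) ↔ editDist q y ≤ R := by
  have hq : editDist (q.take q.length).reverse (y.take y.length).reverse = editDist q y := by
    rw [List.take_length, List.take_length, editDist_reverse]
  constructor
  · rintro ⟨h1, h2⟩
    -- The subtraction truncates to `0` when the second string is shorter by more than `R`; position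
    -- `0` then gives the right verdict.
    rcases Nat.eq_zero_or_pos (y.length + R + 1 - q.length) with h0 | h0
    · rw [h0, band_zero_right] at h2
      omega
    · have := band_sound R e q y (fun i j hi hj => (he i j hi hj).1) q.length y.length le_rfl le_rfl
        (y.length + R + 1 - q.length) (by omega) (by omega) (by omega)
      omega
  · intro h
    have h1 := length_le_length_add_editDist q y
    have h2 := length_le_length_add_editDist y q
    rw [editDist_comm] at h2
    have := band_complete R e q y (fun i j hi hj => (he i j hi hj).2) he1 q.length y.length le_rfl
      le_rfl (y.length + R + 1 - q.length) (by omega) (by omega) (by omega)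
    omega

end Band

/-! ### The hash walk -/

section Walk

variable {β : Type*}

/-- One step of the walk along `x` with random values `v`: stay or drop the first character. -/
def advance (α : ℕ) (v : Option β → ℕ) (x : List β) : List β :=
  if v x.head? < α then x else x.tail

/-- Does this step of the walk reveal the current character? -/
def Emits (α : ℕ) (v : Option β → ℕ) (x : List β) : Prop := 2 * α ≤ v x.head?

instance (α : ℕ) (v : Option β → ℕ) (x : List β) : Decidable (Emits α v x) :=
  inferInstanceAs (Decidable (_ ≤ _))

/-- The walks along `x` and `y` reveal the same characters in each of the first `m` steps. -/
def Collide (α : ℕ) : ℕ → (ℕ → Option β → ℕ) → List β → List β → Prop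
  | 0, _, _, _ => True
  | m + 1, ρ, x, y => (x.head? = y.head? ∨ ¬ Emits α (ρ 0) x ∧ ¬ Emits α (ρ 0) y) ∧
      Collide α m (fun t => ρ (t + 1)) (advance α (ρ 0) x) (advance α (ρ 0) y)

/-- The fingerprint of what the walk along `x` reveals in its first `m` steps. -/
def fingerprint {N : ℕ} (α : ℕ) : ℕ → (ℕ → Option β → ℕ) → (ℕ → Option β → ZMod N) → List β → ZMod N
  | 0, _, _, _ => 0
  | m + 1, ρ, Z, x => (if Emits α (ρ 0) x then Z 0 x.head? else 0) +
      fingerprint α m (fun t => ρ (t + 1)) (fun t => Z (t + 1)) (advance α (ρ 0) x)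

theorem Collide.fingerprint_eq {N : ℕ} {α m : ℕ} {ρ : ℕ → Option β → ℕ} {x y : List β}
    (h : Collide α m ρ x y) (Z : ℕ → Option β → ZMod N) :
    fingerprint α m ρ Z x = fingerprint α m ρ Z y := by
  induction m generalizing ρ Z x y with
  | zero => rfl
  | succ m ih =>
    simp only [fingerprint]
    rw [ih h.2]
    congr 1
    rcases h.1 with h1 | ⟨h1, h2⟩
    · have : Emits α (ρ 0) x ↔ Emits α (ρ 0) y := by simp only [Emits, h1]
      simp only [this, h1]
    · rw [if_neg h1, if_neg h2]

variable [DecidableEq β]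

instance Collide.decidable (α : ℕ) : (m : ℕ) → (ρ : ℕ → Option β → ℕ) → (x y : List β) →
    Decidable (Collide α m ρ x y)
  | 0, _, _, _ => inferInstanceAs (Decidable True)
  | m + 1, ρ, x, y =>
    have := Collide.decidable α m (fun t => ρ (t + 1)) (advance α (ρ 0) x) (advance α (ρ 0) y)
    inferInstanceAs (Decidable (_ ∧ _))

/-- If the walks do not collide, then some random value decides about the equality of the
fingerprints. -/
theorem exists_fingerprint_shift {N : ℕ} {α m : ℕ} {ρ : ℕ → Option β → ℕ} {x y : List β}
    (h : ¬ Collide α m ρ x y) : ∃ t < m, ∃ (c : Option β) (u : ZMod N), u * u = 1 ∧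
      ∀ (Z Z' : ℕ → Option β → ZMod N) (s : ZMod N), Z' t c = Z t c + s →
        (∀ t' c', (t' ≠ t ∨ c' ≠ c) → Z' t' c' = Z t' c') →
        fingerprint α m ρ Z' x - fingerprint α m ρ Z' y =
          fingerprint α m ρ Z x - fingerprint α m ρ Z y + u * s := by
  induction m generalizing ρ x y with
  | zero => exact absurd trivial h
  | succ m ih =>
    by_cases h1 : x.head? = y.head? ∨ ¬ Emits α (ρ 0) x ∧ ¬ Emits α (ρ 0) y
    · have h2 : ¬ Collide α m (fun t => ρ (t + 1)) (advance α (ρ 0) x) (advance α (ρ 0) y) :=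
        fun h2 => h ⟨h1, h2⟩
      obtain ⟨t, ht, c, u, hu, hs⟩ := ih h2
      refine ⟨t + 1, by omega, c, u, hu, fun Z Z' s hZ hZ' => ?_⟩
      have := hs (fun t => Z (t + 1)) (fun t => Z' (t + 1)) s hZ
        (fun t' c' h' => hZ' _ _ (h'.imp (by omega) id))
      have key : ∀ Z : ℕ → Option β → ZMod N, (if Emits α (ρ 0) x then Z 0 x.head? else 0) =
          (if Emits α (ρ 0) y then Z 0 y.head? else 0) := by
        intro Z
        rcases h1 with h1 | ⟨h1, h2⟩
        · have : Emits α (ρ 0) x ↔ Emits α (ρ 0) y := by simp only [Emits, h1]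
          simp only [this, h1]
        · rw [if_neg h1, if_neg h2]
      simp only [fingerprint]
      rw [key Z, key Z', add_sub_add_left_eq_sub, add_sub_add_left_eq_sub, this]
    · have hne : x.head? ≠ y.head? := fun h2 => h1 (.inl h2)
      have key : ∀ Z Z' : ℕ → Option β → ZMod N, (∀ t' c', t' ≠ 0 → Z' t' c' = Z t' c') →
          ∀ x, fingerprint α m (fun t => ρ (t + 1)) (fun t => Z' (t + 1)) x =
            fingerprint α m (fun t => ρ (t + 1)) (fun t => Z (t + 1)) x := by
        intro Z Z' hZ x
        have : (fun t => Z' (t + 1)) = fun t => Z (t + 1) := by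
          funext t c
          exact hZ _ _ (by omega)
        rw [this]
      by_cases hx : Emits α (ρ 0) x
      -- The heads differ, so the table entry of the revealed head of `x` enters only the
      -- fingerprint of `x`, with sign `1`. In the remaining case only `y` reveals and the sign is
      -- `-1`.
      · refine ⟨0, by omega, x.head?, 1, by ring, fun Z Z' s hZ hZ' => ?_⟩
        simp only [fingerprint]
        rw [key Z Z' (fun t' c' h' => hZ' _ _ (.inl h')), key Z Z' (fun t' c' h' => hZ' _ _ (.inl h')),
          if_pos hx, if_pos hx, hZ, hZ' 0 y.head? (.inr hne.symm)]
        ring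
      · have hy : Emits α (ρ 0) y := by
          by_contra hy
          exact h1 (.inr ⟨hx, hy⟩)
        refine ⟨0, by omega, y.head?, -1, by ring, fun Z Z' s hZ hZ' => ?_⟩
        simp only [fingerprint]
        rw [key Z Z' (fun t' c' h' => hZ' _ _ (.inl h')), key Z Z' (fun t' c' h' => hZ' _ _ (.inl h')),
          if_neg hx, if_neg hx, if_pos hy, if_pos hy, hZ]
        ring

/-! ### The collision probability -/

/-- The probability that the walks along `x` and `y` collide for `m` steps, if they stay with
probability `a` and drop a character without revealing it with probability `a`. -/
noncomputable def collProb (a : ℝ) : ℕ → List β → List β → ℝ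
  | 0, _, _ => 1
  | m + 1, x, y => if x.head? = y.head? then
        a * collProb a m x y + (1 - a) * collProb a m x.tail y.tail
      else a ^ 2 * (collProb a m x y + collProb a m x.tail y + collProb a m x y.tail +
        collProb a m x.tail y.tail)

theorem collProb_nonneg {a : ℝ} (ha : 0 ≤ a) (ha' : a ≤ 1) (m : ℕ) (x y : List β) :
    0 ≤ collProb a m x y := by
  induction m generalizing x y with
  | zero => simp [collProb]
  | succ m ih =>
    have h1 := ih x y
    have h2 := ih x.tail y
    have h3 := ih x y.tail
    have h4 := ih x.tail y.tail
    have : 0 ≤ 1 - a := by linarith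
    simp only [collProb]
    split <;> positivity

/-- The number `p = a²/(1-a²)` satisfies `p^(e+1) = a² (p^(e+1) + p^e)`. At a mismatch it suffices
to keep two of the four outcomes: both walks stay, or they follow the first edit of an optimal
alignment. At a match the distance does not change, whether the walks stay or move. -/
theorem pow_le_collProb {a : ℝ} (ha : 0 ≤ a) (ha' : a ≤ 1 / 2) (m : ℕ) (x y : List β) (e : ℕ)
    (he : editDist x y ≤ e) : (a ^ 2 / (1 - a ^ 2)) ^ e ≤ collProb a m x y := by
  have h1 : 0 < 1 - a ^ 2 := by nlinarith
  set p := a ^ 2 / (1 - a ^ 2) with hp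
  have hp0 : 0 ≤ p := by positivity
  have hp1 : p ≤ 1 := by
    rw [hp, div_le_one h1]; nlinarith
  have hpa : p * (1 - a ^ 2) = a ^ 2 := by rw [hp]; field_simp
  induction m generalizing x y e with
  | zero => simp only [collProb]; exact pow_le_one₀ hp0 hp1
  | succ m ih =>
    have hnn := collProb_nonneg (β := β) ha (by linarith) m
    have key : ∀ (e : ℕ) (x' y' : List β), editDist x y ≤ e + 1 → editDist x' y' ≤ e →
        p ^ (e + 1) ≤ a ^ 2 * (collProb a m x y + collProb a m x' y') := by
      intro e x' y' h2 h3
      have h4 := ih _ _ _ h2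
      have h5 := ih _ _ _ h3
      calc p ^ (e + 1) = a ^ 2 * (p ^ (e + 1) + p ^ e) := by
            rw [pow_succ]; linear_combination p ^ e * hpa
        _ ≤ _ := by gcongr
    have ha2 : 0 ≤ a ^ 2 := by positivity
    have n1 := mul_nonneg ha2 (hnn x.tail y)
    have n2 := mul_nonneg ha2 (hnn x y.tail)
    have n3 := mul_nonneg ha2 (hnn x.tail y.tail)
    cases x with
    | nil =>
      cases y with
      | nil =>
        simp only [collProb, if_pos, List.tail_nil]
        have := ih _ _ _ he
        linarith
      | cons b y =>
        rw [editDist_nil_left, List.length_cons] at he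
        obtain ⟨e, rfl⟩ : ∃ e', e = e' + 1 := ⟨e - 1, by omega⟩
        have := key e [] y (by rw [editDist_nil_left, List.length_cons]; exact he)
          (by rw [editDist_nil_left]; omega)
        simp only [collProb, List.head?_nil, List.head?_cons, List.tail_cons, List.tail_nil,
          reduceCtorEq, if_false] at n1 n2 n3 ⊢
        linarith
    | cons c x =>
      cases y with
      | nil =>
        rw [editDist_nil_right, List.length_cons] at he
        obtain ⟨e, rfl⟩ : ∃ e', e = e' + 1 := ⟨e - 1, by omega⟩
        have := key e x [] (by rw [editDist_nil_right, List.length_cons]; exact he)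
          (by rw [editDist_nil_right]; omega)
        simp only [collProb, List.head?_nil, List.head?_cons, List.tail_cons, List.tail_nil,
          reduceCtorEq, if_false] at n1 n2 n3 ⊢
        linarith
      | cons b y =>
        simp only [collProb, List.head?_cons, List.tail_cons, Option.some.injEq] at n1 n2 n3 ⊢
        by_cases hcb : c = b
        · subst hcb
          rw [if_pos rfl]
          have h2 := ih _ _ _ he
          rw [editDist_cons_self] at he
          have h3 := ih _ _ _ he
          have : 0 ≤ 1 - a := by linarith
          calc p ^ e = a * p ^ e + (1 - a) * p ^ e := by ring
            _ ≤ _ := by gcongr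
        · rw [if_neg hcb]
          obtain ⟨e, rfl⟩ : ∃ e', e = e' + 1 :=
            ⟨e - 1, by have := editDist_cons_cons hcb (x := x) (y := y); omega⟩
          rcases editDist_cons_cons hcb (x := x) (y := y) with h | h | h
          · have := key e x (b :: y) he (by omega)
            linarith
          · have := key e (c :: x) y he (by omega)
            linarith
          · have := key e x y he (by omega)
            linarith

/-- The number `Q = 3a²/(1-a²)` satisfies `Q^(e+1) = a² (Q^(e+1) + 3 Q^e)`, and each of the three
moves lowers the distance by at most one. The second summand covers `m = 0`, where the probability
is `1`. It halves with each dropped character, so a step multiplies it by at most `(1 + 3a)/4` at a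
match and `9a²/4` at a mismatch of nonempty strings, in both cases by less than `3/4`. -/
theorem collProb_le {a : ℝ} (ha : 0 ≤ a) (ha' : a ≤ 1 / 2) (m : ℕ) (x y : List β) (e : ℕ)
    (he : e ≤ editDist x y) : collProb a m x y ≤
      (3 * a ^ 2 / (1 - a ^ 2)) ^ e + 2 ^ (x.length + y.length) * (3 / 4) ^ m := by
  have h1 : 0 < 1 - a ^ 2 := by nlinarith
  set Q := 3 * a ^ 2 / (1 - a ^ 2) with hp
  have hQ0 : 0 ≤ Q := by positivity
  have hQ1 : Q ≤ 1 := by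
    rw [hp, div_le_one h1]; nlinarith
  have hQa : Q * (1 - a ^ 2) = 3 * a ^ 2 := by rw [hp]; field_simp
  have ha4 : a ^ 2 ≤ 1 / 4 := by nlinarith
  have ha2 : 0 ≤ a ^ 2 := by positivity
  induction m generalizing x y e with
  | zero =>
    have h2 : (1 : ℝ) ≤ 2 ^ (x.length + y.length) := one_le_pow₀ (by norm_num)
    have h3 : 0 ≤ Q ^ e := by positivity
    simp only [collProb]
    linarith
  | succ m ih =>
    have hQe : ∀ e, 0 ≤ Q ^ e := fun e => by positivity
    have hΦ : ∀ k : ℕ, (0 : ℝ) ≤ 2 ^ k * (3 / 4) ^ m := fun k => by positivity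
    -- one of the strings is empty
    have key : ∀ (e k : ℕ) (u v : ℝ), u ≤ Q ^ e + 2 ^ (k + 1) * (3 / 4) ^ m →
        v ≤ Q ^ (e - 1) + 2 ^ k * (3 / 4) ^ m → (e = 0 → u ≤ 1 ∧ v ≤ 1) →
        2 * a ^ 2 * (u + v) ≤ Q ^ e + 2 ^ (k + 1) * (3 / 4) ^ (m + 1) := by
      intro e k u v hu hv h0
      have hk := hΦ k
      cases e with
      | zero =>
        obtain ⟨hu, hv⟩ := h0 rfl
        have : (0 : ℝ) ≤ 2 ^ (k + 1) * (3 / 4) ^ (m + 1) := by positivity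
        rw [pow_zero]
        nlinarith
      | succ e =>
        rw [Nat.add_sub_cancel] at hv
        -- For an empty string staying and dropping coincide, so two outcomes of weight `2a²`
        -- remain. As `Q = a² (Q + 3)`, the inequality `2a² (Q + 1) ≤ Q` says just `Q ≤ 1`.
        have h3 : 2 * a ^ 2 * (Q ^ (e + 1) + Q ^ e) ≤ Q ^ (e + 1) := by
          have h5 : 2 * a ^ 2 * (Q + 1) ≤ Q := by nlinarith
          have := mul_le_mul_of_nonneg_left h5 (hQe e)
          rw [pow_succ Q]
          linarith
        have h4 : 2 * a ^ 2 * (2 ^ (k + 1) * (3 / 4) ^ m + 2 ^ k * (3 / 4) ^ m) ≤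
            2 ^ (k + 1) * (3 / 4 : ℝ) ^ (m + 1) := by
          have : (2 : ℝ) ^ (k + 1) * (3 / 4) ^ (m + 1) = 3 / 2 * (2 ^ k * (3 / 4) ^ m) := by ring
          rw [this, pow_succ (2 : ℝ)]
          nlinarith
        calc 2 * a ^ 2 * (u + v) ≤ 2 * a ^ 2 * ((Q ^ (e + 1) + 2 ^ (k + 1) * (3 / 4) ^ m) +
              (Q ^ e + 2 ^ k * (3 / 4) ^ m)) := by gcongr
          _ = 2 * a ^ 2 * (Q ^ (e + 1) + Q ^ e) +
              2 * a ^ 2 * (2 ^ (k + 1) * (3 / 4) ^ m + 2 ^ k * (3 / 4) ^ m) := by ring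
          _ ≤ _ := by linarith
    have hle1 : ∀ (m : ℕ) (x y : List β), collProb a m x y ≤ 1 := by
      intro m
      induction m with
      | zero => intro x y; simp [collProb]
      | succ m ihm =>
        intro x y
        have g1 := ihm x y
        have g2 := ihm x.tail y
        have g3 := ihm x y.tail
        have g4 := ihm x.tail y.tail
        simp only [collProb]
        split <;> nlinarith
    rcases Nat.eq_zero_or_pos e with rfl | hepos
    · have : (0 : ℝ) ≤ 2 ^ (x.length + y.length) * (3 / 4) ^ (m + 1) := by positivity
      rw [pow_zero]
      linarith [hle1 (m + 1) x y]
    cases x with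
    | nil =>
      cases y with
      | nil => rw [editDist_self] at he; omega
      | cons b y =>
        rw [editDist_nil_left, List.length_cons] at he
        have := key e y.length (collProb a m [] (b :: y)) (collProb a m [] y)
          (by simpa using ih [] (b :: y) e (by rw [editDist_nil_left, List.length_cons]; omega))
          (by simpa using ih [] y (e - 1) (by rw [editDist_nil_left]; omega)) (by omega)
        simp only [collProb, List.head?_nil, List.head?_cons, List.tail_cons, List.tail_nil,
          reduceCtorEq, if_false, List.length_nil, List.length_cons, zero_add]
        linarith
    | cons c x =>
      cases y with
      | nil =>
        rw [editDist_nil_right, List.length_cons] at he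
        have := key e x.length (collProb a m (c :: x) []) (collProb a m x [])
          (by simpa using ih (c :: x) [] e (by rw [editDist_nil_right, List.length_cons]; omega))
          (by simpa using ih x [] (e - 1) (by rw [editDist_nil_right]; omega)) (by omega)
        simp only [collProb, List.head?_nil, List.head?_cons, List.tail_cons, List.tail_nil,
          reduceCtorEq, if_false, List.length_nil, List.length_cons, add_zero]
        linarith
      | cons b y =>
        simp only [collProb, List.head?_cons, List.tail_cons, Option.some.injEq, List.length_cons]
        set Φ : ℝ := 2 ^ (x.length + y.length) * (3 / 4) ^ m with hΦdef
        have hk : 0 ≤ Φ := hΦ _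
        have e1 : (2 : ℝ) ^ (x.length + 1 + (y.length + 1)) * (3 / 4) ^ m = 4 * Φ := by
          rw [hΦdef]; ring
        have e2 : (2 : ℝ) ^ (x.length + 1 + (y.length + 1)) * (3 / 4) ^ (m + 1) = 3 * Φ := by
          rw [hΦdef]; ring
        have e3 : (2 : ℝ) ^ (x.length + 1 + y.length) * (3 / 4) ^ m = 2 * Φ := by
          rw [hΦdef]; ring
        have e4 : (2 : ℝ) ^ (x.length + (y.length + 1)) * (3 / 4) ^ m = 2 * Φ := by
          rw [hΦdef]; ring
        have g0 := ih (c :: x) (b :: y) e he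
        simp only [List.length_cons, e1] at g0
        rw [e2]
        by_cases hcb : c = b
        · subst hcb
          rw [if_pos rfl]
          rw [editDist_cons_self] at he
          have g1 := ih x y e he
          rw [← hΦdef] at g1
          have : 0 ≤ 1 - a := by linarith
          calc a * collProb a m (c :: x) (c :: y) + (1 - a) * collProb a m x y
              ≤ a * (Q ^ e + 4 * Φ) + (1 - a) * (Q ^ e + Φ) := by gcongr
            _ ≤ _ := by nlinarith
        · rw [if_neg hcb]
          have d1 := editDist_cons_left_le c x (b :: y)
          have d2 := editDist_cons_right_le b (c :: x) y
          have d3 := editDist_cons_cons_le c b x y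
          have g1 := ih x (b :: y) (e - 1) (by omega)
          have g2 := ih (c :: x) y (e - 1) (by omega)
          have g3 := ih x y (e - 1) (by omega)
          simp only [List.length_cons, e3, e4] at g1 g2
          rw [← hΦdef] at g3
          obtain ⟨e, rfl⟩ : ∃ e', e = e' + 1 := ⟨e - 1, by omega⟩
          rw [Nat.add_sub_cancel] at g1 g2 g3
          have h3 : a ^ 2 * (Q ^ (e + 1) + 3 * Q ^ e) = Q ^ (e + 1) := by
            rw [pow_succ]; linear_combination (-Q ^ e) * hQa
          calc a ^ 2 * (collProb a m (c :: x) (b :: y) + collProb a m x (b :: y) +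
                collProb a m (c :: x) y + collProb a m x y)
              ≤ a ^ 2 * ((Q ^ (e + 1) + 4 * Φ) + (Q ^ e + 2 * Φ) + (Q ^ e + 2 * Φ) + (Q ^ e + Φ)) := by
                gcongr
            _ = a ^ 2 * (Q ^ (e + 1) + 3 * Q ^ e) + a ^ 2 * (9 * Φ) := by ring
            _ ≤ _ := by rw [h3]; nlinarith

end Walk

/-! ### Counting the random choices -/

section Counting

/-- Probabilities are kept as counts. A uniformly random function has a uniform value at a point,
and, by the next lemma, independent values at two points. -/
theorem card_mul_sum_apply {κ V : Type*} [Fintype κ] [DecidableEq κ] [Fintype V] (c : κ)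
    (F : V → ℝ) : (Fintype.card V : ℝ) * ∑ v : κ → V, F (v c) =
      Fintype.card (κ → V) * ∑ u, F u := by
  have hcard : Fintype.card (κ → V) = Fintype.card V * Fintype.card ({j // j ≠ c} → V) := by
    rw [Fintype.card_congr (Equiv.funSplitAt c V), Fintype.card_prod]
  have hsum : ∑ v : κ → V, F (v c) = ∑ w : V × ({j // j ≠ c} → V), F w.1 :=
    Fintype.sum_equiv (Equiv.funSplitAt c V) _ _ fun v => rfl
  rw [hsum, Fintype.sum_prod_type, hcard]
  simp only [Finset.sum_const, Finset.card_univ, nsmul_eq_mul, ← Finset.mul_sum]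
  push_cast
  ring

theorem card_mul_sum_apply_apply {κ V : Type*} [Fintype κ] [DecidableEq κ] [Fintype V] {c c' : κ}
    (h : c ≠ c') (F : V → V → ℝ) : (Fintype.card V : ℝ) ^ 2 * ∑ v : κ → V, F (v c) (v c') =
      Fintype.card (κ → V) * ∑ u, ∑ u', F u u' := by
  have hcard : Fintype.card (κ → V) = Fintype.card V * Fintype.card ({j // j ≠ c} → V) := by
    rw [Fintype.card_congr (Equiv.funSplitAt c V), Fintype.card_prod]
  have hsum : ∑ v : κ → V, F (v c) (v c') =
      ∑ w : V × ({j // j ≠ c} → V), F w.1 (w.2 ⟨c', h.symm⟩) :=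
    Fintype.sum_equiv (Equiv.funSplitAt c V) _ _ fun v => rfl
  rw [hsum, Fintype.sum_prod_type, hcard, pow_two, mul_assoc, Finset.mul_sum]
  simp only [card_mul_sum_apply (κ := {j // j ≠ c}) ⟨c', h.symm⟩ (F _), ← Finset.mul_sum]
  push_cast
  ring

theorem sum_zmod_threshold (P α : ℕ) [NeZero P] (h : 2 * α ≤ P) (f₀ f₁ f₂ : ℝ) :
    ∑ u : ZMod P, (if u.val < α then f₀ else if u.val < 2 * α then f₁ else f₂) =
      P * ((α / P : ℝ) * f₀ + (α / P : ℝ) * f₁ + (1 - 2 * (α / P : ℝ)) * f₂) := by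
  have h1 : ∑ u : ZMod P, (if u.val < α then f₀ else if u.val < 2 * α then f₁ else f₂) =
      ∑ k ∈ Finset.range P, (if k < α then f₀ else if k < 2 * α then f₁ else f₂) := by
    obtain ⟨P, rfl⟩ : ∃ P', P = P' + 1 := ⟨P - 1, by have := NeZero.pos P; omega⟩
    exact Fin.sum_univ_eq_sum_range
      (fun k => if k < α then f₀ else if k < 2 * α then f₁ else f₂) (P + 1)
  rw [h1, Finset.range_eq_Ico, ← Finset.sum_Ico_consecutive _ (Nat.zero_le α) (by omega : α ≤ P),
    ← Finset.sum_Ico_consecutive _ (by omega : α ≤ 2 * α) h]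
  have s0 : ∑ k ∈ Finset.Ico 0 α, (if k < α then f₀ else if k < 2 * α then f₁ else f₂) = α * f₀ := by
    rw [Finset.sum_congr rfl fun k hk => if_pos (Finset.mem_Ico.1 hk).2]
    simp
  have s1 : ∑ k ∈ Finset.Ico α (2 * α), (if k < α then f₀ else if k < 2 * α then f₁ else f₂) =
      α * f₁ := by
    rw [Finset.sum_congr rfl (g := fun _ => f₁) fun k hk => ?_]
    · simp only [Finset.sum_const, Nat.card_Ico, nsmul_eq_mul]
      congr 2
      omega
    · have := Finset.mem_Ico.1 hk
      rw [if_neg (by omega), if_pos (by omega)]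
  have s2 : ∑ k ∈ Finset.Ico (2 * α) P, (if k < α then f₀ else if k < 2 * α then f₁ else f₂) =
      (P - 2 * α) * f₂ := by
    rw [Finset.sum_congr rfl (g := fun _ => f₂) fun k hk => ?_]
    · simp only [Finset.sum_const, Nat.card_Ico, nsmul_eq_mul]
      rw [Nat.cast_sub h]
      push_cast
      ring
    · have := Finset.mem_Ico.1 hk
      rw [if_neg (by omega), if_neg (by omega)]
  have hP : (P : ℝ) ≠ 0 := NeZero.ne _
  rw [s0, s1, s2]
  field_simp
  ring

/-- The values of the random table, with value `0` beyond row `M`. -/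
def valueRows {κ : Type*} {P M : ℕ} (ρ : Fin M → κ → ZMod P) (t : ℕ) (c : κ) : ℕ :=
  if h : t < M then (ρ ⟨t, h⟩ c).val else 0

/-- The random table, with value `0` beyond row `M`. -/
def tableRows {κ : Type*} {N M : ℕ} (Z : Fin M → κ → ZMod N) (t : ℕ) (c : κ) : ZMod N :=
  if h : t < M then Z ⟨t, h⟩ c else 0

theorem valueRows_cons_zero {κ : Type*} {P M : ℕ} (v : κ → ZMod P) (ρ : Fin M → κ → ZMod P) :
    valueRows (Fin.cons v ρ : Fin (M + 1) → κ → ZMod P) 0 = fun c => (v c).val := by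
  funext c
  simp [valueRows]

theorem valueRows_cons_succ {κ : Type*} {P M : ℕ} (v : κ → ZMod P) (ρ : Fin M → κ → ZMod P) :
    (fun t => valueRows (Fin.cons v ρ : Fin (M + 1) → κ → ZMod P) (t + 1)) = valueRows ρ := by
  funext t c
  simp only [valueRows]
  by_cases h : t < M
  · rw [dif_pos h, dif_pos (by omega)]
    rfl
  · rw [dif_neg h, dif_neg (by omega)]

variable {β : Type*} [DecidableEq β] [Fintype β]

/-- If the heads agree, both walks read the same entry of the row; otherwise they read two
independent entries. This is the case distinction in `collProb`. -/
theorem sum_step {P α : ℕ} [NeZero P] (h : 2 * α ≤ P) (m : ℕ) (x y : List β) :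
    ∑ v : Option β → ZMod P,
      (if x.head? = y.head? ∨
          ¬ Emits α (fun c => (v c).val) x ∧ ¬ Emits α (fun c => (v c).val) y then
        collProb (α / P : ℝ) m (advance α (fun c => (v c).val) x)
          (advance α (fun c => (v c).val) y) else 0) =
      Fintype.card (Option β → ZMod P) * collProb (α / P : ℝ) (m + 1) x y := by
  have hP : (P : ℝ) ≠ 0 := NeZero.ne _
  simp only [Emits, advance, not_le]
  by_cases hxy : x.head? = y.head?
  · simp only [hxy, true_or, if_true, collProb]
    set X := collProb (α / P : ℝ) m x y
    set Y := collProb (α / P : ℝ) m x.tail y.tail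
    have h1 := card_mul_sum_apply (κ := Option β) (V := ZMod P) y.head?
      (fun u => if u.val < α then X else if u.val < 2 * α then Y else Y)
    rw [sum_zmod_threshold P α h, ZMod.card] at h1
    have h2 : ∀ v : Option β → ZMod P, collProb (α / P : ℝ) m
        (if (v y.head?).val < α then x else x.tail) (if (v y.head?).val < α then y else y.tail) =
        (if (v y.head?).val < α then X else if (v y.head?).val < 2 * α then Y else Y) := by
      intro v
      by_cases hv : (v y.head?).val < α
      · simp only [if_pos hv, X]
      · simp only [if_neg hv, ite_self, Y]
    simp only [h2]
    apply mul_left_cancel₀ hP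
    rw [h1]
    ring
  · simp only [hxy, false_or, if_false, collProb]
    have h1 := card_mul_sum_apply_apply (V := ZMod P) hxy
      (fun u u' => if u.val < α then
          (if u'.val < α then collProb (α / P : ℝ) m x y else
            if u'.val < 2 * α then collProb (α / P : ℝ) m x y.tail else 0)
        else if u.val < 2 * α then
          (if u'.val < α then collProb (α / P : ℝ) m x.tail y else
            if u'.val < 2 * α then collProb (α / P : ℝ) m x.tail y.tail else 0)
        else 0)
    have h2 : ∀ u : ZMod P, ∑ u' : ZMod P, (if u.val < α then
          (if u'.val < α then collProb (α / P : ℝ) m x y else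
            if u'.val < 2 * α then collProb (α / P : ℝ) m x y.tail else 0)
        else if u.val < 2 * α then
          (if u'.val < α then collProb (α / P : ℝ) m x.tail y else
            if u'.val < 2 * α then collProb (α / P : ℝ) m x.tail y.tail else 0)
        else 0) = (if u.val < α then ∑ u' : ZMod P, (if u'.val < α then collProb (α / P : ℝ) m x y
            else if u'.val < 2 * α then collProb (α / P : ℝ) m x y.tail else 0)
          else if u.val < 2 * α then ∑ u' : ZMod P, (if u'.val < α then
            collProb (α / P : ℝ) m x.tail y else
            if u'.val < 2 * α then collProb (α / P : ℝ) m x.tail y.tail else 0) else 0) := by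
      intro u
      split_ifs <;> simp
    simp only [h2, sum_zmod_threshold P α h, ZMod.card] at h1
    apply mul_left_cancel₀ (pow_ne_zero 2 hP)
    have h3 : ∀ v : Option β → ZMod P,
        (if (v x.head?).val < 2 * α ∧ (v y.head?).val < 2 * α then collProb (α / P : ℝ) m
          (if (v x.head?).val < α then x else x.tail) (if (v y.head?).val < α then y else y.tail)
          else 0) = (if (v x.head?).val < α then
          (if (v y.head?).val < α then collProb (α / P : ℝ) m x y else
            if (v y.head?).val < 2 * α then collProb (α / P : ℝ) m x y.tail else 0)
        else if (v x.head?).val < 2 * α then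
          (if (v y.head?).val < α then collProb (α / P : ℝ) m x.tail y else
            if (v y.head?).val < 2 * α then collProb (α / P : ℝ) m x.tail y.tail else 0)
        else 0) := by
      intro v
      by_cases a1 : (v x.head?).val < α <;> by_cases a2 : (v y.head?).val < α <;>
        by_cases a3 : (v x.head?).val < 2 * α <;> by_cases a4 : (v y.head?).val < 2 * α <;>
        first | omega | simp only [a1, a2, a3, a4, if_true, if_false, and_self, and_false, false_and]
    simp only [h3]
    rw [h1]
    ring

/-- Each step reads a fresh row of the table, so splitting off row `0` turns the recursion of
`collProb` into an exact count. -/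
theorem sum_collide {P α : ℕ} [NeZero P] (h : 2 * α ≤ P) (M : ℕ) (x y : List β) :
    ∑ ρ : Fin M → Option β → ZMod P, (if Collide α M (valueRows ρ) x y then (1 : ℝ) else 0) =
      Fintype.card (Fin M → Option β → ZMod P) * collProb (α / P : ℝ) M x y := by
  induction M generalizing x y with
  | zero => simp [Collide, collProb]
  | succ M ih =>
    have h1 : ∑ ρ : Fin (M + 1) → Option β → ZMod P,
        (if Collide α (M + 1) (valueRows ρ) x y then (1 : ℝ) else 0) =
        ∑ w : (Option β → ZMod P) × (Fin M → Option β → ZMod P),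
          (if Collide α (M + 1) (valueRows (Fin.cons w.1 w.2 : Fin (M + 1) → Option β → ZMod P)) x y
            then (1 : ℝ) else 0) :=
      (Fintype.sum_equiv (Fin.consEquiv fun _ => Option β → ZMod P) _ _ fun w => rfl).symm
    rw [h1, Fintype.sum_prod_type]
    have h2 : ∀ v : Option β → ZMod P, ∑ ρ : Fin M → Option β → ZMod P,
        (if Collide α (M + 1) (valueRows (Fin.cons v ρ : Fin (M + 1) → Option β → ZMod P)) x y
            then (1 : ℝ) else 0) = Fintype.card (Fin M → Option β → ZMod P) *
        (if x.head? = y.head? ∨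
          ¬ Emits α (fun c => (v c).val) x ∧ ¬ Emits α (fun c => (v c).val) y then
        collProb (α / P : ℝ) M (advance α (fun c => (v c).val) x)
          (advance α (fun c => (v c).val) y) else 0) := by
      intro v
      simp only [Collide, valueRows_cons_zero, valueRows_cons_succ]
      split_ifs with h3
      · rw [← ih]
        simp only [h3, true_and]
      · simp only [h3, false_and, if_false, Finset.sum_const_zero, mul_zero]
    simp only [h2, ← Finset.mul_sum, sum_step h]
    have h3 : Fintype.card (Fin (M + 1) → Option β → ZMod P) =
        Fintype.card (Fin M → Option β → ZMod P) * Fintype.card (Option β → ZMod P) := by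
      simp only [Fintype.card_fun, Fintype.card_fin]
      rw [pow_succ]
    rw [h3]
    push_cast
    ring

/-- Shifting the one decisive entry of the table translates the difference of the fingerprints by a
unit multiple. Hence all `N` values of the difference are equally frequent, in particular `0`. -/
theorem card_fingerprint_eq {N : ℕ} [NeZero N] {α M : ℕ} {ρ : ℕ → Option β → ℕ} {x y : List β}
    (h : ¬ Collide α M ρ x y) :
    N * (Finset.univ.filter fun Z : Fin M → Option β → ZMod N =>
      fingerprint α M ρ (tableRows Z) x = fingerprint α M ρ (tableRows Z) y).card =
        Fintype.card (Fin M → Option β → ZMod N) := by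
  obtain ⟨t, ht, c, u, hu, hs⟩ := exists_fingerprint_shift (N := N) h
  let D : (Fin M → Option β → ZMod N) → ZMod N := fun Z =>
    fingerprint α M ρ (tableRows Z) x - fingerprint α M ρ (tableRows Z) y
  let e : Fin M → Option β → ZMod N := fun t' c' => if t'.val = t ∧ c' = c then 1 else 0
  have hD : ∀ (s : ZMod N) Z, D (Z + s • e) = D Z + u * s := by
    intro s Z
    refine hs _ _ s ?_ ?_
    · simp [tableRows, ht, e]
    · intro t' c' h'
      simp only [tableRows]
      split_ifs with h2
      · have : ¬ (t' = t ∧ c' = c) := by tauto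
        simp [e, this]
      · rfl
  have hfib : ∀ s : ZMod N, (Finset.univ.filter fun Z => D Z = s).card =
      (Finset.univ.filter fun Z => D Z = 0).card := by
    intro s
    -- As `u * u = 1`, the shift by `-(u * s)` changes the difference by exactly `-s`.
    refine Finset.card_bij (fun Z _ => Z + (-(u * s)) • e) ?_ ?_ ?_
    · intro Z hZ
      simp only [Finset.mem_filter, Finset.mem_univ, true_and] at hZ ⊢
      rw [hD, hZ]
      linear_combination (-s) * hu
    · intro Z _ Z' _ h2
      exact add_right_cancel h2
    · intro Z hZ
      simp only [Finset.mem_filter, Finset.mem_univ, true_and] at hZ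
      refine ⟨Z + (u * s) • e, ?_, ?_⟩
      · simp only [Finset.mem_filter, Finset.mem_univ, true_and]
        rw [hD, hZ]
        linear_combination s * hu
      · simp
  have h1 := Finset.card_eq_sum_card_fiberwise (f := D) (s := Finset.univ) (t := Finset.univ)
    (fun _ _ => Finset.mem_coe.2 (Finset.mem_univ _))
  simp only [hfib, Finset.sum_const, smul_eq_mul, Finset.card_univ, ZMod.card] at h1
  rw [h1]
  simp only [D, sub_eq_zero]

end Counting

/-! ### Pairwise independence -/

section Pairwise

variable {F X : Type*} [Field F] [AddCommGroup X] [Module F X] [Fintype X]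

theorem sum_line (j : F) (f : X → ℝ) :
    ∑ w : X × X, f (w.1 + j • w.2) = Fintype.card X * ∑ x, f x := by
  rw [Fintype.sum_prod_type_right]
  have : ∀ B : X, ∑ A, f (A + j • B) = ∑ x, f x := fun B =>
    Fintype.sum_equiv (Equiv.addRight (j • B)) _ _ fun A => rfl
  simp [this]

/-- Two points on a line determine it: `(A, B) ↦ (A + j B, A + j' B)` is injective as `j - j'` is
invertible, hence bijective. So the two points are independent and uniform. -/
theorem sum_line_mul_line {j j' : F} (h : j ≠ j') (f g : X → ℝ) :
    ∑ w : X × X, f (w.1 + j • w.2) * g (w.1 + j' • w.2) = (∑ x, f x) * ∑ x, g x := by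
  rw [Finset.sum_mul_sum, ← Fintype.sum_prod_type']
  refine Fintype.sum_bijective (fun w : X × X => (w.1 + j • w.2, w.1 + j' • w.2)) ?_ _ _
    fun w => rfl
  rw [← Finite.injective_iff_bijective]
  rintro ⟨A, B⟩ ⟨A', B'⟩ h'
  simp only [Prod.mk.injEq] at h' ⊢
  have h1 : (j - j') • (B - B') = 0 := by
    have := congrArg₂ (· - ·) h'.1 h'.2
    simp only [add_sub_add_left_eq_sub] at this
    rw [sub_smul, smul_sub, smul_sub, sub_sub_sub_comm, this, sub_self]
  rcases smul_eq_zero.1 h1 with h2 | h2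
  · exact absurd (sub_eq_zero.1 h2) h
  · have hB := sub_eq_zero.1 h2
    exact ⟨by simpa [hB] using h'.1, hB⟩

/-- Chebyshev's inequality for the number of `j` such that a pairwise independent point lies in a
set of density `δ`. -/
theorem card_no_hit_le {L : ℕ} (j : Fin L → F) (hj : Function.Injective j) (f : X → Prop)
    [DecidablePred f] (δ : ℝ) (hδ : 0 ≤ δ)
    (hf : ∑ x, (if f x then (1 : ℝ) else 0) = Fintype.card X * δ) :
    ((Finset.univ.filter fun w : X × X => ∀ i, ¬ f (w.1 + j i • w.2)).card : ℝ) * (L * δ) ≤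
      Fintype.card (X × X) := by
  classical
  set μ := (L : ℝ) * δ with hμ
  set φ : X → ℝ := fun x => if f x then 1 else 0 with hφ
  set c : ℝ := ((Fintype.card X : ℕ) : ℝ) with hc
  have hcard : (Fintype.card (X × X) : ℝ) = c * c := by rw [Fintype.card_prod]; push_cast; rfl
  have hL : ∀ i, ∑ w : X × X, φ (w.1 + j i • w.2) = c * c * δ := by
    intro i
    rw [sum_line, hf]
    ring
  have hLL : ∀ i i', ∑ w : X × X, φ (w.1 + j i • w.2) * φ (w.1 + j i' • w.2) ≤
      c * c * δ ^ 2 + if i = i' then c * c * δ else 0 := by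
    intro i i'
    by_cases hi : i = i'
    · subst hi
      rw [if_pos rfl]
      have : ∀ x, φ x * φ x = φ x := by intro x; simp only [hφ]; split <;> simp
      simp only [this, hL]
      have : 0 ≤ c * c * δ ^ 2 := by positivity
      linarith
    · rw [sum_line_mul_line (hj.ne hi), if_neg hi, hf]
      exact le_of_eq (by ring)
  -- The variance of the number of hits is at most its mean: by pairwise independence the terms with
  -- `i ≠ i'` only contribute to `μ²`, and the diagonal adds at most `μ`.
  have hvar : ∑ w : X × X, (∑ i, φ (w.1 + j i • w.2) - μ) ^ 2 ≤ c * c * μ := by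
    have h1 : ∀ w : X × X, (∑ i, φ (w.1 + j i • w.2) - μ) ^ 2 =
        (∑ i, ∑ i', φ (w.1 + j i • w.2) * φ (w.1 + j i' • w.2)) -
          2 * μ * (∑ i, φ (w.1 + j i • w.2)) + μ ^ 2 := by
      intro w
      rw [sub_sq, pow_two, Finset.sum_mul_sum]
      ring
    have h3 : ∑ w : X × X, ∑ i, ∑ i', φ (w.1 + j i • w.2) * φ (w.1 + j i' • w.2) =
        ∑ i, ∑ i', ∑ w : X × X, φ (w.1 + j i • w.2) * φ (w.1 + j i' • w.2) := by
      rw [Finset.sum_comm]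
      exact Finset.sum_congr rfl fun i _ => Finset.sum_comm
    have h4 : ∑ w : X × X, ∑ i, φ (w.1 + j i • w.2) = ∑ i, ∑ w : X × X, φ (w.1 + j i • w.2) :=
      Finset.sum_comm
    simp only [h1, Finset.sum_add_distrib, Finset.sum_sub_distrib]
    rw [h3, ← Finset.mul_sum, h4]
    have h2 : ∑ i, ∑ i', ∑ w : X × X, φ (w.1 + j i • w.2) * φ (w.1 + j i' • w.2) ≤
        ∑ i : Fin L, ∑ i' : Fin L, (c * c * δ ^ 2 + if i = i' then c * c * δ else 0) :=
      Finset.sum_le_sum fun i _ => Finset.sum_le_sum fun i' _ => hLL i i'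
    simp only [Finset.sum_add_distrib, Finset.sum_ite_eq, Finset.mem_univ, if_true,
      Finset.sum_const, Finset.card_univ, Fintype.card_fin, nsmul_eq_mul] at h2
    simp only [hL, Finset.sum_const, Finset.card_univ, Fintype.card_fin, nsmul_eq_mul, hcard]
    rw [hμ]
    linarith
  -- Without any hit the squared deviation from the mean is `μ²`.
  have hzero : ((Finset.univ.filter fun w : X × X => ∀ i, ¬ f (w.1 + j i • w.2)).card : ℝ) * μ ^ 2 ≤
      ∑ w : X × X, (∑ i, φ (w.1 + j i • w.2) - μ) ^ 2 := by
    rw [← nsmul_eq_mul, ← Finset.sum_const]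
    refine (Finset.sum_le_sum fun w hw => ?_).trans
      (Finset.sum_le_sum_of_subset_of_nonneg (Finset.filter_subset _ _) fun w _ _ => sq_nonneg _)
    simp only [Finset.mem_filter, Finset.mem_univ, true_and] at hw
    simp [hφ, hw]
  have hμ0 : 0 ≤ μ := by positivity
  rw [hcard]
  rcases hμ0.eq_or_lt with h0 | h0
  · rw [← h0, mul_zero]; positivity
  · have := hzero.trans hvar
    rw [pow_two, ← mul_assoc] at this
    exact le_of_mul_le_mul_right this h0

end Pairwise

/-! ### Groups of hash tables -/

/-- The random choices of a group of hash tables: two tables for the pairwise independent walks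
and one table for the fingerprints. -/
abbrev Seed (β : Type*) (M P N : ℕ) : Type _ :=
  ((Fin M → Option β → ZMod P) × (Fin M → Option β → ZMod P)) × (Fin M → Option β → ZMod N)

section Group

variable {β : Type*} {M P N : ℕ}

/-- The random values used by the walk number `j`. -/
def Seed.rows (γ : Seed β M P N) (j : ℕ) : ℕ → Option β → ℕ :=
  valueRows (γ.1.1 + (j : ZMod P) • γ.1.2)

/-- The fingerprint of the walk number `j` along `x`, with `m` steps. -/
def Seed.hash (γ : Seed β M P N) (α m j : ℕ) (x : List β) : ZMod N :=
  fingerprint α m (γ.rows j) (tableRows γ.2) x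

/-- Some string of distance at most `R` has the same fingerprint as the query in one of the first
`L` tables. -/
def Seed.Hit (γ : Seed β M P N) (α m L R : ℕ) (str : ℕ → List β) (q : List β) : Prop :=
  ∃ j < L, ∃ y < N, γ.hash α m j (str y) = γ.hash α m j q ∧ editDist q (str y) ≤ R

/-- The pairs of a table and a string with the fingerprint of the query, but of distance
more than `R`. -/
noncomputable def Seed.falseHits (γ : Seed β M P N) (α m L R : ℕ) (str : ℕ → List β)
    (q : List β) : Finset (ℕ × ℕ) :=
  (Finset.range L ×ˢ Finset.range N).filter fun w =>
    γ.hash α m w.1 (str w.2) = γ.hash α m w.1 q ∧ R < editDist q (str w.2)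

/-- The group of tables leads to an answer of distance at most `R`, with less than `cap`
distance computations in vain. -/
def Seed.Good (γ : Seed β M P N) (α m L R cap : ℕ) (str : ℕ → List β) (q : List β) : Prop :=
  γ.Hit α m L R str q ∧ (γ.falseHits α m L R str q).card < cap

variable [Fintype β] [DecidableEq β]

/-- Colliding walks have equal fingerprints, so it suffices that the walks along `q` and one near
string collide in some table. The expected number of such tables is at least `4`, and Chebyshev's
inequality gives `1/4`. The condition `L ≤ P` keeps the table numbers distinct in the field. -/
theorem four_mul_card_not_hit_le [Fact P.Prime] [NeZero N] {α L R r : ℕ} {str : ℕ → List β}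
    {q : List β} (hα : 2 * α ≤ P) (hL : L ≤ P) (hrR : r ≤ R) {y : ℕ} (hy : y < N)
    (hyr : editDist q (str y) ≤ r)
    (hLp : 4 ≤ L * ((α / P : ℝ) ^ 2 / (1 - (α / P : ℝ) ^ 2)) ^ r) :
    4 * (Nat.card {γ : Seed β M P N // ¬ γ.Hit α M L R str q} : ℝ) ≤
      Fintype.card (Seed β M P N) := by
  classical
  have hP : (0 : ℝ) < P := by exact_mod_cast (Fact.out : P.Prime).pos
  have ha : (0 : ℝ) ≤ α / P := by positivity
  have ha' : (α / P : ℝ) ≤ 1 / 2 := by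
    rw [div_le_div_iff₀ hP two_pos]; exact_mod_cast (by omega)
  let X := Fin M → Option β → ZMod P
  let f : X → Prop := fun ρ => Collide α M (valueRows ρ) q (str y)
  have hj : Function.Injective fun i : Fin L => ((i : ℕ) : ZMod P) := by
    intro i i' h
    have h1 := (ZMod.natCast_eq_natCast_iff' _ _ _).1 h
    rw [Nat.mod_eq_of_lt (by omega), Nat.mod_eq_of_lt (by omega)] at h1
    exact Fin.ext h1
  have h1 := card_no_hit_le (X := X) _ hj f (collProb (α / P : ℝ) M q (str y))
    (collProb_nonneg ha (by linarith) _ _ _) (sum_collide hα M q (str y))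
  have h2 : (4 : ℝ) ≤ L * collProb (α / P : ℝ) M q (str y) :=
    hLp.trans (mul_le_mul_of_nonneg_left (pow_le_collProb ha ha' M q (str y) r hyr)
      (Nat.cast_nonneg _))
  have h3 : Nat.card {γ : Seed β M P N // ¬ γ.Hit α M L R str q} ≤
      (Finset.univ.filter fun w : X × X => ∀ i : Fin L, ¬ f (w.1 + ((i : ℕ) : ZMod P) • w.2)).card *
        Fintype.card (Fin M → Option β → ZMod N) := by
    rw [Nat.card_eq_fintype_card, Fintype.card_subtype, ← Finset.card_univ, ← Finset.card_product]
    refine Finset.card_le_card fun γ hγ => ?_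
    simp only [Finset.mem_filter, Finset.mem_univ, true_and, Finset.mem_product, and_true] at hγ ⊢
    intro i hi
    exact hγ ⟨i, i.2, y, hy, (Collide.fingerprint_eq hi _).symm, hyr.trans hrR⟩
  have h4 : (Fintype.card (Seed β M P N) : ℝ) =
      Fintype.card (X × X) * Fintype.card (Fin M → Option β → ZMod N) := by
    rw [← Nat.cast_mul, ← Fintype.card_prod]
  rw [h4]
  have h5 : (Nat.card {γ : Seed β M P N // ¬ γ.Hit α M L R str q} : ℝ) ≤ _ := Nat.cast_le.2 h3
  push_cast at h5
  have h6 := (mul_le_mul_of_nonneg_left h2 (Nat.cast_nonneg (Finset.univ.filter fun w : X × X =>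
    ∀ i : Fin L, ¬ f (w.1 + ((i : ℕ) : ZMod P) • w.2)).card)).trans h1
  have h7 := mul_le_mul_of_nonneg_right h6
    (Nat.cast_nonneg (α := ℝ) (Fintype.card (Fin M → Option β → ZMod N)))
  linarith

/-- Equal fingerprints come either from a collision of the walks or, with probability `1/N`, from an
accident of the fingerprint table. -/
theorem sum_hash_eq_le [Fact P.Prime] [NeZero N] {α : ℕ} (hα : 2 * α ≤ P) (j : ℕ) (x y : List β) :
    ∑ γ : Seed β M P N, (if γ.hash α M j x = γ.hash α M j y then (1 : ℝ) else 0) ≤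
      Fintype.card (Seed β M P N) * (collProb (α / P : ℝ) M x y + 1 / N) := by
  classical
  have hN : (0 : ℝ) < N := by exact_mod_cast NeZero.pos N
  let X := Fin M → Option β → ZMod P
  let Y := Fin M → Option β → ZMod N
  have h1 : ∀ w : X × X, ∑ Z : Y, (if Seed.hash (w, Z) α M j x = Seed.hash (w, Z) α M j y
      then (1 : ℝ) else 0) ≤ Fintype.card Y * ((if Collide α M (valueRows (w.1 + (j : ZMod P) • w.2))
        x y then (1 : ℝ) else 0) + 1 / N) := by
    intro w
    by_cases hc : Collide α M (valueRows (w.1 + (j : ZMod P) • w.2)) x y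
    · rw [if_pos hc]
      have : ∑ Z : Y, (if Seed.hash (w, Z) α M j x = Seed.hash (w, Z) α M j y
          then (1 : ℝ) else 0) ≤ ∑ Z : Y, (1 : ℝ) :=
        Finset.sum_le_sum fun Z _ => by split <;> norm_num
      rw [Finset.sum_const, Finset.card_univ, nsmul_eq_mul] at this
      refine this.trans (mul_le_mul_of_nonneg_left ?_ (Nat.cast_nonneg _))
      have : (0 : ℝ) ≤ 1 / N := by positivity
      linarith
    · rw [if_neg hc, zero_add, Finset.sum_boole, ← card_fingerprint_eq (N := N) (M := M) hc]
      push_cast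
      rw [mul_one_div, mul_div_cancel_left₀ _ hN.ne']
      exact le_rfl
  rw [Fintype.sum_prod_type]
  refine (Finset.sum_le_sum fun w _ => h1 w).trans (le_of_eq ?_)
  rw [← Finset.mul_sum, Finset.sum_add_distrib,
    sum_line (j : ZMod P) (fun ρ : X => if Collide α M (valueRows ρ) x y then (1 : ℝ) else 0),
    sum_collide hα]
  simp only [Finset.sum_const, Finset.card_univ, nsmul_eq_mul, Fintype.card_prod]
  push_cast
  ring

/-- A far string matches the query in a given table with probability at most `3/N`: one `1/N` each
for a genuine collision, unfinished walks and the fingerprint. Over `L * N` pairs the expectation is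
at most `3 L`, and Markov's inequality yields the limit `12 L`. -/
theorem four_mul_card_falseHits_le [Fact P.Prime] [NeZero N] {α L R d : ℕ} {str : ℕ → List β}
    {q : List β} (hα : 2 * α ≤ P) (hq : q.length ≤ d) (hstr : ∀ y < N, (str y).length ≤ d)
    (hL : 0 < L) (hQ : (3 * (α / P : ℝ) ^ 2 / (1 - (α / P : ℝ) ^ 2)) ^ (R + 1) ≤ 1 / N)
    (hM : (2 : ℝ) ^ (d + d) * (3 / 4) ^ M ≤ 1 / N) :
    4 * (Nat.card {γ : Seed β M P N // ¬ (γ.falseHits α M L R str q).card < 12 * L + 1} : ℝ) ≤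
      Fintype.card (Seed β M P N) := by
  classical
  have hN : (0 : ℝ) < N := by exact_mod_cast NeZero.pos N
  have hP : (0 : ℝ) < P := by exact_mod_cast (Fact.out : P.Prime).pos
  have ha : (0 : ℝ) ≤ α / P := by positivity
  have ha' : (α / P : ℝ) ≤ 1 / 2 := by
    rw [div_le_div_iff₀ hP two_pos]; exact_mod_cast (by omega)
  set c : ℝ := ((Fintype.card (Seed β M P N) : ℕ) : ℝ) with hc
  have h1 : ∑ γ : Seed β M P N, ((γ.falseHits α M L R str q).card : ℝ) ≤ c * (3 * L) := by
    have h2 : ∀ γ : Seed β M P N, ((γ.falseHits α M L R str q).card : ℝ) =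
        ∑ w ∈ Finset.range L ×ˢ Finset.range N, (if γ.hash α M w.1 (str w.2) = γ.hash α M w.1 q ∧
          R < editDist q (str w.2) then (1 : ℝ) else 0) := by
      intro γ
      rw [Finset.sum_boole]
      unfold Seed.falseHits
      congr! 2
    simp only [h2]
    rw [Finset.sum_comm]
    have h3 : ∀ w ∈ Finset.range L ×ˢ Finset.range N, ∑ γ : Seed β M P N,
        (if γ.hash α M w.1 (str w.2) = γ.hash α M w.1 q ∧ R < editDist q (str w.2)
          then (1 : ℝ) else 0) ≤ c * (3 / N) := by
      intro w hw
      simp only [Finset.mem_product, Finset.mem_range] at hw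
      by_cases hR : R < editDist q (str w.2)
      · simp only [hR, and_true]
        refine (sum_hash_eq_le hα w.1 (str w.2) q).trans (mul_le_mul_of_nonneg_left ?_ ?_)
        · have h4 := collProb_le ha ha' M (str w.2) q (R + 1) (by rw [editDist_comm]; exact hR)
          have h5 : (2 : ℝ) ^ ((str w.2).length + q.length) * (3 / 4) ^ M ≤
              2 ^ (d + d) * (3 / 4) ^ M := by
            refine mul_le_mul_of_nonneg_right (pow_le_pow_right₀ (by norm_num) ?_) (by positivity)
            have := hstr _ hw.2
            omega
          have h6 : (3 : ℝ) / N = 1 / N + 1 / N + 1 / N := by ring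
          linarith
        · positivity
      · simp only [hR, and_false, if_false, Finset.sum_const_zero]
        positivity
    refine (Finset.sum_le_sum h3).trans (le_of_eq ?_)
    rw [Finset.sum_const, Finset.card_product, Finset.card_range, Finset.card_range, nsmul_eq_mul]
    push_cast
    field_simp
  have h4 : (Nat.card {γ : Seed β M P N // ¬ (γ.falseHits α M L R str q).card < 12 * L + 1} : ℝ) *
      (12 * L) ≤ ∑ γ : Seed β M P N, ((γ.falseHits α M L R str q).card : ℝ) := by
    rw [Nat.card_eq_fintype_card, Fintype.card_subtype, ← nsmul_eq_mul, ← Finset.sum_const]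
    refine (Finset.sum_le_sum fun γ hγ => ?_).trans
      (Finset.sum_le_sum_of_subset_of_nonneg (Finset.filter_subset _ _) fun γ _ _ =>
        Nat.cast_nonneg _)
    simp only [Finset.mem_filter, Finset.mem_univ, true_and] at hγ
    exact_mod_cast (by omega)
  have hL' : (0 : ℝ) < L := by exact_mod_cast hL
  have h5 := h4.trans h1
  refine le_of_mul_le_mul_right (a := 3 * (L : ℝ)) ?_ (by positivity)
  linarith

theorem two_mul_card_not_good_le [Fact P.Prime] [NeZero N] {α L R r d : ℕ} {str : ℕ → List β}
    {q : List β} (hα : 2 * α ≤ P) (hL0 : 0 < L) (hL : L ≤ P) (hrR : r ≤ R)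
    (hq : q.length ≤ d) (hstr : ∀ y < N, (str y).length ≤ d)
    (hyr : ∃ y < N, editDist q (str y) ≤ r)
    (hLp : 4 ≤ L * ((α / P : ℝ) ^ 2 / (1 - (α / P : ℝ) ^ 2)) ^ r)
    (hQ : (3 * (α / P : ℝ) ^ 2 / (1 - (α / P : ℝ) ^ 2)) ^ (R + 1) ≤ 1 / N)
    (hM : (2 : ℝ) ^ (d + d) * (3 / 4) ^ M ≤ 1 / N) :
    2 * Nat.card {γ : Seed β M P N // ¬ γ.Good α M L R (12 * L + 1) str q} ≤
      Fintype.card (Seed β M P N) := by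
  classical
  obtain ⟨y, hy, hyr⟩ := hyr
  have h1 := four_mul_card_not_hit_le (M := M) hα hL hrR hy hyr hLp
  have h2 := four_mul_card_falseHits_le (M := M) hα hq hstr hL0 hQ hM
  have h3 : Nat.card {γ : Seed β M P N // ¬ γ.Good α M L R (12 * L + 1) str q} ≤
      Nat.card {γ : Seed β M P N // ¬ γ.Hit α M L R str q} +
      Nat.card {γ : Seed β M P N // ¬ (γ.falseHits α M L R str q).card < 12 * L + 1} := by
    simp only [Nat.card_eq_fintype_card, Fintype.card_subtype]
    refine (Finset.card_le_card fun γ hγ => ?_).trans (Finset.card_union_le _ _)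
    simp only [Finset.mem_filter, Finset.mem_univ, true_and, Finset.mem_union] at hγ ⊢
    unfold Seed.Good at hγ
    tauto
  have h4 : (2 * Nat.card {γ : Seed β M P N // ¬ γ.Good α M L R (12 * L + 1) str q} : ℝ) ≤
      Fintype.card (Seed β M P N) := by
    have : (Nat.card {γ : Seed β M P N // ¬ γ.Good α M L R (12 * L + 1) str q} : ℝ) ≤ _ :=
      Nat.cast_le.2 h3
    push_cast at this
    linarith
  exact_mod_cast h4

/-- Among `G` independent groups all fail with probability at most `2⁻ᴳ`. -/
theorem two_pow_mul_card_forall_not_le {Γ : Type*} [Fintype Γ] (G : ℕ) (p : Γ → Prop)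
    (h : 2 * Nat.card {γ // ¬ p γ} ≤ Fintype.card Γ) :
    2 ^ G * Nat.card {ω : Fin G → Γ // ∀ g, ¬ p (ω g)} ≤ Fintype.card (Fin G → Γ) := by
  classical
  have h1 : Nat.card {ω : Fin G → Γ // ∀ g, ¬ p (ω g)} = Nat.card {γ // ¬ p γ} ^ G := by
    rw [Nat.card_congr (Equiv.subtypePiEquivPi (p := fun _ γ => ¬ p γ)), Nat.card_pi]
    simp
  rw [h1, ← mul_pow, Fintype.card_fun, Fintype.card_fin]
  exact Nat.pow_le_pow_left h G

end Group

/-! ### Parameters -/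

set_option maxHeartbeats 1000000 in
-- The ideal `a = A` has `A² = X = Q/(3 + Q)`, which solves `3a²/(1-a²) = Q = n^(-1/(cr))`. It would
-- give `8` in the second claim; the factor two is a reserve for rounding `A * P` down to an
-- integer. Rounding down can only help the third claim, where `Q^(⌊cr⌋+1) ≤ Q^(cr) = 1/n`.
theorem exists_threshold {n P r : ℕ} {c : ℝ} (hc : 1 ≤ c) (hn : 0 < n) (hr : r ≤ n)
    (hP : 12 * n ^ 2 ≤ P) : ∃ α : ℕ, 2 * α ≤ P ∧
      4 ≤ ((8 * 3 ^ r * ⌈(n : ℝ) ^ (1 / c)⌉₊ : ℕ) : ℝ) *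
        ((α / P : ℝ) ^ 2 / (1 - (α / P : ℝ) ^ 2)) ^ r ∧
      (3 * (α / P : ℝ) ^ 2 / (1 - (α / P : ℝ) ^ 2)) ^ (⌊c * r⌋₊ + 1) ≤ 1 / n := by
  have hn1 : (1 : ℝ) ≤ n := by exact_mod_cast hn
  have hn0 : (0 : ℝ) < n := by linarith
  have hPr : 12 * (n : ℝ) ^ 2 ≤ P := by exact_mod_cast hP
  have hP0 : (0 : ℝ) < P := by nlinarith
  have hm : (n : ℝ) ^ (1 / c) ≤ ⌈(n : ℝ) ^ (1 / c)⌉₊ := Nat.le_ceil _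
  have hm1 : 1 ≤ (n : ℝ) ^ (1 / c) := Real.one_le_rpow hn1 (by positivity)
  rcases Nat.eq_zero_or_pos r with rfl | hr0
  -- At scale `0` the walk never stays and reveals every character.
  · refine ⟨0, by omega, ?_, by simp⟩
    simp only [pow_zero, mul_one]
    push_cast
    linarith
  have hr1 : (1 : ℝ) ≤ r := by exact_mod_cast hr0
  have hrn : (r : ℝ) ≤ n := by exact_mod_cast hr
  have hcr : 1 ≤ c * r := by nlinarith
  set Q : ℝ := (n : ℝ) ^ (-(1 / (c * r))) with hQ
  have hQ0 : 0 < Q := Real.rpow_pos_of_pos hn0 _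
  have hQ1 : Q ≤ 1 := Real.rpow_le_one_of_one_le_of_nonpos hn1 (by
    rw [neg_nonpos]; positivity)
  have hQn : 1 / (n : ℝ) ≤ Q := by
    rw [one_div, ← Real.rpow_neg_one, hQ]
    refine Real.rpow_le_rpow_of_exponent_le hn1 (neg_le_neg ?_)
    rw [div_le_one (by linarith)]
    exact hcr
  set X : ℝ := Q / (3 + Q) with hX
  have hX0 : 0 < X := by positivity
  have hX4 : X ≤ 1 / 4 := by
    rw [hX, div_le_div_iff₀ (by linarith) (by norm_num)]; linarith
  have hXn : 1 / (4 * (n : ℝ)) ≤ X := by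
    calc 1 / (4 * (n : ℝ)) = (1 / n) / 4 := by field_simp
      _ ≤ Q / 4 := by linarith
      _ ≤ X := by
        rw [hX]
        exact div_le_div_of_nonneg_left hQ0.le (by linarith) (by linarith)
  set A : ℝ := Real.sqrt X with hA
  have hA0 : 0 < A := Real.sqrt_pos.2 hX0
  have hA2 : A ^ 2 = X := Real.sq_sqrt hX0.le
  have hAhalf : A ≤ 1 / 2 := by nlinarith
  have hAn : 1 / (2 * (n : ℝ)) ≤ A := by
    refine abs_le_of_sq_le_sq' ?_ hA0.le |>.2
    rw [hA2]
    refine le_trans ?_ hXn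
    rw [div_pow, one_pow]
    exact one_div_le_one_div_of_le (by positivity) (by nlinarith)
  set α : ℕ := ⌊A * P⌋₊ with hα
  have hα1 : (α : ℝ) ≤ A * P := Nat.floor_le (by positivity)
  have hα2 : A * P < α + 1 := Nat.lt_floor_add_one _
  set a : ℝ := α / P with ha
  have ha0 : 0 ≤ a := by positivity
  have haA : a ≤ A := by rw [ha, div_le_iff₀ hP0]; exact hα1
  -- Rounding costs less than `1`, which is a fraction of at most `1/(6r)` of `A * P`, because `A ≥
  -- 1/(2n)`, `P ≥ 12 n²` and `r ≤ n`.
  have hδ : A * (1 - 1 / (6 * r)) ≤ a := by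
    rw [ha, le_div_iff₀ hP0]
    have : 1 ≤ A * P * (1 / (6 * r)) := by
      rw [mul_one_div, le_div_iff₀ (by positivity), one_mul]
      calc 6 * (r : ℝ) ≤ 6 * n := by linarith
        _ = 1 / (2 * (n : ℝ)) * (12 * n ^ 2) := by field_simp; norm_num
        _ ≤ A * P := by gcongr
    linarith
  set δ : ℝ := 1 / (6 * r) with hδdef
  have hδ0 : 0 ≤ δ := by positivity
  have hδ1 : δ ≤ 1 := by rw [hδdef, div_le_one (by positivity)]; linarith
  have ha2X : a ^ 2 ≤ X := by rw [← hA2]; gcongr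
  have h1a : 0 < 1 - a ^ 2 := by linarith
  have hQX : Q * (1 - X) = 3 * X := by
    rw [hX]; field_simp; ring
  refine ⟨α, ?_, ?_, ?_⟩
  · have : (2 * α : ℝ) ≤ P := by nlinarith
    exact_mod_cast this
  · have e1 : ((8 * 3 ^ r * ⌈(n : ℝ) ^ (1 / c)⌉₊ : ℕ) : ℝ) * (a ^ 2 / (1 - a ^ 2)) ^ r =
        8 * ⌈(n : ℝ) ^ (1 / c)⌉₊ * (3 * a ^ 2 / (1 - a ^ 2)) ^ r := by
      rw [mul_div_assoc, mul_pow]; push_cast; ring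
    -- Two factors `1 - δ` are lost in `a²` and one in the denominator. Over `r` powers Bernoulli's
    -- inequality leaves `1 - 3 r δ = 1/2`.
    have e2 : Q * (1 - δ) ^ 3 ≤ 3 * a ^ 2 / (1 - a ^ 2) := by
      rw [le_div_iff₀ h1a]
      have g1 : X * (1 - δ) ^ 2 ≤ a ^ 2 := by
        rw [← hA2, ← mul_pow]
        exact pow_le_pow_left₀ (mul_nonneg hA0.le (by linarith)) hδ 2
      have g2 : (1 - δ) * (1 - a ^ 2) ≤ 1 - X := by
        nlinarith
      calc Q * (1 - δ) ^ 3 * (1 - a ^ 2) = (1 - δ) ^ 2 * Q * ((1 - δ) * (1 - a ^ 2)) := by ring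
        _ ≤ (1 - δ) ^ 2 * Q * (1 - X) := by gcongr
        _ = 3 * (X * (1 - δ) ^ 2) := by linear_combination (1 - δ) ^ 2 * hQX
        _ ≤ _ := by linarith
    have e3 : (1 : ℝ) / 2 ≤ ((1 - δ) ^ 3) ^ r := by
      rw [← pow_mul]
      have := one_add_mul_le_pow (a := -δ) (by linarith) (3 * r)
      rw [← sub_eq_add_neg] at this
      refine le_trans (le_of_eq ?_) this
      rw [hδdef]; push_cast; field_simp; norm_num
    have e4 : Q ^ r * (n : ℝ) ^ (1 / c) = 1 := by
      rw [hQ, ← Real.rpow_natCast, ← Real.rpow_mul hn0.le, ← Real.rpow_add hn0]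
      have : -(1 / (c * r)) * (r : ℝ) + 1 / c = 0 := by field_simp; ring
      rw [this, Real.rpow_zero]
    rw [e1]
    have h1δ : 0 ≤ 1 - δ := by linarith
    calc (4 : ℝ) = 8 * (Q ^ r * (n : ℝ) ^ (1 / c)) * (1 / 2) := by rw [e4]; norm_num
      _ ≤ 8 * (Q ^ r * ⌈(n : ℝ) ^ (1 / c)⌉₊) * ((1 - δ) ^ 3) ^ r :=
        mul_le_mul (mul_le_mul_of_nonneg_left (mul_le_mul_of_nonneg_left hm (by positivity))
          (by norm_num)) e3 (by norm_num) (by positivity)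
      _ = 8 * ⌈(n : ℝ) ^ (1 / c)⌉₊ * (Q * (1 - δ) ^ 3) ^ r := by rw [mul_pow]; ring
      _ ≤ _ := by gcongr
  · have e1 : 3 * a ^ 2 / (1 - a ^ 2) ≤ Q := by
      rw [div_le_iff₀ h1a]; nlinarith
    have e0 : 0 ≤ 3 * a ^ 2 / (1 - a ^ 2) := by positivity
    calc (3 * a ^ 2 / (1 - a ^ 2)) ^ (⌊c * r⌋₊ + 1) ≤ Q ^ (⌊c * r⌋₊ + 1) := by gcongr
      _ = Q ^ ((⌊c * r⌋₊ : ℝ) + 1) := by rw [← Nat.cast_add_one, Real.rpow_natCast]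
      _ ≤ Q ^ (c * r) :=
        Real.rpow_le_rpow_of_exponent_ge hQ0 hQ1 (Nat.lt_floor_add_one _).le
      _ = 1 / n := by
        rw [hQ, ← Real.rpow_mul hn0.le]
        have : -(1 / (c * r)) * (c * r) = -1 := by field_simp
        rw [this, Real.rpow_neg_one, one_div]

/-- This fixes the number of steps: `4 * (3/4)^5 = 243/256 < 1` takes care of the string lengths,
and `(3/4)^3 = 27/64 ≤ 1/2` supplies the factor `2^(-l)`. -/
theorem two_pow_mul_pow_le {n d l : ℕ} (hn : 0 < n) (hl : n ≤ 2 ^ l) :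
    (2 : ℝ) ^ (d + d) * (3 / 4) ^ (5 * d + 3 * l) ≤ 1 / n := by
  have hn0 : (0 : ℝ) < n := by exact_mod_cast hn
  have hl' : (n : ℝ) ≤ 2 ^ l := by exact_mod_cast hl
  have e : (2 : ℝ) ^ (d + d) * (3 / 4) ^ (5 * d + 3 * l) = (243 / 256) ^ d * (27 / 64) ^ l := by
    rw [pow_add, pow_add, pow_mul, pow_mul, ← mul_assoc, ← mul_pow, ← mul_pow]
    norm_num
  rw [e]
  calc (243 / 256 : ℝ) ^ d * (27 / 64) ^ l ≤ 1 * (1 / 2) ^ l :=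
        mul_le_mul (pow_le_one₀ (by norm_num) (by norm_num))
          (pow_le_pow_left₀ (by norm_num) (by norm_num) _) (by positivity) (by norm_num)
    _ = 1 / 2 ^ l := by rw [one_mul, one_div_pow]
    _ ≤ 1 / n := one_div_le_one_div_of_le hn0 hl'

/-! ### Reasoning about programs -/

namespace WordRAM

/-- Started in `s`, the program `p` halts after `t` steps in a state `s'` such that `Q s' t`. -/
def Runs (E : Env) (p : Prog) (s : State) (Q : State → ℕ → Prop) : Prop :=
  ∃ s' t, Exec E p s s' t ∧ Q s' t

variable {E : Env} {p q : Prog} {s : State} {Q Q' : State → ℕ → Prop} {e a : Expr} {x : ℕ}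

theorem Runs.mono (h : Runs E p s Q) (h' : ∀ s' t, Q s' t → Q' s' t) : Runs E p s Q' := by
  obtain ⟨s', t, h1, h2⟩ := h
  exact ⟨s', t, h1, h' _ _ h2⟩

theorem Runs.skip (h : Q s 1) : Runs E .skip s Q := ⟨_, _, .skip s, h⟩

theorem Runs.assign {v : ℕ} (hv : e.eval E s = v) (h : Q (s.setReg x v) (e.cost + 1)) :
    Runs E (.assign x e) s Q := by
  subst hv
  exact ⟨_, _, .assign s x e, h⟩

theorem Runs.store {i v : ℕ} (hi : a.eval E s = i) (hv : e.eval E s = v)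
    (h : Q (s.setMem E i v) (a.cost + e.cost + 1)) : Runs E (.store a e) s Q := by
  subst hi hv
  exact ⟨_, _, .store s a e, h⟩

theorem Runs.seq (h : Runs E p s fun s' t => Runs E q s' fun s'' t' => Q s'' (t + t')) :
    Runs E (.seq p q) s Q := by
  obtain ⟨s', t, h1, s'', t', h2, h3⟩ := h
  exact ⟨_, _, .seq h1 h2, h3⟩

theorem Runs.ite (h1 : e.eval E s ≠ 0 → Runs E p s fun s' t => Q s' (e.cost + 1 + t))
    (h2 : e.eval E s = 0 → Runs E q s fun s' t => Q s' (e.cost + 1 + t)) :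
    Runs E (.ite e p q) s Q := by
  by_cases h : e.eval E s = 0
  · obtain ⟨s', t, h3, h4⟩ := h2 h
    exact ⟨_, _, .ite_false h h3, h4⟩
  · obtain ⟨s', t, h3, h4⟩ := h1 h
    exact ⟨_, _, .ite_true h h3, h4⟩

/-- The rule for loops: `I` is an invariant of the state and the time so far, `μ` decreases. -/
theorem Runs.loop (I : State → ℕ → Prop) (μ : State → ℕ)
    (hbody : ∀ s t, I s t → e.eval E s ≠ 0 →
      Runs E p s fun s' t' => I s' (t + (e.cost + 1 + t')) ∧ μ s' < μ s)
    (h0 : I s 0) (hQ : ∀ s' t, I s' t → e.eval E s' = 0 → Q s' (t + (e.cost + 1))) :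
    Runs E (.loop e p) s Q := by
  have key : ∀ (k : ℕ) (s : State) (t : ℕ), μ s < k → I s t →
      ∃ s' t', Exec E (.loop e p) s s' t' ∧
        ∃ t₀, I s' t₀ ∧ e.eval E s' = 0 ∧ t + t' = t₀ + (e.cost + 1) := by
    intro k
    induction k with
    | zero => intro s t h; omega
    | succ k ih =>
      intro s t hμ hI
      by_cases h : e.eval E s = 0
      · exact ⟨s, _, .loop_false h, t, hI, h, rfl⟩
      · obtain ⟨s', t', h1, h2, h3⟩ := hbody s t hI h
        obtain ⟨s'', t'', h4, t₀, h5, h6, h7⟩ := ih s' _ (by omega) h2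
        exact ⟨s'', _, .loop_true h h1 h4, t₀, h5, h6, by omega⟩
  obtain ⟨s', t', h1, t₀, h2, h3, h4⟩ := key _ s 0 (Nat.lt_succ_self _) h0
  refine ⟨s', t', h1, ?_⟩
  have := hQ s' t₀ h2 h3
  rwa [← h4, zero_add] at this

@[simp] theorem setReg_reg (s : State) (x v y : ℕ) :
    (s.setReg x v).reg y = if y = x then v else s.reg y := by
  simp only [State.setReg, Function.update_apply]

@[simp] theorem setReg_mem (s : State) (x v : ℕ) : (s.setReg x v).mem = s.mem := rfl

@[simp] theorem setMem_reg (s : State) (E : Env) (i v : ℕ) : (s.setMem E i v).reg = s.reg := by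
  unfold State.setMem; split <;> rfl

theorem setMem_mem (s : State) (i v j : ℕ) (h : i < E.space) :
    (s.setMem E i v).mem j = if j = i then v else s.mem j := by
  simp only [State.setMem, if_pos h, Function.update_apply]

/-- The static data consists of sixteen interleaved sections. -/
def entry (E : Env) (k i : ℕ) : ℕ := E.data (16 * i + k)

/-- The entry with index `e` of section `k`. -/
def Expr.fld (k : ℕ) (e : Expr) : Expr :=
  .data (.op .add (.op .mul (.const 16) e) (.const k))

/-- Entry `i` of section `0`. -/
def Expr.hdr (i : ℕ) : Expr := .data (.const (16 * i))

/-- All section indices stay below a common bound `B`, so one inequality between `B` and the word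
size rules out overflow in every address. -/
theorem Expr.eval_fld {k i B : ℕ} (hw : 16 * B + 16 ≤ 2 ^ E.w) (hi : i < B) (hk : k < 16)
    (he : e.eval E s = i) : (e.fld k).eval E s = entry E k i := by
  simp only [Expr.fld, Expr.eval, Op.eval, he, entry]
  rw [Nat.mod_eq_of_lt (by omega : 16 < 2 ^ E.w), Nat.mod_eq_of_lt (by omega : k < 2 ^ E.w),
    Nat.mod_eq_of_lt (by omega : 16 * i < 2 ^ E.w), Nat.mod_eq_of_lt (by omega)]

theorem Expr.eval_hdr {i B : ℕ} (hw : 16 * B + 16 ≤ 2 ^ E.w) (hi : i < B) :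
    (Expr.hdr i).eval E s = entry E 0 i := by
  simp only [Expr.hdr, Expr.eval, entry]
  rw [Nat.mod_eq_of_lt (by omega), add_zero]

theorem Expr.eval_const {c : ℕ} (h : c < 2 ^ E.w) : (Expr.const c).eval E s = c :=
  Nat.mod_eq_of_lt h

theorem Expr.eval_add {a b : Expr} {u v : ℕ} (ha : a.eval E s = u) (hb : b.eval E s = v)
    (h : u + v < 2 ^ E.w) : (Expr.op .add a b).eval E s = u + v := by
  simp only [Expr.eval, Op.eval, ha, hb]
  exact Nat.mod_eq_of_lt h

theorem Expr.eval_mul {a b : Expr} {u v : ℕ} (ha : a.eval E s = u) (hb : b.eval E s = v)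
    (h : u * v < 2 ^ E.w) : (Expr.op .mul a b).eval E s = u * v := by
  simp only [Expr.eval, Op.eval, ha, hb]
  exact Nat.mod_eq_of_lt h

theorem Expr.eval_sub {a b : Expr} {u v : ℕ} (ha : a.eval E s = u) (hb : b.eval E s = v) :
    (Expr.op .sub a b).eval E s = u - v := by
  simp only [Expr.eval, Op.eval, ha, hb]

theorem Expr.eval_mod {a b : Expr} {u v : ℕ} (ha : a.eval E s = u) (hb : b.eval E s = v) :
    (Expr.op .mod a b).eval E s = u % v := by
  simp only [Expr.eval, Op.eval, ha, hb]

theorem Expr.eval_lt {a b : Expr} {u v : ℕ} (hw : 1 < 2 ^ E.w) (ha : a.eval E s = u)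
    (hb : b.eval E s = v) : (Expr.op .lt a b).eval E s = if u < v then 1 else 0 := by
  simp only [Expr.eval, Op.eval, ha, hb, Nat.mod_eq_of_lt hw]

theorem Expr.eval_eq {a b : Expr} {u v : ℕ} (hw : 1 < 2 ^ E.w) (ha : a.eval E s = u)
    (hb : b.eval E s = v) : (Expr.op .eq a b).eval E s = if u = v then 1 else 0 := by
  simp only [Expr.eval, Op.eval, ha, hb, Nat.mod_eq_of_lt hw]

theorem Expr.eval_reg {v : ℕ} (h : s.reg x = v) : (Expr.reg x).eval E s = v := h

theorem Expr.eval_query {v : ℕ} (h : e.eval E s = v) : (Expr.query e).eval E s = E.query v := by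
  simp only [Expr.eval, h]

theorem Expr.eval_mem {v : ℕ} (h : e.eval E s = v) : (Expr.mem e).eval E s = s.mem v := by
  simp only [Expr.eval, h]

/-! ### The hash program -/

/-- One step of the walk along the query. -/
def hashStep : Prog :=
  .seq (.ite (.op .lt (.reg 7) (.reg 0)) (.assign 9 (.op .add (.query (.reg 7)) (.const 1)))
    (.assign 9 (.const 0)))
  (.seq (.assign 9 (.op .add (.op .add (.fld 8 (.reg 2)) (.op .mul (.reg 6) (.hdr 1))) (.reg 9)))
  (.seq (.assign 10 (.op .mod (.op .add (.fld 1 (.reg 9)) (.op .mul (.reg 4) (.fld 2 (.reg 9))))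
    (.hdr 2)))
  (.seq (.ite (.op .lt (.reg 10) (.fld 6 (.reg 2))) .skip
      (.seq (.assign 7 (.op .add (.reg 7) (.const 1)))
        (.ite (.op .lt (.reg 10) (.op .mul (.const 2) (.fld 6 (.reg 2)))) .skip
          (.assign 8 (.op .mod (.op .add (.reg 8) (.fld 3 (.reg 9))) (.hdr 0))))))
    (.assign 6 (.op .add (.reg 6) (.const 1))))))

/-- Compute the fingerprint of the query for table `reg 4` of block `reg 2` in register `8`. -/
def hashProg : Prog :=
  .seq (.assign 6 (.const 0)) (.seq (.assign 7 (.const 0)) (.seq (.assign 8 (.const 0))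
    (.loop (.op .lt (.reg 6) (.fld 7 (.reg 2))) hashStep)))

/-- The code of a character; `none` stands for the end of the string. -/
def charCode {σ : ℕ} : Option (Fin σ) → ℕ
  | none => 0
  | some a => a + 1

/-- The query tape of the environment holds `q`, and register `0` its length. -/
structure HoldsQuery {σ : ℕ} (E : Env) (q : List (Fin σ)) : Prop where
  query : ∀ (i : ℕ) (h : i < q.length), E.query i = q[i]

/-- The static data holds what is needed for the fingerprint number `j` of block `b`. -/
structure HoldsHash {σ n : ℕ} (E : Env) (B b j α m : ℕ) (ρ : ℕ → Option (Fin σ) → ℕ)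
    (Z : ℕ → Option (Fin σ) → ZMod n) : Prop where
  hw : 16 * B + 16 ≤ 2 ^ E.w
  hB : 3 < B
  hb : b < B
  modulus : entry E 0 0 = n
  threshold : entry E 6 b = α
  steps : entry E 7 b = m
  hm : m < B
  hα : 2 * α < B
  hn : 2 * n < B
  idx : ∀ t < m, ∀ c : Option (Fin σ), entry E 8 b + t * entry E 0 1 + charCode c < B
  val_lt : ∀ t < m, ∀ c : Option (Fin σ),
    entry E 1 (entry E 8 b + t * entry E 0 1 + charCode c) +
      j * entry E 2 (entry E 8 b + t * entry E 0 1 + charCode c) < 2 ^ E.w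
  val : ∀ t < m, ∀ c : Option (Fin σ),
    (entry E 1 (entry E 8 b + t * entry E 0 1 + charCode c) +
      j * entry E 2 (entry E 8 b + t * entry E 0 1 + charCode c)) % entry E 0 2 = ρ t c
  key_lt : ∀ t < m, ∀ c : Option (Fin σ),
    entry E 3 (entry E 8 b + t * entry E 0 1 + charCode c) < n
  key : ∀ t < m, ∀ c : Option (Fin σ),
    (entry E 3 (entry E 8 b + t * entry E 0 1 + charCode c) : ZMod n) = Z t c

/-- The registers outside `lo, …, hi` and the scratch memory are the same. -/
def SameExcept (lo hi : ℕ) (s s' : State) : Prop :=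
  ∀ x, x < lo ∨ hi < x → s'.reg x = s.reg x

/-- Register `2` is the block, `4` the table, `6` the step, `7` the position in the query and `8`
the fingerprint so far. Register `9` holds first the character code and then the index in the random
tables, `10` the value `A + j B` modulo the prime. The position never exceeds the step number, so it
cannot overflow either. -/
theorem hashStep_runs {σ n : ℕ} [NeZero n] {B b j α m : ℕ} {ρ : ℕ → Option (Fin σ) → ℕ}
    {Z : ℕ → Option (Fin σ) → ZMod n} {q : List (Fin σ)} (hq : HoldsQuery E q)
    (H : HoldsHash E B b j α m ρ Z) {t i f : ℕ} (h0 : s.reg 0 = q.length) (h2 : s.reg 2 = b)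
    (h4 : s.reg 4 = j) (h6 : s.reg 6 = t) (h7 : s.reg 7 = i) (h8 : s.reg 8 = f) (ht : t < m)
    (hi : i ≤ t) (hf : f < n) :
    Runs E hashStep s fun s' T => SameExcept 6 10 s s' ∧ s'.mem = s.mem ∧ T ≤ 100 ∧
      s'.reg 6 = t + 1 ∧ s'.reg 7 ≤ t + 1 ∧ s'.reg 8 < n ∧
      q.drop (s'.reg 7) = advance α (ρ t) (q.drop i) ∧
      (s'.reg 8 : ZMod n) = f + if Emits α (ρ t) (q.drop i) then Z t (q.drop i).head? else 0 := by
  have hw := H.hw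
  have hB := H.hB
  have hm := H.hm
  have hαB := H.hα
  have hnB := H.hn
  have hidx := H.idx t ht (q.drop i).head?
  have h1w : 1 < 2 ^ E.w := by omega
  have hcode : charCode (q.drop i).head? = if h : i < q.length then (q[i] : ℕ) + 1 else 0 := by
    rw [List.head?_drop]
    split_ifs with h
    · rw [List.getElem?_eq_getElem h]; rfl
    · rw [List.getElem?_eq_none (by omega)]; rfl
  unfold hashStep
  -- after the first two assignments register `9` holds the index
  set idx := entry E 8 b + t * entry E 0 1 + charCode (q.drop i).head? with hidxdef
  have step1 : Runs E (.ite (.op .lt (.reg 7) (.reg 0))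
      (.assign 9 (.op .add (.query (.reg 7)) (.const 1))) (.assign 9 (.const 0))) s
      fun s' T => s' = s.setReg 9 (charCode (q.drop i).head?) ∧ T ≤ 10 := by
    have hc := Expr.eval_lt h1w (Expr.eval_reg (E := E) h7) (Expr.eval_reg (E := E) h0)
    refine Runs.ite (fun h => ?_) (fun h => ?_)
    · rw [hc] at h
      have hlt : i < q.length := by by_contra h'; simp [h'] at h
      rw [dif_pos hlt] at hcode
      refine Runs.assign (v := charCode (q.drop i).head?) ?_ ⟨rfl, by simp [Expr.cost]⟩
      rw [hcode]
      exact Expr.eval_add ((Expr.eval_query (Expr.eval_reg h7)).trans (hq.query i hlt))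
        (Expr.eval_const h1w) (by omega)
    · rw [hc] at h
      have hlt : ¬ i < q.length := by intro h'; simp [h'] at h
      rw [dif_neg hlt] at hcode
      refine Runs.assign (v := charCode (q.drop i).head?) ?_ ⟨rfl, by simp [Expr.cost]⟩
      rw [hcode]
      exact Expr.eval_const (by omega)
  refine Runs.seq (step1.mono ?_)
  rintro s1 T1 ⟨rfl, hT1⟩
  refine Runs.seq (Runs.assign (v := idx) ?_ ?_)
  · exact Expr.eval_add (Expr.eval_add (Expr.eval_fld hw H.hb (by norm_num)
      (Expr.eval_reg (by simpa using h2))) (Expr.eval_mul (Expr.eval_reg (by simpa using h6))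
      (Expr.eval_hdr hw (by omega)) (by omega)) (by omega)) (Expr.eval_reg (by simp)) (by omega)
  refine Runs.seq (Runs.assign (v := ρ t (q.drop i).head?) ?_ ?_)
  · rw [← H.val t ht, ← hidxdef]
    have := H.val_lt t ht (q.drop i).head?
    rw [← hidxdef] at this
    have h9 := Expr.eval_reg (E := E) (s := (s.setReg 9 (charCode (q.drop i).head?)).setReg 9 idx)
      (x := 9) (v := idx) (by simp)
    exact Expr.eval_mod (Expr.eval_add (Expr.eval_fld hw hidx (by norm_num) h9)
      (Expr.eval_mul (Expr.eval_reg (by simpa using h4)) (Expr.eval_fld hw hidx (by norm_num) h9)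
      (by omega)) (by omega)) (Expr.eval_hdr hw (by omega))
  set v := ρ t (q.drop i).head? with hv
  set s2 := ((s.setReg 9 (charCode (q.drop i).head?)).setReg 9 idx).setReg 10 v with hs2
  have hα2 : (Expr.fld 6 (.reg 2)).eval E s2 = α :=
    (Expr.eval_fld hw H.hb (by norm_num) (Expr.eval_reg (by simpa [hs2] using h2))).trans
      H.threshold
  have hc1 : (Expr.op .lt (.reg 10) (.fld 6 (.reg 2))).eval E s2 = if v < α then 1 else 0 :=
    Expr.eval_lt h1w (Expr.eval_reg (by simp [hs2])) hα2
  refine Runs.seq (Runs.ite (fun h => Runs.skip ?_) (fun h => ?_))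
  · rw [hc1] at h
    have hlt : v < α := by by_contra h'; simp [h'] at h
    refine Runs.assign (v := t + 1) (Expr.eval_add (Expr.eval_reg (by simpa [hs2] using h6))
      (Expr.eval_const h1w) (by omega)) ?_
    refine ⟨?_, by simp [hs2], by simp only [Expr.cost, Expr.fld, Expr.hdr]; omega, by simp,
      by simp [hs2, h7]; omega, by simpa [hs2, h8] using hf, ?_, ?_⟩
    · intro x hx
      simp only [setReg_reg, hs2]
      split_ifs <;> omega
    · simp only [setReg_reg, hs2, advance]
      rw [if_pos hlt]
      simp [h7]
    · have : ¬ Emits α (ρ t) (q.drop i) := by simp only [Emits]; omega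
      rw [if_neg this]
      simp [hs2, h8]
  · rw [hc1] at h
    have hlt : ¬ v < α := by intro h'; simp [h'] at h
    refine Runs.seq (Runs.assign (v := i + 1) (Expr.eval_add
      (Expr.eval_reg (by simpa [hs2] using h7)) (Expr.eval_const h1w) (by omega)) ?_)
    have hα3 : (Expr.op .lt (.reg 10) (.op .mul (.const 2) (.fld 6 (.reg 2)))).eval E
        (s2.setReg 7 (i + 1)) = if v < 2 * α then 1 else 0 :=
      Expr.eval_lt h1w (Expr.eval_reg (by simp [hs2])) (Expr.eval_mul (Expr.eval_const (by omega))
        ((Expr.eval_fld hw H.hb (by norm_num) (Expr.eval_reg (by simpa [hs2] using h2))).trans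
          H.threshold) (by omega))
    have hdrop : q.drop (i + 1) = advance α (ρ t) (q.drop i) := by
      simp only [advance]
      rw [if_neg hlt, List.tail_drop]
    refine Runs.ite (fun h' => Runs.skip ?_) (fun h' => ?_)
    · rw [hα3] at h'
      have hlt' : v < 2 * α := by by_contra h''; simp [h''] at h'
      refine Runs.assign (v := t + 1) (Expr.eval_add (Expr.eval_reg (by simpa [hs2] using h6))
        (Expr.eval_const h1w) (by omega)) ?_
      refine ⟨?_, by simp [hs2], by simp only [Expr.cost, Expr.fld, Expr.hdr]; omega, by simp,
        by simp [hs2]; omega, by simpa [hs2, h8] using hf, by simpa [hs2] using hdrop, ?_⟩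
      · intro x hx
        simp only [setReg_reg, hs2]
        split_ifs <;> omega
      · have : ¬ Emits α (ρ t) (q.drop i) := by simp only [Emits]; omega
        rw [if_neg this]
        simp [hs2, h8]
    · rw [hα3] at h'
      have hlt' : ¬ v < 2 * α := by intro h''; simp [h''] at h'
      have hkey := H.key_lt t ht (q.drop i).head?
      rw [← hidxdef] at hkey
      refine Runs.assign (v := (f + entry E 3 idx) % n) ?_ ?_
      · rw [← H.modulus] at hkey hnB hf ⊢
        exact Expr.eval_mod (Expr.eval_add (Expr.eval_reg (by simpa [hs2] using h8))
          (Expr.eval_fld hw hidx (by norm_num) (Expr.eval_reg (by simp [hs2]))) (by omega))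
          (Expr.eval_hdr hw (by omega))
      refine Runs.assign (v := t + 1) (Expr.eval_add (Expr.eval_reg (by simpa [hs2] using h6))
        (Expr.eval_const h1w) (by omega)) ?_
      refine ⟨?_, by simp [hs2], by simp only [Expr.cost, Expr.fld, Expr.hdr]; omega, by simp,
        by simp [hs2]; omega, by simpa using Nat.mod_lt _ (NeZero.pos n),
        by simpa [hs2] using hdrop, ?_⟩
      · intro x hx
        simp only [setReg_reg, hs2]
        split_ifs <;> omega
      · have : Emits α (ρ t) (q.drop i) := by simp only [Emits]; omega
        rw [if_pos this, ← H.key t ht, ← hidxdef]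
        simp

theorem hashProg_runs {σ n : ℕ} [NeZero n] {B b j α m : ℕ} {ρ : ℕ → Option (Fin σ) → ℕ}
    {Z : ℕ → Option (Fin σ) → ZMod n} {q : List (Fin σ)} (hq : HoldsQuery E q)
    (H : HoldsHash E B b j α m ρ Z) (h0 : s.reg 0 = q.length) (h2 : s.reg 2 = b)
    (h4 : s.reg 4 = j) :
    Runs E hashProg s fun s' T => SameExcept 6 10 s s' ∧ s'.mem = s.mem ∧ T ≤ 120 * (m + 1) ∧
      s'.reg 8 = (fingerprint α m ρ Z q).val := by
  have hw := H.hw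
  have hB := H.hB
  unfold hashProg
  refine Runs.seq (Runs.assign (v := 0) (Expr.eval_const (by omega)) ?_)
  refine Runs.seq (Runs.assign (v := 0) (Expr.eval_const (by omega)) ?_)
  refine Runs.seq (Runs.assign (v := 0) (Expr.eval_const (by omega)) ?_)
  have hcond : ∀ s' : State, SameExcept 6 10 s s' →
      (Expr.op .lt (.reg 6) (.fld 7 (.reg 2))).eval E s' = if s'.reg 6 < m then 1 else 0 := by
    intro s' hs'
    refine Expr.eval_lt (by omega) (Expr.eval_reg rfl) ((Expr.eval_fld hw H.hb (by norm_num)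
      (Expr.eval_reg ((hs' 2 (by omega)).trans h2))).trans H.steps)
  -- The fingerprint so far plus the fingerprint of the remaining walk is constant.
  refine Runs.loop (fun s' T => SameExcept 6 10 s s' ∧ s'.mem = s.mem ∧ s'.reg 6 ≤ m ∧
    s'.reg 7 ≤ s'.reg 6 ∧ s'.reg 8 < n ∧ T ≤ 120 * s'.reg 6 ∧
    (s'.reg 8 : ZMod n) + fingerprint α (m - s'.reg 6) (fun u => ρ (s'.reg 6 + u))
      (fun u => Z (s'.reg 6 + u)) (q.drop (s'.reg 7)) = fingerprint α m ρ Z q)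
    (fun s' => m - s'.reg 6) ?_ ?_ ?_
  · rintro s' T ⟨hs, hmem, h6, h7, h8, hT, hfp⟩ hne
    rw [hcond s' hs] at hne
    have hlt : s'.reg 6 < m := by by_contra h'; simp [h'] at hne
    refine (hashStep_runs hq H ((hs 0 (by omega)).trans h0) ((hs 2 (by omega)).trans h2)
      ((hs 4 (by omega)).trans h4) rfl rfl rfl hlt h7 h8).mono ?_
    rintro s'' T' ⟨hs', hmem', hT', h6', h7', h8', hdrop, hval⟩
    refine ⟨⟨fun x hx => (hs' x hx).trans (hs x hx), hmem'.trans hmem, by omega, by omega, h8',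
      ?_, ?_⟩, by omega⟩
    · rw [h6']
      simp only [Expr.cost, Expr.fld]
      omega
    · rw [hval, h6', ← hfp, hdrop]
      obtain ⟨k, hk⟩ : ∃ k, m - s'.reg 6 = k + 1 := ⟨m - s'.reg 6 - 1, by omega⟩
      rw [hk, show m - (s'.reg 6 + 1) = k by omega]
      simp only [fingerprint, add_zero]
      have e1 : (fun u => ρ (s'.reg 6 + 1 + u)) = fun u => ρ (s'.reg 6 + (u + 1)) := by
        funext u; congr 1; omega
      have e2 : (fun u => Z (s'.reg 6 + 1 + u)) = fun u => Z (s'.reg 6 + (u + 1)) := by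
        funext u; congr 1; omega
      rw [e1, e2, add_assoc]
  · refine ⟨?_, rfl, by simp, by simp, by simpa using NeZero.pos n, by simp, by simp⟩
    intro x hx
    simp only [setReg_reg]
    split_ifs <;> omega
  · rintro s' T ⟨hs, hmem, h6, h7, h8, hT, hfp⟩ hz
    rw [hcond s' hs] at hz
    have hge : ¬ s'.reg 6 < m := by intro h'; simp [h'] at hz
    have h6' : s'.reg 6 = m := by omega
    refine ⟨hs, hmem, ?_, ?_⟩
    · simp only [Expr.cost, Expr.fld]
      omega
    · rw [h6', Nat.sub_self] at hfp
      simp only [fingerprint, add_zero] at hfp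
      rw [← hfp, ZMod.val_natCast, Nat.mod_eq_of_lt h8]

end WordRAM

namespace WordRAM

variable {E : Env} {p q : Prog} {s : State} {Q Q' : State → ℕ → Prop} {e a : Expr} {x : ℕ}

/-! ### The distance program -/

/-- The radius of the current block. -/
def Expr.radius : Expr := .fld 4 (.reg 2)

/-- Fill the scratch cells `0, …, 2 * R + 2` with the first row of the dynamic program. -/
def initProg : Prog :=
  .seq (.assign 11 (.const 0))
    (.loop (.op .lt (.reg 11) (.op .add (.op .mul (.const 2) .radius) (.const 3)))
      (.seq (.ite (.op .lt (.reg 11) (.op .add .radius (.const 1)))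
          (.store (.reg 11) (.op .add .radius (.const 1)))
          (.store (.reg 11) (.op .sub (.reg 11) (.op .add .radius (.const 1)))))
        (.assign 11 (.op .add (.reg 11) (.const 1)))))

/-- Compute one cell of the dynamic program. -/
def cellProg : Prog :=
  .seq (.assign 13 (.op .add (.mem (.reg 11)) (.op .sub (.const 1) (.op .eq (.query (.reg 12))
    (.fld 14 (.op .add (.op .mul (.reg 5) (.hdr 3))
      (.op .sub (.op .add (.reg 12) (.reg 11)) (.op .add .radius (.const 1)))))))))
  (.seq (.assign 14 (.op .add (.mem (.op .add (.reg 11) (.const 1))) (.const 1)))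
  (.seq (.ite (.op .lt (.reg 14) (.reg 13)) (.assign 13 (.reg 14)) .skip)
  (.seq (.assign 14 (.op .add (.mem (.op .sub (.reg 11) (.const 1))) (.const 1)))
  (.seq (.ite (.op .lt (.reg 14) (.reg 13)) (.assign 13 (.reg 14)) .skip)
  (.seq (.store (.reg 11) (.reg 13))
    (.assign 11 (.op .add (.reg 11) (.const 1))))))))

/-- Compute one row of the dynamic program. -/
def rowProg : Prog :=
  .seq (.assign 11 (.const 1))
    (.seq (.loop (.op .lt (.reg 11) (.op .add (.op .mul (.const 2) .radius) (.const 2))) cellProg)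
      (.assign 12 (.op .add (.reg 12) (.const 1))))

/-- Decide whether string number `reg 5` has distance at most the radius of block `reg 2` from the
query; the answer goes to register `1`. -/
def checkProg : Prog :=
  .seq initProg
  (.seq (.assign 12 (.const 0))
  (.seq (.loop (.op .lt (.reg 12) (.reg 0)) rowProg)
  (.seq (.assign 11 (.op .sub (.op .add (.op .add (.fld 13 (.reg 5)) .radius) (.const 1)) (.reg 0)))
    (.assign 1 (.op .mul (.op .lt (.reg 11) (.op .add (.op .mul (.const 2) .radius) (.const 2)))
      (.op .lt (.mem (.reg 11)) (.op .add .radius (.const 1))))))))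

/-- The static data holds the string `x` with number `y`. -/
structure HoldsString {σ : ℕ} (E : Env) (y : ℕ) (x : List (Fin σ)) : Prop where
  len : entry E 13 y = x.length
  char : ∀ (j : ℕ) (h : j < x.length), entry E 14 (y * entry E 0 3 + j) = x[j]

/-- The words and the memory are large enough for the dynamic program. -/
structure BandFits (E : Env) (B b R y lq lx : ℕ) : Prop where
  hw : 16 * B + 16 ≤ 2 ^ E.w
  hb : b < B
  hy : y < B
  radius : entry E 4 b = R
  idx : y * entry E 0 3 + lq + lx + 2 * R + 5 < B
  space : 2 * R + 3 + lx ≤ E.space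

variable {B b R y lq lx : ℕ}

theorem BandFits.eval_radius (H : BandFits E B b R y lq lx) (h2 : s.reg 2 = b) :
    Expr.radius.eval E s = R :=
  (Expr.eval_fld H.hw H.hb (by norm_num) (Expr.eval_reg h2)).trans H.radius

theorem BandFits.eval_radius_succ (H : BandFits E B b R y lq lx) (h2 : s.reg 2 = b) :
    (Expr.op .add .radius (.const 1)).eval E s = R + 1 := by
  have hw := H.hw
  have := H.idx
  exact Expr.eval_add (H.eval_radius h2) (Expr.eval_const (by omega)) (by omega)

theorem BandFits.eval_width (H : BandFits E B b R y lq lx) (h2 : s.reg 2 = b) (c : ℕ)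
    (hc : c ≤ 3) : (Expr.op .add (.op .mul (.const 2) .radius) (.const c)).eval E s =
      2 * R + c := by
  have hw := H.hw
  have := H.idx
  exact Expr.eval_add (Expr.eval_mul (Expr.eval_const (by omega)) (H.eval_radius h2) (by omega))
    (Expr.eval_const (by omega)) (by omega)

theorem initProg_runs (H : BandFits E B b R y lq lx) (h2 : s.reg 2 = b) :
    Runs E initProg s fun s' T => SameExcept 11 14 s s' ∧ T ≤ 60 * (2 * R + 4) ∧
      ∀ (e : ℕ → ℕ → ℕ), ∀ p ≤ 2 * R + 2, s'.mem p = band R e 0 p := by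
  have hw := H.hw
  have hidx := H.idx
  have hsp := H.space
  have h1w : 1 < 2 ^ E.w := by omega
  unfold initProg
  refine Runs.seq (Runs.assign (v := 0) (Expr.eval_const (by omega)) ?_)
  have hcond : ∀ s' : State, SameExcept 11 14 s s' →
      (Expr.op .lt (.reg 11) (.op .add (.op .mul (.const 2) .radius) (.const 3))).eval E s' =
        if s'.reg 11 < 2 * R + 3 then 1 else 0 := by
    intro s' hs'
    exact Expr.eval_lt h1w (Expr.eval_reg rfl)
      (H.eval_width ((hs' 2 (by omega)).trans h2) 3 le_rfl)
  refine Runs.loop (fun s' T => SameExcept 11 14 s s' ∧ s'.reg 11 ≤ 2 * R + 3 ∧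
    T ≤ 60 * s'.reg 11 ∧ ∀ p < s'.reg 11, s'.mem p = if p < R + 1 then R + 1 else p - (R + 1))
    (fun s' => 2 * R + 3 - s'.reg 11) ?_ ?_ ?_
  · rintro s' T ⟨hs, h11, hT, hmem⟩ hne
    rw [hcond s' hs] at hne
    have hlt : s'.reg 11 < 2 * R + 3 := by by_contra h'; simp [h'] at hne
    have h2' := (hs 2 (by omega)).trans h2
    set m := s'.reg 11 with hm
    have key : Runs E (.ite (.op .lt (.reg 11) (.op .add .radius (.const 1)))
          (.store (.reg 11) (.op .add .radius (.const 1)))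
          (.store (.reg 11) (.op .sub (.reg 11) (.op .add .radius (.const 1))))) s'
        fun s'' T => s'' = s'.setMem E m (if m < R + 1 then R + 1 else m - (R + 1)) ∧ T ≤ 30 := by
      have hc := Expr.eval_lt (E := E) (s := s') h1w (Expr.eval_reg hm.symm)
        (H.eval_radius_succ h2')
      refine Runs.ite (fun h => ?_) (fun h => ?_)
      · rw [hc] at h
        have hlt : m < R + 1 := by by_contra h'; simp [h'] at h
        refine Runs.store (Expr.eval_reg rfl) (H.eval_radius_succ h2') ⟨by rw [if_pos hlt], ?_⟩
        simp [Expr.cost, Expr.radius, Expr.fld]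
      · rw [hc] at h
        have hlt : ¬ m < R + 1 := by intro h'; simp [h'] at h
        refine Runs.store (Expr.eval_reg rfl) (Expr.eval_sub (Expr.eval_reg rfl)
          (H.eval_radius_succ h2')) ⟨by rw [if_neg hlt], ?_⟩
        simp [Expr.cost, Expr.radius, Expr.fld]
    refine Runs.seq (key.mono ?_)
    rintro s'' T' ⟨rfl, hT'⟩
    refine Runs.assign (v := m + 1) (Expr.eval_add (Expr.eval_reg (by simp [hm]))
      (Expr.eval_const h1w) (by omega)) ?_
    refine ⟨⟨?_, by simp; omega, ?_, ?_⟩, by simp; omega⟩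
    · intro x hx
      rw [setReg_reg, if_neg (by omega), setMem_reg]
      exact hs x hx
    · simp only [Expr.cost, Expr.fld, Expr.radius, setReg_reg, if_true]
      omega
    · intro p hp
      simp only [setReg_reg, if_true] at hp
      rw [setReg_mem, setMem_mem _ _ _ _ (by omega)]
      by_cases h1 : p = m
      · rw [if_pos h1, h1]
      · rw [if_neg h1]
        exact hmem p (by omega)
  · refine ⟨?_, by simp, by simp, by simp⟩
    intro x hx
    rw [setReg_reg, if_neg (by omega)]
  · rintro s' T ⟨hs, h11, hT, hmem⟩ hz
    rw [hcond s' hs] at hz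
    have hge : ¬ s'.reg 11 < 2 * R + 3 := by intro h'; simp [h'] at hz
    refine ⟨hs, ?_, ?_⟩
    · simp only [Expr.cost, Expr.fld, Expr.radius]
      omega
    · intro e p hp
      rw [hmem p (by omega)]
      rfl

/-- The cost of aligning character `i` of the query with character `j` of string number `y`. -/
def alignCost (E : Env) (y i j : ℕ) : ℕ :=
  1 - if E.query i = entry E 14 (y * entry E 0 3 + j) then 1 else 0

/-- The row is updated in place: when cell `m` is computed, cell `m - 1` already belongs to the new
row, while `m` and `m + 1` still hold the old one. These are just the values that the recursion
needs. -/
theorem cellProg_runs (H : BandFits E B b R y lq lx) (h2 : s.reg 2 = b) (h5 : s.reg 5 = y)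
    {i m : ℕ} (h11 : s.reg 11 = m) (h12 : s.reg 12 = i) (hm0 : 0 < m) (hm : m < 2 * R + 2)
    (hi : i < lq) (hmem : ∀ p ≤ 2 * R + 2, s.mem p ≤ R + 2 + i) :
    Runs E cellProg s fun s' T => SameExcept 11 14 s s' ∧ s'.reg 12 = i ∧ s'.reg 11 = m + 1 ∧
      T ≤ 120 ∧
      ∀ p, s'.mem p = if p = m then min (min (s.mem m + alignCost E y i (i + m - (R + 1)))
        (s.mem (m + 1) + 1)) (s.mem (m - 1) + 1) else s.mem p := by
  have hw := H.hw
  have hidx := H.idx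
  have hsp := H.space
  have h1w : 1 < 2 ^ E.w := by omega
  have hm1 := hmem m (by omega)
  have hm2 := hmem (m + 1) (by omega)
  have hm3 := hmem (m - 1) (by omega)
  have hcost : alignCost E y i (i + m - (R + 1)) ≤ 1 := by unfold alignCost; omega
  unfold cellProg
  set v1 := s.mem m + alignCost E y i (i + m - (R + 1)) with hv1
  refine Runs.seq (Runs.assign (v := v1) ?_ ?_)
  · refine Expr.eval_add (Expr.eval_mem (Expr.eval_reg h11)) (Expr.eval_sub (Expr.eval_const h1w)
      (Expr.eval_eq h1w (Expr.eval_query (Expr.eval_reg h12)) (Expr.eval_fld hw ?_ (by norm_num)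
      (Expr.eval_add (Expr.eval_mul (Expr.eval_reg h5) (Expr.eval_hdr hw (by omega)) (by omega))
        (Expr.eval_sub (Expr.eval_add (Expr.eval_reg h12) (Expr.eval_reg h11) (by omega))
          (H.eval_radius_succ h2)) (by omega))))) (by rw [hv1] at *; omega)
    omega
  refine Runs.seq (Runs.assign (v := s.mem (m + 1) + 1) ?_ ?_)
  · exact Expr.eval_add (Expr.eval_mem (Expr.eval_add (Expr.eval_reg (by simpa using h11))
      (Expr.eval_const h1w) (by omega))) (Expr.eval_const h1w) (by omega)
  have hmin : ∀ (s : State) (u v : ℕ), s.reg 13 = v → s.reg 14 = u →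
      Runs E (.ite (.op .lt (.reg 14) (.reg 13)) (.assign 13 (.reg 14)) .skip) s
        fun s' T => s'.mem = s.mem ∧ (∀ x, x ≠ 13 → s'.reg x = s.reg x) ∧
          s'.reg 13 = min v u ∧ T ≤ 10 := by
    intro s u v h13 h14
    have hc := Expr.eval_lt h1w (Expr.eval_reg (E := E) h14) (Expr.eval_reg (E := E) h13)
    refine Runs.ite (fun h => Runs.assign (Expr.eval_reg h14) ?_) (fun h => Runs.skip ?_)
    · rw [hc] at h
      have hlt : u < v := by by_contra h'; simp [h'] at h
      refine ⟨rfl, fun x hx => by rw [setReg_reg, if_neg hx], ?_, by simp [Expr.cost]⟩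
      simp only [setReg_reg, if_true]
      omega
    · rw [hc] at h
      have hlt : ¬ u < v := by intro h'; simp [h'] at h
      refine ⟨rfl, fun x _ => rfl, ?_, by simp [Expr.cost]⟩
      omega
  refine Runs.seq ((hmin _ (s.mem (m + 1) + 1) v1 (by simp) (by simp)).mono ?_)
  rintro s1 T1 ⟨hmem1, hreg1, h13, hT1⟩
  simp only [setReg_mem] at hmem1
  have hreg1' : ∀ x, x ≠ 13 → x ≠ 14 → s1.reg x = s.reg x := by
    intro x hx hx'
    rw [hreg1 x hx, setReg_reg, if_neg hx', setReg_reg, if_neg hx]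
  refine Runs.seq (Runs.assign (v := s.mem (m - 1) + 1) ?_ ?_)
  · refine (Expr.eval_add (Expr.eval_mem (Expr.eval_sub
      (Expr.eval_reg ((hreg1' 11 (by omega) (by omega)).trans h11)) (Expr.eval_const h1w)))
      (Expr.eval_const h1w) (by rw [hmem1]; omega)).trans (by rw [hmem1])
  refine Runs.seq ((hmin _ (s.mem (m - 1) + 1) (min v1 (s.mem (m + 1) + 1)) (by simpa using h13)
    (by simp)).mono ?_)
  rintro s2 T2 ⟨hmem2, hreg2, h13', hT2⟩
  rw [setReg_mem, hmem1] at hmem2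
  have hreg2' : ∀ x, x ≠ 13 → x ≠ 14 → s2.reg x = s.reg x := by
    intro x hx hx'
    rw [hreg2 x hx, setReg_reg, if_neg hx', hreg1' x hx hx']
  have h11' := (hreg2' 11 (by omega) (by omega)).trans h11
  refine Runs.seq (Runs.store (Expr.eval_reg h11') (Expr.eval_reg h13') ?_)
  refine Runs.assign (v := m + 1) (Expr.eval_add (Expr.eval_reg (by simpa using h11'))
    (Expr.eval_const h1w) (by omega)) ?_
  refine ⟨?_, ?_, by simp, ?_, ?_⟩
  · intro x hx
    rw [setReg_reg, if_neg (by omega), setMem_reg]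
    exact hreg2' x (by omega) (by omega)
  · rw [setReg_reg, if_neg (by omega), setMem_reg]
    exact (hreg2' 12 (by omega) (by omega)).trans h12
  · simp only [Expr.cost, Expr.fld, Expr.hdr, Expr.radius]
    omega
  · intro p
    rw [setReg_mem, setMem_mem _ _ _ _ (by omega), hmem2]

theorem rowProg_runs (H : BandFits E B b R y lq lx) (h2 : s.reg 2 = b) (h5 : s.reg 5 = y)
    {i : ℕ} (h12 : s.reg 12 = i) (hi : i < lq)
    (hmem : ∀ p ≤ 2 * R + 2, s.mem p = band R (alignCost E y) i p) :
    Runs E rowProg s fun s' T => SameExcept 11 14 s s' ∧ s'.reg 12 = i + 1 ∧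
      T ≤ 140 * (2 * R + 3) ∧ ∀ p ≤ 2 * R + 2, s'.mem p = band R (alignCost E y) (i + 1) p := by
  have hw := H.hw
  have hidx := H.idx
  have hsp := H.space
  have h1w : 1 < 2 ^ E.w := by omega
  have hcost : ∀ i j, alignCost E y i j ≤ 1 := by intro i j; unfold alignCost; omega
  unfold rowProg
  refine Runs.seq (Runs.assign (v := 1) (Expr.eval_const h1w) ?_)
  have hcond : ∀ s' : State, SameExcept 11 14 s s' →
      (Expr.op .lt (.reg 11) (.op .add (.op .mul (.const 2) .radius) (.const 2))).eval E s' =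
        if s'.reg 11 < 2 * R + 2 then 1 else 0 := by
    intro s' hs'
    exact Expr.eval_lt h1w (Expr.eval_reg rfl)
      (H.eval_width ((hs' 2 (by omega)).trans h2) 2 (by omega))
  -- Cells to the left of register `11` are new, the others old. The two border cells are never
  -- written, but their values are the same in all rows.
  refine Runs.seq (Runs.loop (fun s' T => SameExcept 11 14 s s' ∧ s'.reg 12 = i ∧
    1 ≤ s'.reg 11 ∧ s'.reg 11 ≤ 2 * R + 2 ∧ T ≤ 140 * s'.reg 11 ∧
    ∀ p ≤ 2 * R + 2, s'.mem p = if p < s'.reg 11 then band R (alignCost E y) (i + 1) p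
      else band R (alignCost E y) i p) (fun s' => 2 * R + 2 - s'.reg 11) ?_ ?_ ?_)
  · rintro s' T ⟨hs, h12', h11, h11', hT, hmem'⟩ hne
    rw [hcond s' hs] at hne
    have hlt : s'.reg 11 < 2 * R + 2 := by by_contra h'; simp [h'] at hne
    set m := s'.reg 11 with hm
    refine (cellProg_runs H ((hs 2 (by omega)).trans h2) ((hs 5 (by omega)).trans h5) hm.symm h12'
      (by omega) hlt hi ?_).mono ?_
    · intro p hp
      rw [hmem' p hp]
      have g1 := band_le R (alignCost E y) hcost (i + 1) p hp
      have g2 := band_le R (alignCost E y) hcost i p hp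
      split <;> omega
    · rintro s'' T' ⟨hs', h12'', h11'', hT', hmem''⟩
      refine ⟨⟨fun x hx => (hs' x hx).trans (hs x hx), h12'', by omega, by omega, ?_, ?_⟩, by omega⟩
      · simp only [Expr.cost, Expr.fld, Expr.radius]
        omega
      · intro p hp
        rw [hmem'', h11'']
        split_ifs with e1 e2 e2
        · obtain ⟨k, hk⟩ : ∃ k, m = k + 1 := ⟨m - 1, by omega⟩
          rw [hmem' m (by omega), hmem' (m + 1) (by omega), hmem' (m - 1) (by omega),
            if_neg (by omega), if_neg (by omega), if_pos (by omega), e1, hk,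
            band_succ _ _ _ _ (by omega)]
          rfl
        · omega
        · rw [hmem' p hp, if_pos (by omega)]
        · rw [hmem' p hp, if_neg (by omega)]
  · refine ⟨?_, by simpa using h12, by simp, by simp, by simp, ?_⟩
    · intro x hx
      rw [setReg_reg, if_neg (by omega)]
    · intro p hp
      rw [setReg_mem, hmem p hp]
      simp only [setReg_reg, if_true]
      split_ifs with h
      · have : p = 0 := by omega
        rw [this, band_zero_right, band_zero_right]
      · rfl
  · rintro s' T ⟨hs, h12', h11, h11', hT, hmem'⟩ hz
    rw [hcond s' hs] at hz
    have hge : ¬ s'.reg 11 < 2 * R + 2 := by intro h'; simp [h'] at hz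
    refine Runs.assign (v := i + 1) (Expr.eval_add (Expr.eval_reg h12') (Expr.eval_const h1w)
      (by omega)) ?_
    refine ⟨?_, by simp, ?_, ?_⟩
    · intro x hx
      rw [setReg_reg, if_neg (by omega)]
      exact hs x hx
    · simp only [Expr.cost, Expr.fld, Expr.radius]
      omega
    · intro p hp
      rw [setReg_mem, hmem' p hp]
      split_ifs with h
      · rfl
      · have : p = 2 * R + 2 := by omega
        rw [this, band_last, band_last]

/-- The product of the two comparisons serves as a conjunction. If the final position lies outside
the band, the cell read there is meaningless, but it is multiplied by `0`. -/
theorem checkProg_runs {σ : ℕ} {q x : List (Fin σ)} (hq : HoldsQuery E q) (hx : HoldsString E y x)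
    (H : BandFits E B b R y q.length x.length) (h0 : s.reg 0 = q.length) (h2 : s.reg 2 = b)
    (h5 : s.reg 5 = y) :
    Runs E checkProg s fun s' T => (∀ z, (z < 11 ∨ 14 < z) → z ≠ 1 → s'.reg z = s.reg z) ∧
      T ≤ 300 * ((q.length + 1) * (2 * R + 4)) ∧
      s'.reg 1 = if editDist q x ≤ R then 1 else 0 := by
  have hw := H.hw
  have hidx := H.idx
  have hsp := H.space
  have h1w : 1 < 2 ^ E.w := by omega
  unfold checkProg
  refine Runs.seq ((initProg_runs H h2).mono ?_)
  rintro s1 T1 ⟨hs1, hT1, hmem1⟩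
  refine Runs.seq (Runs.assign (v := 0) (Expr.eval_const (by omega)) ?_)
  have hcond : ∀ s' : State, SameExcept 11 14 s s' →
      (Expr.op .lt (.reg 12) (.reg 0)).eval E s' = if s'.reg 12 < q.length then 1 else 0 := by
    intro s' hs'
    exact Expr.eval_lt h1w (Expr.eval_reg rfl) (Expr.eval_reg ((hs' 0 (by omega)).trans h0))
  refine Runs.seq (Runs.loop (fun s' T => SameExcept 11 14 s s' ∧ s'.reg 12 ≤ q.length ∧
    T ≤ 150 * (s'.reg 12 * (2 * R + 4)) ∧
    ∀ p ≤ 2 * R + 2, s'.mem p = band R (alignCost E y) (s'.reg 12) p)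
    (fun s' => q.length - s'.reg 12) ?_ ?_ ?_)
  · rintro s' T ⟨hs, h12, hT, hmem⟩ hne
    rw [hcond s' hs] at hne
    have hlt : s'.reg 12 < q.length := by by_contra h'; simp [h'] at hne
    refine (rowProg_runs H ((hs 2 (by omega)).trans h2) ((hs 5 (by omega)).trans h5) rfl hlt
      hmem).mono ?_
    rintro s'' T' ⟨hs', h12', hT', hmem'⟩
    refine ⟨⟨fun x hx => (hs' x hx).trans (hs x hx), by omega, ?_, ?_⟩, by omega⟩
    · rw [h12', Nat.add_mul]
      simp only [Expr.cost]
      omega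
    · rw [h12']
      exact hmem'
  · refine ⟨?_, by simp, by simp, ?_⟩
    · intro x hx
      rw [setReg_reg, if_neg (by omega)]
      exact hs1 x hx
    · intro p hp
      simp only [setReg_mem, setReg_reg, if_true]
      exact hmem1 _ p hp
  · rintro s' T ⟨hs, h12, hT, hmem⟩ hz
    rw [hcond s' hs] at hz
    have hge : ¬ s'.reg 12 < q.length := by intro h'; simp [h'] at hz
    have h12' : s'.reg 12 = q.length := by omega
    rw [h12'] at hmem hT
    have h2' := (hs 2 (by omega)).trans h2
    have h5' := (hs 5 (by omega)).trans h5
    have h0' := (hs 0 (by omega)).trans h0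
    refine Runs.seq (Runs.assign (v := x.length + R + 1 - q.length) ?_ ?_)
    · exact Expr.eval_sub (Expr.eval_add (Expr.eval_add ((Expr.eval_fld hw H.hy (by norm_num)
        (Expr.eval_reg h5')).trans hx.len) (H.eval_radius h2') (by omega)) (Expr.eval_const h1w)
        (by omega)) (Expr.eval_reg h0')
    set m := x.length + R + 1 - q.length with hm
    have h2'' : (s'.setReg 11 m).reg 2 = b := by simpa using h2'
    refine Runs.assign (v := (if m < 2 * R + 2 then 1 else 0) *
      (if s'.mem m < R + 1 then 1 else 0)) ?_ ?_
    · refine Expr.eval_mul (Expr.eval_lt h1w (Expr.eval_reg (by simp))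
        (H.eval_width h2'' 2 (by omega))) (Expr.eval_lt h1w (Expr.eval_mem (Expr.eval_reg (by simp)))
        (H.eval_radius_succ h2'')) ?_
      split_ifs <;> omega
    · refine ⟨?_, ?_, ?_⟩
      · intro z hz hz'
        rw [setReg_reg, if_neg hz', setReg_reg, if_neg (by omega)]
        exact hs z hz
      · rw [Nat.add_mul]
        simp only [Expr.cost, Expr.fld, Expr.radius]
        omega
      · have hband := band_le_iff R (alignCost E y) q x (fun i j hi hj => by
          unfold alignCost
          rw [hq.query i hi, hx.char j hj]
          by_cases h : q[i] = x[j]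
          · simp [h]
          · have : ¬ (q[i] : ℕ) = x[j] := fun h' => h (Fin.ext h')
            simp [h, this]) (fun i j => by unfold alignCost; omega)
        rw [← hm] at hband
        simp only [setReg_reg, if_true]
        by_cases h1 : m < 2 * R + 2
        · rw [hmem m (by omega)]
          simp only [h1, true_and] at hband
          simp only [h1, if_true, one_mul]
          by_cases h2 : band R (alignCost E y) q.length m < R + 1
          · rw [if_pos h2, if_pos (hband.1 h2)]
          · rw [if_neg h2, if_neg (fun h => h2 (hband.2 h))]
        · have : ¬ editDist q x ≤ R := fun h => h1 (hband.2 h).1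
          rw [if_neg h1, if_neg this, zero_mul]

end WordRAM

/-! ### The query program -/

/-- The first `y` with `k ≤ y < n` and `p y`, or `n`. -/
noncomputable def nextHit (p : ℕ → Prop) (n k : ℕ) : ℕ :=
  sInf {y | y = n ∨ k ≤ y ∧ y < n ∧ p y}

/-- Buckets are linked lists of string numbers in increasing order; the value `n` marks the end of a
list. -/
theorem nextHit_spec (p : ℕ → Prop) (n k : ℕ) :
    nextHit p n k = n ∨ k ≤ nextHit p n k ∧ nextHit p n k < n ∧ p (nextHit p n k) :=
  Nat.sInf_mem (s := {y | y = n ∨ k ≤ y ∧ y < n ∧ p y}) ⟨n, .inl rfl⟩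

theorem nextHit_le (p : ℕ → Prop) (n k : ℕ) : nextHit p n k ≤ n := by
  rcases nextHit_spec p n k with h | h <;> omega

theorem nextHit_le_of {p : ℕ → Prop} {n k y : ℕ} (h : k ≤ y) (hn : y < n) (hy : p y) :
    nextHit p n k ≤ y :=
  Nat.sInf_le (.inr ⟨h, hn, hy⟩)

namespace WordRAM

variable {E : Env} {p q : Prog} {s : State} {Q Q' : State → ℕ → Prop} {e a : Expr} {x : ℕ}

/-- The position of entry `e` of the hash table `reg 4` of block `reg 2`. -/
def Expr.slot (e : Expr) : Expr :=
  .op .add (.op .mul (.op .add (.fld 9 (.reg 2)) (.reg 4)) (.hdr 0)) e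

/-- Run through the strings with the fingerprint of the query. -/
def scanProg : Prog :=
  .loop (.op .mul (.op .lt (.reg 5) (.hdr 0)) (.op .mul (.op .lt (.reg 3) (.fld 10 (.reg 2)))
      (.op .eq (.reg 1) (.const 0))))
    (.seq checkProg (.ite (.reg 1) .skip (.seq (.assign 3 (.op .add (.reg 3) (.const 1)))
      (.assign 5 (.fld 12 (.slot (.reg 5)))))))

/-- Search one hash table. -/
def tableProg : Prog :=
  .seq hashProg (.seq (.assign 5 (.fld 11 (.slot (.reg 8))))
    (.seq scanProg (.assign 4 (.op .add (.reg 4) (.const 1)))))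

/-- Search one block of hash tables. -/
def blockProg : Prog :=
  .seq (.assign 3 (.const 0)) (.seq (.assign 4 (.const 0))
    (.seq (.loop (.op .mul (.op .lt (.reg 4) (.fld 5 (.reg 2))) (.op .eq (.reg 1) (.const 0)))
        tableProg)
      (.assign 2 (.op .add (.reg 2) (.const 1)))))

/-- Write string number `reg 5` as the answer. -/
def outputProg : Prog :=
  .seq (.assign 11 (.const 0))
    (.seq (.loop (.op .lt (.reg 11) (.fld 13 (.reg 5)))
        (.seq (.store (.reg 11) (.fld 14 (.op .add (.op .mul (.reg 5) (.hdr 3)) (.reg 11))))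
          (.assign 11 (.op .add (.reg 11) (.const 1)))))
      (.assign 0 (.fld 13 (.reg 5))))

/-- The query program. -/
def nearestProg : Prog :=
  .seq (.loop (.op .eq (.reg 1) (.const 0)) blockProg) outputProg

/-- The static data holds block `b` of hash tables, with the seed `γ`. -/
structure HoldsBlock {σ M P n : ℕ} (E : Env) (B b α m L R cap : ℕ) (γ : Seed (Fin σ) M P n)
    (str : ℕ → List (Fin σ)) (q : List (Fin σ)) : Prop where
  hash : ∀ j < L, HoldsHash E B b j α m (γ.rows j) (tableRows γ.2)
  band : ∀ y < n, BandFits E B b R y q.length (str y).length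
  string : ∀ y < n, HoldsString E y (str y)
  size : entry E 5 b = L
  limit : entry E 10 b = cap
  hw : 16 * B + 16 ≤ 2 ^ E.w
  hb : b < B
  modulus : entry E 0 0 = n
  hL : L < B
  hcap : cap < B
  idx : ∀ j < L, ∀ f ≤ n, (entry E 9 b + j) * n + f < B
  head : ∀ j < L, ∀ f : ZMod n, entry E 11 ((entry E 9 b + j) * n + f.val) =
    nextHit (fun y => γ.hash α m j (str y) = f) n 0
  next : ∀ j < L, ∀ y < n, entry E 12 ((entry E 9 b + j) * n + y) =
    nextHit (fun y' => γ.hash α m j (str y') = γ.hash α m j (str y)) n (y + 1)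

/-! ### Searching one block of hash tables -/

section Block

variable {σ M P n : ℕ} {B b α m L R cap : ℕ} {γ : Seed (Fin σ) M P n}
  {str : ℕ → List (Fin σ)} {q : List (Fin σ)}

/-- The number of strings `y < k` found in table `j` that are too far from the query. -/
noncomputable def falseCount (γ : Seed (Fin σ) M P n) (α m R : ℕ) (str : ℕ → List (Fin σ))
    (q : List (Fin σ)) (j k : ℕ) : ℕ :=
  ((Finset.range k).filter fun y =>
    γ.hash α m j (str y) = γ.hash α m j q ∧ R < editDist q (str y)).card

theorem falseCount_mono {j k k' : ℕ} (h : k ≤ k') :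
    falseCount γ α m R str q j k ≤ falseCount γ α m R str q j k' :=
  Finset.card_le_card (Finset.filter_subset_filter _ (Finset.range_mono h))

theorem falseCount_succ {j y : ℕ} (h : γ.hash α m j (str y) = γ.hash α m j q)
    (hR : R < editDist q (str y)) :
    falseCount γ α m R str q j (y + 1) = falseCount γ α m R str q j y + 1 := by
  unfold falseCount
  rw [Finset.range_add_one, Finset.filter_insert, if_pos ⟨h, hR⟩, Finset.card_insert_of_notMem]
  simp

theorem sum_falseCount :
    ∑ j ∈ Finset.range L, falseCount γ α m R str q j n = (γ.falseHits α m L R str q).card := by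
  unfold falseCount Seed.falseHits
  simp only [Finset.card_filter]
  rw [Finset.sum_product]

/-- The time for one distance computation. -/
def checkTime (R lq : ℕ) : ℕ := 300 * ((lq + 1) * (2 * R + 4)) + 100

theorem HoldsBlock.eval_slot [NeZero n] (H : HoldsBlock E B b α m L R cap γ str q) (h2 : s.reg 2 = b) {j f : ℕ}
    (h4 : s.reg 4 = j) (hj : j < L) (he : e.eval E s = f) (hf : f ≤ n) :
    (Expr.slot e).eval E s = (entry E 9 b + j) * n + f := by
  have hw := H.hw
  have hidx := H.idx j hj f hf
  have hn := NeZero.pos n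
  have : entry E 9 b + j ≤ (entry E 9 b + j) * n := Nat.le_mul_of_pos_right _ hn
  exact Expr.eval_add (Expr.eval_mul (Expr.eval_add (Expr.eval_fld hw H.hb (by norm_num)
    (Expr.eval_reg h2)) (Expr.eval_reg h4) (by omega))
    ((Expr.eval_hdr hw (by omega)).trans H.modulus) (by omega)) he (by omega)

/-- Register `5` is the current string, `3` counts the failed checks in the block and `1` is the
success flag. Each check raises register `3` or sets register `1`, so these two registers also
account for the time. Failed checks are distinct false hits, which bounds register `3`. -/
theorem scanProg_runs [NeZero n] (hq : HoldsQuery E q) (H : HoldsBlock E B b α m L R cap γ str q) {j c : ℕ}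
    (h0 : s.reg 0 = q.length) (h1 : s.reg 1 = 0) (h2 : s.reg 2 = b) (h3 : s.reg 3 = c)
    (h4 : s.reg 4 = j) (hj : j < L) (hc : c ≤ cap)
    (h5 : s.reg 5 = nextHit (fun y => γ.hash α m j (str y) = γ.hash α m j q) n 0) :
    Runs E scanProg s fun s' T => s'.reg 0 = q.length ∧ s'.reg 2 = b ∧ s'.reg 4 = j ∧
      s'.reg 1 ≤ 1 ∧ c ≤ s'.reg 3 ∧ s'.reg 3 ≤ cap ∧
      s'.reg 3 ≤ c + falseCount γ α m R str q j n ∧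
      T ≤ (s'.reg 3 - c + s'.reg 1) * checkTime R q.length + 50 ∧
      (s'.reg 1 = 1 → s'.reg 5 < n ∧ editDist q (str (s'.reg 5)) ≤ R) ∧
      (s'.reg 1 = 0 → cap ≤ s'.reg 3 ∨
        ∀ y < n, γ.hash α m j (str y) = γ.hash α m j q → R < editDist q (str y)) := by
  have hw := H.hw
  have hb := H.hb
  have hcapB := H.hcap
  have h1w : 1 < 2 ^ E.w := by omega
  set p : ℕ → Prop := fun y => γ.hash α m j (str y) = γ.hash α m j q with hp
  have hcond : ∀ s' : State, s'.reg 2 = b →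
      (Expr.op .mul (.op .lt (.reg 5) (.hdr 0)) (.op .mul (.op .lt (.reg 3) (.fld 10 (.reg 2)))
        (.op .eq (.reg 1) (.const 0)))).eval E s' =
      (if s'.reg 5 < n then 1 else 0) * ((if s'.reg 3 < cap then 1 else 0) *
        (if s'.reg 1 = 0 then 1 else 0)) := by
    intro s' h2'
    refine Expr.eval_mul (Expr.eval_lt h1w (Expr.eval_reg rfl)
      ((Expr.eval_hdr hw (by omega)).trans H.modulus)) (Expr.eval_mul (Expr.eval_lt h1w
      (Expr.eval_reg rfl) ((Expr.eval_fld hw hb (by norm_num) (Expr.eval_reg h2')).trans H.limit))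
      (Expr.eval_eq h1w (Expr.eval_reg rfl) (Expr.eval_const (by omega))) ?_) ?_
    all_goals split_ifs <;> omega
  unfold scanProg
  refine Runs.loop (fun s' T => s'.reg 0 = q.length ∧ s'.reg 2 = b ∧ s'.reg 4 = j ∧
    s'.reg 1 ≤ 1 ∧ c ≤ s'.reg 3 ∧ s'.reg 3 ≤ cap ∧ s'.reg 5 ≤ n ∧
    s'.reg 3 ≤ c + falseCount γ α m R str q j (s'.reg 5) ∧
    T ≤ (s'.reg 3 - c + s'.reg 1) * checkTime R q.length ∧
    (s'.reg 1 = 1 → s'.reg 5 < n ∧ editDist q (str (s'.reg 5)) ≤ R) ∧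
    (s'.reg 1 = 0 → (s'.reg 5 < n → p (s'.reg 5)) ∧
      ∀ y < s'.reg 5, p y → R < editDist q (str y)))
    -- On success the list position does not advance; the flag makes the measure decrease.
    (fun s' => (n - s'.reg 5) + (1 - s'.reg 1)) ?_ ?_ ?_
  · rintro s' T ⟨g0, g2, g4, g1, g3, g3', g5, gF, gT, gd, gn⟩ hne
    rw [hcond s' g2] at hne
    have hy : s'.reg 5 < n := by by_contra h; simp [h] at hne
    have hcap : s'.reg 3 < cap := by by_contra h; simp [h] at hne
    have hd : s'.reg 1 = 0 := by by_contra h; simp [h] at hne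
    obtain ⟨gp, gall⟩ := gn hd
    have gpy := gp hy
    refine Runs.seq ((checkProg_runs hq (H.string _ hy) (H.band _ hy) g0 g2 rfl).mono ?_)
    rintro s1 T1 ⟨hreg, hT1, hr1⟩
    have r0 := hreg 0 (by omega) (by omega)
    have r2 := hreg 2 (by omega) (by omega)
    have r3 := hreg 3 (by omega) (by omega)
    have r4 := hreg 4 (by omega) (by omega)
    have r5 := hreg 5 (by omega) (by omega)
    have hct : checkTime R q.length = 300 * ((q.length + 1) * (2 * R + 4)) + 100 := rfl
    refine Runs.ite (fun h => Runs.skip ?_) (fun h => ?_)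
    · have hED : editDist q (str (s'.reg 5)) ≤ R := by
        by_contra h'
        rw [if_neg h'] at hr1
        exact h hr1
      rw [if_pos hED] at hr1
      refine ⟨⟨by omega, by omega, by omega, by omega, by omega, by omega, by omega, by rw [r3, r5]; exact gF,
        ?_, ?_, by omega⟩, by omega⟩
      · rw [hr1, r3]
        rw [hd, add_zero] at gT
        rw [Nat.add_mul, one_mul]
        simp only [Expr.cost, Expr.fld, Expr.hdr]
        omega
      · intro _
        rw [r5]
        exact ⟨hy, hED⟩
    · have hED : ¬ editDist q (str (s'.reg 5)) ≤ R := by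
        intro h'
        rw [if_pos h'] at hr1
        have : s1.reg 1 = 0 := h
        omega
      rw [if_neg hED] at hr1
      refine Runs.seq (Runs.assign (v := s'.reg 3 + 1) (Expr.eval_add (Expr.eval_reg r3)
        (Expr.eval_const h1w) (by omega)) ?_)
      have hnext := H.next j hj _ hy
      rw [show γ.hash α m j (str (s'.reg 5)) = γ.hash α m j q from gpy] at hnext
      have hidx := H.idx j hj _ hy.le
      refine Runs.assign (v := nextHit p n (s'.reg 5 + 1)) ?_ ?_
      · rw [hp, ← hnext]
        refine Expr.eval_fld hw hidx (by norm_num) (H.eval_slot ?_ ?_ hj (Expr.eval_reg ?_) hy.le)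
        · simp [r2, g2]
        · simp [r4, g4]
        · simp [r5]
      · have hsp := nextHit_spec p n (s'.reg 5 + 1)
        have hle := nextHit_le p n (s'.reg 5 + 1)
        have hgt : s'.reg 5 + 1 ≤ nextHit p n (s'.reg 5 + 1) := by rcases hsp with h | h <;> omega
        have hfc := falseCount_succ (R := R) (q := q) (γ := γ) gpy (by omega)
        have hmono := falseCount_mono (γ := γ) (α := α) (m := m) (R := R) (str := str) (q := q)
          (j := j) hgt
        simp only [setReg_reg, Nat.reduceEqDiff, if_true, if_false, OfNat.zero_ne_ofNat,
          OfNat.one_ne_ofNat]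
        refine ⟨⟨by omega, by omega, by omega, by omega, by omega, by omega, hle, by omega, ?_, by omega,
          fun _ => ⟨?_, ?_⟩⟩, by omega⟩
        · rw [hr1, show s'.reg 3 + 1 - c + 0 = s'.reg 3 - c + 1 by omega]
          rw [hd, add_zero] at gT
          rw [Nat.add_mul, one_mul]
          simp only [Expr.cost, Expr.fld, Expr.hdr, Expr.slot]
          omega
        · intro hlt
          rcases hsp with h | h
          · omega
          · exact h.2.2
        · intro y hy' hpy
          rcases Nat.lt_trichotomy y (s'.reg 5) with h' | h' | h'
          · exact gall y h' hpy
          · rw [h']; omega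
          · have := nextHit_le_of (p := p) (n := n) (show s'.reg 5 + 1 ≤ y by omega) (by omega) hpy
            omega
  · have hsp := nextHit_spec p n 0
    refine ⟨h0, h2, h4, by omega, by omega, by omega, ?_, by omega, by omega, by omega, fun _ => ⟨?_, ?_⟩⟩
    · rw [h5]; exact nextHit_le _ _ _
    · intro hlt
      rw [h5] at hlt ⊢
      rcases hsp with h | h
      · omega
      · exact h.2.2
    · intro y hy hpy
      rw [h5] at hy
      have := nextHit_le p n 0
      have := nextHit_le_of (p := p) (n := n) (Nat.zero_le y) (by omega) hpy
      omega
  · rintro s' T ⟨g0, g2, g4, g1, g3, g3', g5, gF, gT, gd, gn⟩ hz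
    rw [hcond s' g2] at hz
    have hmono := falseCount_mono (γ := γ) (α := α) (m := m) (R := R) (str := str) (q := q)
      (j := j) g5
    refine ⟨g0, g2, g4, g1, g3, g3', by omega, ?_, gd, ?_⟩
    · simp only [Expr.cost, Expr.fld, Expr.hdr]
      omega
    · intro hd
      by_cases hcap : s'.reg 3 < cap
      · right
        have hge : ¬ s'.reg 5 < n := by intro h; simp [h, hcap, hd] at hz
        have : s'.reg 5 = n := by omega
        rw [this] at gn
        exact (gn hd).2
      · left; omega

/-- The time for searching one block. -/
def blockTime (m L R cap lq : ℕ) : ℕ :=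
  L * (120 * (m + 1) + 200) + (cap + 1) * checkTime R lq + 100

/-- The limit `cap` bounds the time for any seed. For a good seed it is not reached, so a search
without an answer would have gone through all tables, including the one with a hit. -/
theorem blockProg_runs [NeZero n] (hq : HoldsQuery E q) (H : HoldsBlock E B b α m L R cap γ str q)
    (h0 : s.reg 0 = q.length) (h1 : s.reg 1 = 0) (h2 : s.reg 2 = b) :
    Runs E blockProg s fun s' T => s'.reg 0 = q.length ∧ s'.reg 2 = b + 1 ∧ s'.reg 1 ≤ 1 ∧
      T ≤ blockTime m L R cap q.length ∧
      (s'.reg 1 = 1 → s'.reg 5 < n ∧ editDist q (str (s'.reg 5)) ≤ R) ∧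
      (s'.reg 1 = 0 → ¬ γ.Good α m L R cap str q) := by
  have hw := H.hw
  have hb := H.hb
  have hcapB := H.hcap
  have hLB := H.hL
  have h1w : 1 < 2 ^ E.w := by omega
  unfold blockProg
  refine Runs.seq (Runs.assign (v := 0) (Expr.eval_const (by omega)) ?_)
  refine Runs.seq (Runs.assign (v := 0) (Expr.eval_const (by omega)) ?_)
  have hcond : ∀ s' : State, s'.reg 2 = b →
      (Expr.op .mul (.op .lt (.reg 4) (.fld 5 (.reg 2))) (.op .eq (.reg 1) (.const 0))).eval E s' =
      (if s'.reg 4 < L then 1 else 0) * (if s'.reg 1 = 0 then 1 else 0) := by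
    intro s' h2'
    refine Expr.eval_mul (Expr.eval_lt h1w (Expr.eval_reg rfl)
      ((Expr.eval_fld hw hb (by norm_num) (Expr.eval_reg h2')).trans H.size))
      (Expr.eval_eq h1w (Expr.eval_reg rfl) (Expr.eval_const (by omega))) ?_
    split_ifs <;> omega
  refine Runs.seq (Runs.loop (fun s' T => s'.reg 0 = q.length ∧ s'.reg 2 = b ∧ s'.reg 4 ≤ L ∧
    s'.reg 1 ≤ 1 ∧ s'.reg 3 ≤ cap ∧
    s'.reg 3 ≤ ∑ j ∈ Finset.range (s'.reg 4), falseCount γ α m R str q j n ∧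
    T ≤ s'.reg 4 * (120 * (m + 1) + 200) + (s'.reg 3 + s'.reg 1) * checkTime R q.length ∧
    (s'.reg 1 = 1 → s'.reg 5 < n ∧ editDist q (str (s'.reg 5)) ≤ R) ∧
    (s'.reg 1 = 0 → cap ≤ s'.reg 3 ∨ ∀ j < s'.reg 4,
        ∀ y < n, γ.hash α m j (str y) = γ.hash α m j q → R < editDist q (str y)))
    (fun s' => L - s'.reg 4) ?_ ?_ ?_)
  · rintro s' T ⟨g0, g2, g4, g1, g3, gF, gT, gd, gn⟩ hne
    rw [hcond s' g2] at hne
    have hj : s'.reg 4 < L := by by_contra h; simp [h] at hne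
    have hd : s'.reg 1 = 0 := by by_contra h; simp [h] at hne
    unfold tableProg
    refine Runs.seq ((hashProg_runs hq (H.hash _ hj) g0 g2 rfl).mono ?_)
    rintro s1 T1 ⟨hs1, hmem1, hT1, hfp⟩
    have r0 := hs1 0 (by omega)
    have r1 := hs1 1 (by omega)
    have r2 := hs1 2 (by omega)
    have r3 := hs1 3 (by omega)
    have r4 := hs1 4 (by omega)
    have hhash : fingerprint α m (γ.rows (s'.reg 4)) (tableRows γ.2) q = γ.hash α m (s'.reg 4) q := rfl
    rw [hhash] at hfp
    have hflt := ZMod.val_lt (γ.hash α m (s'.reg 4) q)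
    have hidx := H.idx _ hj _ hflt.le
    refine Runs.seq (Runs.assign (v := nextHit (fun y => γ.hash α m (s'.reg 4) (str y) =
      γ.hash α m (s'.reg 4) q) n 0) ?_ ?_)
    · rw [← H.head _ hj]
      exact Expr.eval_fld hw hidx (by norm_num) (H.eval_slot (r2.trans g2) r4 hj
        (Expr.eval_reg hfp) hflt.le)
    refine Runs.seq ((scanProg_runs hq H (j := s'.reg 4) (c := s'.reg 3) (by simp; omega)
      (by simp; omega) (by simp; omega) (by simp; omega) (by simp; omega) hj g3 (by simp)).mono ?_)
    rintro s2 T2 ⟨k0, k2, k4, k1, k3, k3', kF, kT, kd, kn⟩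
    refine Runs.assign (v := s'.reg 4 + 1) (Expr.eval_add (Expr.eval_reg k4)
      (Expr.eval_const h1w) (by omega)) ?_
    simp only [setReg_reg, Nat.reduceEqDiff, if_true, if_false, OfNat.zero_ne_ofNat,
          OfNat.one_ne_ofNat]
    refine ⟨⟨k0, k2, hj, k1, k3', ?_, ?_, kd, ?_⟩, by omega⟩
    · rw [Finset.sum_range_succ]; omega
    · have e1 : (s2.reg 3 + s2.reg 1) = s'.reg 3 + (s2.reg 3 - s'.reg 3 + s2.reg 1) := by omega
      rw [e1, Nat.add_mul, Nat.add_mul, one_mul]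
      rw [hd, add_zero] at gT
      simp only [Expr.cost, Expr.fld, Expr.hdr, Expr.slot]
      omega
    · intro hd2
      rcases kn hd2 with h | h
      · exact .inl h
      · rcases gn hd with h' | h'
        · exact .inl (by omega)
        · right
          intro j hj' y hy hyq
          rcases Nat.lt_succ_iff_lt_or_eq.1 hj' with h'' | h''
          · exact h' j h'' y hy hyq
          · subst h''
            exact h y hy hyq
  · simp [h0, h1, h2]
  · rintro s' T ⟨g0, g2, g4, g1, g3, gF, gT, gd, gn⟩ hz
    rw [hcond s' g2] at hz
    refine Runs.assign (v := b + 1) (Expr.eval_add (Expr.eval_reg g2)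
      (Expr.eval_const h1w) (by omega)) ?_
    simp only [setReg_reg, Nat.reduceEqDiff, if_true, if_false, OfNat.zero_ne_ofNat,
          OfNat.one_ne_ofNat]
    refine ⟨g0, trivial, g1, ?_, gd, ?_⟩
    · unfold blockTime
      have e1 : s'.reg 4 * (120 * (m + 1) + 200) ≤ L * (120 * (m + 1) + 200) :=
        Nat.mul_le_mul_right _ g4
      have e2 : (s'.reg 3 + s'.reg 1) * checkTime R q.length ≤ (cap + 1) * checkTime R q.length :=
        Nat.mul_le_mul_right _ (by omega)
      simp only [Expr.cost, Expr.fld]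
      omega
    -- Neither alternative of the invariant is possible: the false hits number less than `cap`, and
    -- the hit in table `j` would have been found.
    · rintro hd ⟨⟨j, hj, y, hy, hyq, hyR⟩, hcard⟩
      have h4 : ¬ s'.reg 4 < L := by intro h; simp [h, hd] at hz
      have h4' : s'.reg 4 = L := by omega
      rw [h4'] at gF gn
      rw [sum_falseCount] at gF
      rcases gn hd with h | h
      · omega
      · have := h j hj y hy hyq
        omega

end Block

theorem outputProg_runs {σ : ℕ} {B b R y lq : ℕ} {x : List (Fin σ)} (hx : HoldsString E y x)
    (H : BandFits E B b R y lq x.length) (h5 : s.reg 5 = y) :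
    Runs E outputProg s fun s' T => s'.output = x.map Fin.val ∧ T ≤ 50 * (x.length + 1) := by
  have hw := H.hw
  have hidx := H.idx
  have hsp := H.space
  have h1w : 1 < 2 ^ E.w := by omega
  unfold outputProg
  refine Runs.seq (Runs.assign (v := 0) (Expr.eval_const (by omega)) ?_)
  have hlen : ∀ s' : State, s'.reg 5 = y → (Expr.fld 13 (.reg 5)).eval E s' = x.length :=
    fun s' h => (Expr.eval_fld hw H.hy (by norm_num) (Expr.eval_reg h)).trans hx.len
  have hcond : ∀ s' : State, s'.reg 5 = y →
      (Expr.op .lt (.reg 11) (.fld 13 (.reg 5))).eval E s' =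
        if s'.reg 11 < x.length then 1 else 0 :=
    fun s' h => Expr.eval_lt h1w (Expr.eval_reg rfl) (hlen s' h)
  refine Runs.seq (Runs.loop (fun s' T => s'.reg 5 = y ∧ s'.reg 11 ≤ x.length ∧
    T ≤ 50 * s'.reg 11 ∧ ∀ (k : ℕ) (hk : k < x.length), k < s'.reg 11 → s'.mem k = x[k])
    (fun s' => x.length - s'.reg 11) ?_ ?_ ?_)
  · rintro s' T ⟨g5, g11, gT, gm⟩ hne
    rw [hcond s' g5] at hne
    have hlt : s'.reg 11 < x.length := by by_contra h; simp [h] at hne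
    refine Runs.seq (Runs.store (v := x[s'.reg 11]) (Expr.eval_reg rfl) ?_ ?_)
    · rw [← hx.char _ hlt]
      exact Expr.eval_fld hw (by omega) (by norm_num) (Expr.eval_add (Expr.eval_mul
        (Expr.eval_reg g5) (Expr.eval_hdr hw (by omega)) (by omega)) (Expr.eval_reg rfl) (by omega))
    refine Runs.assign (v := s'.reg 11 + 1) (Expr.eval_add (Expr.eval_reg (by simp))
      (Expr.eval_const h1w) (by omega)) ?_
    refine ⟨⟨by simpa using g5, by simpa using hlt, ?_, ?_⟩, by simp; omega⟩
    · simp only [Expr.cost, Expr.fld, Expr.hdr, setReg_reg, if_true]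
      omega
    · intro k hk hk'
      simp only [setReg_reg, if_true] at hk'
      rw [setReg_mem, setMem_mem _ _ _ _ (by omega)]
      split_ifs with h
      · subst h; rfl
      · exact gm k hk (by omega)
  · simp [h5]
  · rintro s' T ⟨g5, g11, gT, gm⟩ hz
    rw [hcond s' g5] at hz
    have hge : ¬ s'.reg 11 < x.length := by intro h; simp [h] at hz
    refine Runs.assign (hlen s' g5) ⟨?_, ?_⟩
    · simp only [State.output, setReg_reg, if_true, setReg_mem]
      apply List.ext_getElem
      · simp
      · intro k hk hk'
        simp only [List.getElem_map, List.getElem_range]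
        simp only [List.length_map, List.length_range] at hk
        exact gm k hk (by omega)
    · simp only [Expr.cost, Expr.fld]
      omega

/-- Block `g` succeeds for certain, so the loop ends there at the latest. An earlier block may
answer too, within its own radius. -/
theorem nearestProg_runs {σ M P n : ℕ} [NeZero n] {B : ℕ} {α m L R cap : ℕ → ℕ}
    {γ : ℕ → Seed (Fin σ) M P n} {str : ℕ → List (Fin σ)} {q : List (Fin σ)} {d g : ℕ}
    (hq : HoldsQuery E q)
    (H : ∀ b ≤ g, HoldsBlock E B b (α b) (m b) (L b) (R b) (cap b) (γ b) str q)
    (hd : ∀ y < n, (str y).length ≤ d)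
    (hg : (γ g).Good (α g) (m g) (L g) (R g) (cap g) str q)
    (h0 : s.reg 0 = q.length) (h1 : s.reg 1 = 0) (h2 : s.reg 2 = 0) :
    Runs E nearestProg s fun s' T => ∃ b ≤ g, ∃ y < n, editDist q (str y) ≤ R b ∧
      s'.output = (str y).map Fin.val ∧
      T ≤ (∑ b ∈ Finset.range (g + 1), (blockTime (m b) (L b) (R b) (cap b) q.length + 10)) +
        100 * (d + 1) := by
  have hw := (H g le_rfl).hw
  have h1w : 1 < 2 ^ E.w := by omega
  have hcond : ∀ s' : State, (Expr.op .eq (.reg 1) (.const 0)).eval E s' =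
      if s'.reg 1 = 0 then 1 else 0 :=
    fun s' => Expr.eval_eq h1w (Expr.eval_reg rfl) (Expr.eval_const (by omega))
  unfold nearestProg
  refine Runs.seq (Runs.loop (fun s' T => s'.reg 0 = q.length ∧ s'.reg 1 ≤ 1 ∧
    s'.reg 2 ≤ g + 1 ∧ T ≤ ∑ b ∈ Finset.range (s'.reg 2),
      (blockTime (m b) (L b) (R b) (cap b) q.length + 10) ∧
    (s'.reg 1 = 1 → ∃ b ≤ g, s'.reg 5 < n ∧ editDist q (str (s'.reg 5)) ≤ R b) ∧
    (s'.reg 1 = 0 → s'.reg 2 ≤ g)) (fun s' => g + 1 - s'.reg 2) ?_ ?_ ?_)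
  · rintro s' T ⟨g0, g1, g2, gT, gd, gn⟩ hne
    rw [hcond s'] at hne
    have hz : s'.reg 1 = 0 := by by_contra h; simp [h] at hne
    have hle := gn hz
    refine (blockProg_runs hq (H _ hle) g0 hz rfl).mono ?_
    rintro s'' T' ⟨k0, k2, k1, kT, kd, kn⟩
    refine ⟨⟨k0, k1, by omega, ?_, ?_, ?_⟩, by omega⟩
    · rw [k2, Finset.sum_range_succ]
      simp only [Expr.cost]
      omega
    · intro h
      exact ⟨_, hle, kd h⟩
    · intro h
      have h' := kn h
      by_contra hgt
      have : s'.reg 2 = g := by omega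
      rw [this] at h'
      exact h' hg
  · simp [h0, h1, h2]
  · rintro s' T ⟨g0, g1, g2, gT, gd, gn⟩ hz
    rw [hcond s'] at hz
    have h1' : s'.reg 1 = 1 := by
      by_contra h
      simp [show s'.reg 1 = 0 by omega] at hz
    obtain ⟨b, hb, hy, hR⟩ := gd h1'
    refine (outputProg_runs ((H g le_rfl).string _ hy) ((H g le_rfl).band _ hy) rfl).mono ?_
    rintro s'' T' ⟨hout, hT'⟩
    refine ⟨b, hb, _, hy, hR, hout, ?_⟩
    have := hd _ hy
    have hmono : ∑ b ∈ Finset.range (s'.reg 2), (blockTime (m b) (L b) (R b) (cap b) q.length + 10) ≤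
        ∑ b ∈ Finset.range (g + 1), (blockTime (m b) (L b) (R b) (cap b) q.length + 10) :=
      Finset.sum_le_sum_of_subset (Finset.range_mono g2)
    simp only [Expr.cost]
    omega

end WordRAM

/-! ### The static data -/

/-- The character with a given code. -/
def charOfCode (σ k : ℕ) : Option (Fin σ) :=
  if h : 0 < k ∧ k ≤ σ then some ⟨k - 1, by omega⟩ else none

theorem charOfCode_charCode {σ : ℕ} (c : Option (Fin σ)) :
    charOfCode σ (WordRAM.charCode c) = c := by
  cases c with
  | none => simp [charOfCode, WordRAM.charCode]
  | some a =>
    have h : 0 < (a : ℕ) + 1 ∧ (a : ℕ) + 1 ≤ σ := ⟨by omega, by omega⟩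
    change charOfCode σ (a + 1) = some a
    unfold charOfCode
    rw [dif_pos h]
    rfl

theorem charCode_lt {σ : ℕ} (c : Option (Fin σ)) : WordRAM.charCode c < σ + 1 := by
  cases c with
  | none => simp [WordRAM.charCode]
  | some a => simp [WordRAM.charCode]

/-- The parameters of the data structure: strings have length at most `d`, there are `G` groups of
seeds for walks of `M` steps, the modulus is `P`, there are at most `W` tables in a block, and
proper hash tables are used for the scales `0, …, r₀`; the other entries depend on the scale. -/
structure Params where
  d : ℕ
  M : ℕ
  P : ℕ
  G : ℕ
  r₀ : ℕ
  W : ℕ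
  α : ℕ → ℕ
  m : ℕ → ℕ
  L : ℕ → ℕ
  R : ℕ → ℕ
  cap : ℕ → ℕ

namespace Params

variable {σ n : ℕ} (p : Params)

/-- Entry `i` of section `k` of the static data. -/
noncomputable def entryOf (γ : ℕ → Seed (Fin σ) p.M p.P n) (str : ℕ → List (Fin σ)) : ℕ → ℕ → ℕ
  | 0, 0 => n
  | 0, 1 => σ + 1
  | 0, 2 => p.P
  | 0, 3 => p.d
  -- The index of group `g`, step `t` and character code `k` is `(g * M + t) * (σ + 1) + k`.
  | 1, i => valueRows (γ (i / (σ + 1) / p.M)).1.1 (i / (σ + 1) % p.M) (charOfCode σ (i % (σ + 1)))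
  | 2, i => valueRows (γ (i / (σ + 1) / p.M)).1.2 (i / (σ + 1) % p.M) (charOfCode σ (i % (σ + 1)))
  | 3, i => (tableRows (γ (i / (σ + 1) / p.M)).2 (i / (σ + 1) % p.M)
      (charOfCode σ (i % (σ + 1)))).val
  | 4, b => p.R (b / p.G)
  | 5, b => p.L (b / p.G)
  | 6, b => p.α (b / p.G)
  | 7, b => p.m (b / p.G)
  | 8, b => b % p.G * p.M * (σ + 1)
  -- All scales beyond `r₀` share the tables of scale `r₀ + 1`. Otherwise the space would grow with
  -- the number of scales, which depends on `d`.
  | 9, b => (min (b / p.G) (p.r₀ + 1) * p.G + b % p.G) * p.W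
  | 10, b => p.cap (b / p.G)
  -- Entry `f` of table `j` for scale `r` and group `g` has index `((r * G + g) * W + j) * n + f`;
  -- in section `12` the string number takes the place of `f`.
  | 11, i => nextHit (fun y => (γ (i / n / p.W % p.G)).hash (p.α (i / n / p.W / p.G))
      (p.m (i / n / p.W / p.G)) (i / n % p.W) (str y) = (i % n : ℕ)) n 0
  | 12, i => nextHit (fun y => (γ (i / n / p.W % p.G)).hash (p.α (i / n / p.W / p.G))
      (p.m (i / n / p.W / p.G)) (i / n % p.W) (str y) =
      (γ (i / n / p.W % p.G)).hash (p.α (i / n / p.W / p.G))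
      (p.m (i / n / p.W / p.G)) (i / n % p.W) (str (i % n))) n (i % n + 1)
  | 13, y => (str y).length
  | 14, i => (((str (i / p.d))[i % p.d]?).map Fin.val).getD 0
  | _, _ => 0

/-- The static data, with interleaved sections. -/
noncomputable def cell (γ : ℕ → Seed (Fin σ) p.M p.P n) (str : ℕ → List (Fin σ)) (a : ℕ) : ℕ :=
  p.entryOf γ str (a % 16) (a / 16)

/-- The size of a section. -/
def sectionSize (σ n NS Rmax : ℕ) : ℕ :=
  10 + NS * p.G + p.M + p.P + 3 * n + p.G * p.M * (σ + 1) + 13 * p.W + (p.r₀ + 2) * p.G * p.W * n +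
    n * p.d + 2 * p.d + 2 * Rmax

/-- Consistency of the parameters. -/
structure Consistent (n NS Rmax : ℕ) : Prop where
  d_pos : 0 < p.d
  n_pos : 0 < n
  G_pos : 0 < p.G
  m_le : ∀ r, p.m r ≤ p.M
  M_pos : 0 < p.M
  α_le : ∀ r, 2 * p.α r ≤ p.P
  L_le : ∀ r, p.L r ≤ p.W
  W_le : p.W ≤ p.P
  R_le : ∀ r < NS, p.R r ≤ Rmax
  cap_le : ∀ r, p.cap r ≤ 12 * p.W + n + 1
  m_eq : ∀ r, p.r₀ < r → p.m r = 0

theorem mul_add_div_of_lt {a k b : ℕ} (h : b < k) : (a * k + b) / k = a := by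
  rw [mul_comm, Nat.mul_add_div (by omega), Nat.div_eq_of_lt h, add_zero]

theorem mul_add_mod_of_lt {a k b : ℕ} (h : b < k) : (a * k + b) % k = b := by
  rw [mul_comm, Nat.mul_add_mod, Nat.mod_eq_of_lt h]

variable {p} {NS Rmax : ℕ}

theorem Consistent.sub_le (h : p.Consistent n NS Rmax) :
    σ + 1 ≤ p.G * p.M * (σ + 1) :=
  Nat.le_mul_of_pos_left _ (Nat.mul_pos h.G_pos h.M_pos)

theorem mul_add_lt {a b A B : ℕ} (ha : a < A) (hb : b < B) : a * B + b < A * B := by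
  calc a * B + b < a * B + B := by omega
    _ = (a + 1) * B := by ring
    _ ≤ A * B := Nat.mul_le_mul_right _ ha

/-- Sections `4` to `10` are indexed by blocks. Past the last block their formulas continue with
values, such as radii, that need not fit into a word, and these cells are excluded. -/
theorem Consistent.cell_lt (h : p.Consistent n NS Rmax) {w : ℕ} [NeZero p.P] [NeZero n]
    (hw : 16 * p.sectionSize σ n NS Rmax + 16 ≤ 2 ^ w) {γ : ℕ → Seed (Fin σ) p.M p.P n}
    {str : ℕ → List (Fin σ)} (hstr : ∀ y, (str y).length ≤ p.d) {a : ℕ}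
    (ha : a < 16 * (NS * p.G) ∨ a % 16 < 4 ∨ 10 < a % 16) :
    p.cell γ str a < 2 ^ w := by
  have hσ := h.sub_le (σ := σ)
  have hnd : p.d ≤ n * p.d := Nat.le_mul_of_pos_left _ h.n_pos
  have hS : p.sectionSize σ n NS Rmax = 10 + NS * p.G + p.M + p.P + 3 * n +
    p.G * p.M * (σ + 1) + 13 * p.W + (p.r₀ + 2) * p.G * p.W * n + n * p.d + 2 * p.d + 2 * Rmax := rfl
  have hval : ∀ (ρ : Fin p.M → Option (Fin σ) → ZMod p.P) t c, valueRows ρ t c ≤ p.P := by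
    intro ρ t c
    unfold valueRows
    split
    · exact (ZMod.val_lt _).le
    · omega
  have hb : ∀ i, 16 * i ≤ a → a < 16 * (NS * p.G) → i / p.G < NS ∧ i % p.G < p.G := by
    intro i hi hi'
    exact ⟨(Nat.div_lt_iff_lt_mul h.G_pos).2 (by omega), Nat.mod_lt _ h.G_pos⟩
  unfold cell
  have hi : 16 * (a / 16) ≤ a := by omega
  have hk : a % 16 < 16 := by omega
  generalize a % 16 = k at *
  generalize a / 16 = i at *
  have hbi : (3 < k ∧ k ≤ 10) → i / p.G < NS ∧ i % p.G < p.G := fun h' => hb i hi (by omega)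
  have hc : p.r₀ + 1 + 1 ≤ p.r₀ + 2 := le_rfl
  interval_cases k
  · rcases i with _ | _ | _ | _ | i <;> simp only [entryOf] <;> omega
  · have := hval (γ (i / (σ + 1) / p.M)).1.1 (i / (σ + 1) % p.M) (charOfCode σ (i % (σ + 1)))
    simp only [entryOf]; omega
  · have := hval (γ (i / (σ + 1) / p.M)).1.2 (i / (σ + 1) % p.M) (charOfCode σ (i % (σ + 1)))
    simp only [entryOf]; omega
  · have := ZMod.val_lt (tableRows (γ (i / (σ + 1) / p.M)).2 (i / (σ + 1) % p.M)
      (charOfCode σ (i % (σ + 1))))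
    simp only [entryOf]; omega
  · have := h.R_le _ (hbi (by omega)).1
    simp only [entryOf]; omega
  · have := h.L_le (i / p.G)
    simp only [entryOf]; omega
  · have := h.α_le (i / p.G)
    simp only [entryOf]; omega
  · have := h.m_le (i / p.G)
    simp only [entryOf]; omega
  · have : i % p.G * p.M * (σ + 1) ≤ p.G * p.M * (σ + 1) :=
      Nat.mul_le_mul_right _ (Nat.mul_le_mul_right _ (hbi (by omega)).2.le)
    simp only [entryOf]; omega
  · have h1 := mul_add_lt (A := p.r₀ + 2) (show min (i / p.G) (p.r₀ + 1) < p.r₀ + 2 by omega)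
      (hbi (by omega)).2
    have h2 : (min (i / p.G) (p.r₀ + 1) * p.G + i % p.G) * p.W ≤ (p.r₀ + 2) * p.G * p.W :=
      Nat.mul_le_mul_right _ h1.le
    have h3 : (p.r₀ + 2) * p.G * p.W ≤ (p.r₀ + 2) * p.G * p.W * n :=
      Nat.le_mul_of_pos_right _ h.n_pos
    simp only [entryOf]; omega
  · have := h.cap_le (i / p.G)
    simp only [entryOf]; omega
  · simp only [entryOf]
    refine (nextHit_le _ _ _).trans_lt ?_
    omega
  · simp only [entryOf]
    refine (nextHit_le _ _ _).trans_lt ?_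
    omega
  · have := hstr i
    simp only [entryOf]; omega
  · simp only [entryOf]
    rcases (str (i / p.d))[i % p.d]? with _ | c
    · simp
    · have := c.2
      simp only [Option.map_some, Option.getD_some]
      omega
  · simp only [entryOf]; positivity

/-- Without steps nothing is revealed, so neither the seed nor the table matters. This allows tables
to be shared among the large scales. -/
theorem hash_eq_of_zero (γ : Seed (Fin σ) p.M p.P n) (α j : ℕ) (x : List (Fin σ)) :
    γ.hash α 0 j x = 0 := rfl

/-- The static data holds every block. -/
theorem Consistent.holdsBlock (h : p.Consistent n NS Rmax) [Fact p.P.Prime] [NeZero n]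
    {E : WordRAM.Env} {γ : ℕ → Seed (Fin σ) p.M p.P n} {str : ℕ → List (Fin σ)}
    (hstr : ∀ y, (str y).length ≤ p.d)
    (hw : 16 * p.sectionSize σ n NS Rmax + 16 ≤ 2 ^ E.w) (hw' : p.P + p.P * p.P < 2 ^ E.w)
    (hspace : E.space = 16 * p.sectionSize σ n NS Rmax)
    (hdata : ∀ a < 16 * p.sectionSize σ n NS Rmax,
      (a < 16 * (NS * p.G) ∨ a % 16 < 4 ∨ 10 < a % 16) → E.data a = p.cell γ str a)
    {q : List (Fin σ)} (hq : q.length ≤ p.d) {b : ℕ} (hb : b < NS * p.G) :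
    WordRAM.HoldsBlock E (p.sectionSize σ n NS Rmax) b (p.α (b / p.G)) (p.m (b / p.G))
      (p.L (b / p.G)) (p.R (b / p.G)) (p.cap (b / p.G)) (γ (b % p.G)) str q := by
  have hσ := h.sub_le (σ := σ)
  have hn := h.n_pos
  have hd := h.d_pos
  have hS : p.sectionSize σ n NS Rmax = 10 + NS * p.G + p.M + p.P + 3 * n +
    p.G * p.M * (σ + 1) + 13 * p.W + (p.r₀ + 2) * p.G * p.W * n + n * p.d + 2 * p.d + 2 * Rmax := rfl
  set S := p.sectionSize σ n NS Rmax with hSdef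
  have hr : b / p.G < NS := (Nat.div_lt_iff_lt_mul h.G_pos).2 hb
  have hg : b % p.G < p.G := Nat.mod_lt _ h.G_pos
  have hentry : ∀ k i, k < 16 → i < S → (i < NS * p.G ∨ k < 4 ∨ 10 < k) →
      WordRAM.entry E k i = p.entryOf γ str k i := by
    intro k i hk hi hki
    unfold WordRAM.entry
    rw [hdata _ (by omega) (by omega)]
    unfold cell
    rw [show (16 * i + k) % 16 = k by omega, show (16 * i + k) / 16 = i by omega]
  have e0 : WordRAM.entry E 0 0 = n := hentry 0 0 (by omega) (by omega) (by omega)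
  have e01 : WordRAM.entry E 0 1 = σ + 1 := hentry 0 1 (by omega) (by omega) (by omega)
  have e02 : WordRAM.entry E 0 2 = p.P := hentry 0 2 (by omega) (by omega) (by omega)
  have e03 : WordRAM.entry E 0 3 = p.d := hentry 0 3 (by omega) (by omega) (by omega)
  have e8 : WordRAM.entry E 8 b = b % p.G * p.M * (σ + 1) :=
    hentry 8 b (by omega) (by omega) (by omega)
  have e9 : WordRAM.entry E 9 b = (min (b / p.G) (p.r₀ + 1) * p.G + b % p.G) * p.W :=
    hentry 9 b (by omega) (by omega) (by omega)
  have hL := h.L_le (b / p.G)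
  have hm := h.m_le (b / p.G)
  have hα := h.α_le (b / p.G)
  have hR := h.R_le _ hr
  have hcap := h.cap_le (b / p.G)
  have hW := h.W_le
  -- positions in the random tables
  have hidx : ∀ t < p.m (b / p.G), ∀ c : Option (Fin σ), WordRAM.entry E 8 b +
      t * WordRAM.entry E 0 1 + WordRAM.charCode c =
      (b % p.G * p.M + t) * (σ + 1) + WordRAM.charCode c := by
    intro t ht c
    rw [e8, e01]; ring
  have hidx_lt : ∀ t < p.m (b / p.G), ∀ c : Option (Fin σ),
      (b % p.G * p.M + t) * (σ + 1) + WordRAM.charCode c < p.G * p.M * (σ + 1) := by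
    intro t ht c
    exact mul_add_lt (mul_add_lt hg (by omega)) (charCode_lt c)
  have hdec : ∀ t < p.m (b / p.G), ∀ c : Option (Fin σ),
      ((b % p.G * p.M + t) * (σ + 1) + WordRAM.charCode c) / (σ + 1) / p.M = b % p.G ∧
      ((b % p.G * p.M + t) * (σ + 1) + WordRAM.charCode c) / (σ + 1) % p.M = t ∧
      charOfCode σ (((b % p.G * p.M + t) * (σ + 1) + WordRAM.charCode c) % (σ + 1)) = c := by
    intro t ht c
    rw [mul_add_div_of_lt (charCode_lt c), mul_add_mod_of_lt (charCode_lt c),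
      mul_add_div_of_lt (by omega), mul_add_mod_of_lt (by omega), charOfCode_charCode]
    exact ⟨rfl, rfl, rfl⟩
  have hA : ∀ t < p.m (b / p.G), ∀ c : Option (Fin σ), WordRAM.entry E 1 (WordRAM.entry E 8 b +
      t * WordRAM.entry E 0 1 + WordRAM.charCode c) = valueRows (γ (b % p.G)).1.1 t c := by
    intro t ht c
    have := hidx_lt t ht c
    obtain ⟨d1, d2, d3⟩ := hdec t ht c
    rw [hidx t ht c, hentry 1 _ (by omega) (by omega) (by omega)]
    simp only [entryOf]
    rw [d1, d2, d3]
  have hB : ∀ t < p.m (b / p.G), ∀ c : Option (Fin σ), WordRAM.entry E 2 (WordRAM.entry E 8 b +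
      t * WordRAM.entry E 0 1 + WordRAM.charCode c) = valueRows (γ (b % p.G)).1.2 t c := by
    intro t ht c
    have := hidx_lt t ht c
    obtain ⟨d1, d2, d3⟩ := hdec t ht c
    rw [hidx t ht c, hentry 2 _ (by omega) (by omega) (by omega)]
    simp only [entryOf]
    rw [d1, d2, d3]
  have hZ : ∀ t < p.m (b / p.G), ∀ c : Option (Fin σ), WordRAM.entry E 3 (WordRAM.entry E 8 b +
      t * WordRAM.entry E 0 1 + WordRAM.charCode c) = (tableRows (γ (b % p.G)).2 t c).val := by
    intro t ht c
    have := hidx_lt t ht c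
    obtain ⟨d1, d2, d3⟩ := hdec t ht c
    rw [hidx t ht c, hentry 3 _ (by omega) (by omega) (by omega)]
    simp only [entryOf]
    rw [d1, d2, d3]
  have hval : ∀ (ρ : Fin p.M → Option (Fin σ) → ZMod p.P) t c, valueRows ρ t c < p.P := by
    intro ρ t c
    unfold valueRows
    split
    · exact ZMod.val_lt _
    · exact NeZero.pos _
  -- positions in the hash tables
  have hslot : ∀ j < p.L (b / p.G), WordRAM.entry E 9 b + j < (p.r₀ + 2) * p.G * p.W := by
    intro j hj
    rw [e9]
    exact mul_add_lt (mul_add_lt (by omega) hg) (by omega)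
  have hslot_lt : ∀ j < p.L (b / p.G), ∀ f < n,
      (WordRAM.entry E 9 b + j) * n + f < (p.r₀ + 2) * p.G * p.W * n := by
    intro j hj f hf
    exact mul_add_lt (hslot j hj) hf
  have hhash : ∀ j < p.L (b / p.G), ∀ f < n, ∀ x,
      (γ (((WordRAM.entry E 9 b + j) * n + f) / n / p.W % p.G)).hash
        (p.α (((WordRAM.entry E 9 b + j) * n + f) / n / p.W / p.G))
        (p.m (((WordRAM.entry E 9 b + j) * n + f) / n / p.W / p.G))
        (((WordRAM.entry E 9 b + j) * n + f) / n % p.W) x =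
      (γ (b % p.G)).hash (p.α (b / p.G)) (p.m (b / p.G)) j x := by
    intro j hj f hf x
    rw [mul_add_div_of_lt hf, e9, mul_add_div_of_lt (show j < p.W by omega),
      mul_add_mod_of_lt (show j < p.W by omega), mul_add_div_of_lt hg, mul_add_mod_of_lt hg]
    -- For a large scale the address points to scale `r₀ + 1` instead, but walks without steps give
    -- the same fingerprint.
    rcases Nat.lt_or_ge p.r₀ (b / p.G) with h1 | h1
    · rw [h.m_eq _ h1, h.m_eq _ (by omega), hash_eq_of_zero, hash_eq_of_zero]
    · rw [min_eq_left (by omega)]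
  refine
    { hash := fun j hj =>
        { hw := hw
          hB := by omega
          hb := by omega
          modulus := e0
          threshold := hentry 6 b (by omega) (by omega) (by omega)
          steps := hentry 7 b (by omega) (by omega) (by omega)
          hm := by omega
          hα := by omega
          hn := by omega
          idx := fun t ht c => by
            have := hidx_lt t ht c
            rw [hidx t ht c]
            omega
          val_lt := fun t ht c => by
            rw [hA t ht c, hB t ht c]
            have g1 := hval (γ (b % p.G)).1.1 t c
            have g2 := hval (γ (b % p.G)).1.2 t c
            have g3 : j * valueRows (γ (b % p.G)).1.2 t c ≤ p.P * p.P :=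
              Nat.mul_le_mul (by omega) g2.le
            omega
          val := fun t ht c => by
            rw [hA t ht c, hB t ht c, e02]
            simp only [Seed.rows, valueRows]
            rw [dif_pos (by omega), dif_pos (by omega), dif_pos (by omega), ← ZMod.val_natCast]
            congr 1
            simp
          key_lt := fun t ht c => by
            rw [hZ t ht c]
            exact ZMod.val_lt _
          key := fun t ht c => by
            rw [hZ t ht c]
            exact ZMod.natCast_zmod_val _ }
      band := fun y hy =>
        { hw := hw
          hb := by omega
          hy := by omega
          radius := hentry 4 b (by omega) (by omega) (by omega)
          idx := by
            rw [e03]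
            have := hstr y
            have : y * p.d ≤ n * p.d := Nat.mul_le_mul_right _ hy.le
            omega
          space := by
            have := hstr y
            omega }
      string := fun y hy =>
        { len := hentry 13 y (by omega) (by omega) (by omega)
          char := fun j hj => by
            have := hstr y
            have h1 := mul_add_lt hy (show j < p.d by omega)
            rw [e03, hentry 14 _ (by omega) (by omega) (by omega)]
            simp only [entryOf]
            rw [mul_add_div_of_lt (by omega), mul_add_mod_of_lt (by omega),
              List.getElem?_eq_getElem hj]
            rfl }
      size := hentry 5 b (by omega) (by omega) (by omega)
      limit := hentry 10 b (by omega) (by omega) (by omega)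
      hw := hw
      hb := by omega
      modulus := e0
      hL := by omega
      hcap := by omega
      idx := fun j hj f hf => by
        have := hslot_lt j hj (n - 1) (by omega)
        omega
      head := fun j hj f => by
        have hf := ZMod.val_lt f
        have := hslot_lt j hj f.val hf
        rw [hentry 11 _ (by omega) (by omega) (by omega)]
        simp only [entryOf]
        rw [mul_add_mod_of_lt hf, ZMod.natCast_zmod_val]
        simp only [hhash j hj f.val hf]
      next := fun j hj y hy => by
        have := hslot_lt j hj y hy
        rw [hentry 12 _ (by omega) (by omega) (by omega)]
        simp only [entryOf]
        rw [mul_add_mod_of_lt hy]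
        simp only [hhash j hj y hy] }

end Params

/-! ### Choice of the parameters -/

section Parameters

variable (c : ℝ) (n d P : ℕ) (α : ℕ → ℕ)

/-- The number `⌈n ^ (1 / c)⌉`. -/
noncomputable def width : ℕ := ⌈(n : ℝ) ^ (1 / c)⌉₊

/-- The largest scale with proper hash tables. -/
noncomputable def maxScale : ℕ := Nat.log 3 (n / width c n)

/-- The parameters for `n` strings of length at most `d`, the modulus `P` and the thresholds `α`. -/
noncomputable def lshParams : Params where
  d := d
  M := 5 * d + 3 * (Nat.log 2 n + 1)
  P := P
  G := 2 * (Nat.log 2 n + 1)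
  r₀ := maxScale c n
  W := 8 * n
  -- Beyond the largest hashed scale, walks without steps put all strings into the single bucket of
  -- one table. The limit `n + 1` on failed checks is then never reached.
  α r := if r ≤ maxScale c n then α r else 0
  m r := if r ≤ maxScale c n then 5 * d + 3 * (Nat.log 2 n + 1) else 0
  L r := if r ≤ maxScale c n then 8 * 3 ^ r * width c n else 1
  R r := if r ≤ maxScale c n then ⌊c * r⌋₊ else r
  cap r := if r ≤ maxScale c n then 12 * (8 * 3 ^ r * width c n) + 1 else n + 1

variable {c n d P α}

theorem width_pos (hn : 0 < n) : 0 < width c n :=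
  Nat.ceil_pos.2 (Real.rpow_pos_of_pos (by exact_mod_cast hn) _)

theorem width_le (hc : 1 ≤ c) (hn : 0 < n) : width c n ≤ n := by
  refine Nat.ceil_le.2 ?_
  have h1 : (1 : ℝ) ≤ n := by exact_mod_cast hn
  calc (n : ℝ) ^ (1 / c) ≤ (n : ℝ) ^ (1 : ℝ) :=
        Real.rpow_le_rpow_of_exponent_le h1 ((div_le_one (by linarith)).2 hc)
    _ = n := Real.rpow_one _

theorem width_le_two_mul (hc : 1 ≤ c) (hn : 0 < n) : (width c n : ℝ) ≤ 2 * (n : ℝ) ^ (1 / c) := by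
  have h1 : (1 : ℝ) ≤ n := by exact_mod_cast hn
  have h2 : 1 ≤ (n : ℝ) ^ (1 / c) := Real.one_le_rpow h1 (by positivity)
  have h3 : (width c n : ℝ) < (n : ℝ) ^ (1 / c) + 1 := Nat.ceil_lt_add_one (by positivity)
  linarith

/-- With the next lemma this locates the scale at which the number of tables reaches the order of
`n` and hashing stops paying off. It also bounds the tables of a block by `W = 8 n`. -/
theorem three_pow_maxScale_mul_le (hc : 1 ≤ c) (hn : 0 < n) :
    3 ^ maxScale c n * width c n ≤ n := by
  have h1 := Nat.pow_log_le_self 3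
    (Nat.div_pos (width_le hc hn) (width_pos (c := c) hn)).ne'
  exact (Nat.mul_le_mul_right _ h1).trans (Nat.div_mul_le_self _ _)

theorem lt_three_pow_maxScale_succ_mul (hn : 0 < n) :
    n < 3 ^ (maxScale c n + 1) * width c n :=
  (Nat.div_lt_iff_lt_mul (width_pos hn)).1 (Nat.lt_pow_succ_log_self (by norm_num) _)

theorem maxScale_le : maxScale c n ≤ Nat.log 2 n :=
  (Nat.log_mono_right (Nat.div_le_self _ _)).trans (Nat.log_anti_left (by norm_num) (by norm_num))

theorem three_pow_mul_width_le (hc : 1 ≤ c) (hn : 0 < n) {r : ℕ} (hr : r ≤ maxScale c n) :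
    3 ^ r * width c n ≤ n :=
  (Nat.mul_le_mul_right _ (Nat.pow_le_pow_right (by norm_num) hr)).trans
    (three_pow_maxScale_mul_le hc hn)

theorem radius_le (hc : 1 ≤ c) (r : ℕ) : ((lshParams c n d P α).R r : ℝ) ≤ c * r := by
  have h0 : (0 : ℝ) ≤ r := Nat.cast_nonneg _
  simp only [lshParams]
  split
  · exact Nat.floor_le (by positivity)
  · nlinarith

theorem radius_le_nat (hc : 1 ≤ c) (r : ℕ) : (lshParams c n d P α).R r ≤ ⌈c⌉₊ * r := by
  have h1 := radius_le (n := n) (d := d) (P := P) (α := α) hc r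
  have h2 : c * r ≤ ⌈c⌉₊ * r := mul_le_mul_of_nonneg_right (Nat.le_ceil c) (Nat.cast_nonneg _)
  exact_mod_cast h1.trans h2

theorem le_radius (hc : 1 ≤ c) (r : ℕ) : r ≤ (lshParams c n d P α).R r := by
  have h0 : (0 : ℝ) ≤ r := Nat.cast_nonneg _
  simp only [lshParams]
  split
  · exact Nat.le_floor (by nlinarith)
  · exact le_rfl

theorem lshParams_consistent (hc : 1 ≤ c) (hn : 0 < n) (hd : 0 < d) (hα : ∀ r, r ≤ n → 2 * α r ≤ P)
    (hP : 8 * n ≤ P) :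
    (lshParams c n d P α).Consistent n (d + maxScale c n + 2)
      (⌈c⌉₊ * (d + maxScale c n + 2)) where
  d_pos := hd
  n_pos := hn
  G_pos := by simp [lshParams]
  m_le r := by simp only [lshParams]; split <;> omega
  M_pos := by simp [lshParams]
  α_le r := by
    simp only [lshParams]
    split
    · exact hα r (by
        have := maxScale_le (c := c) (n := n)
        have := Nat.log_le_self 2 n
        omega)
    · omega
  L_le r := by
    simp only [lshParams]
    split_ifs with h
    · have := three_pow_mul_width_le hc hn h
      rw [mul_assoc]; omega
    · omega
  W_le := hP
  R_le r hr := (radius_le_nat hc r).trans (Nat.mul_le_mul_left _ hr.le)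
  cap_le r := by
    simp only [lshParams]
    split_ifs with h
    · have := three_pow_mul_width_le hc hn h
      rw [mul_assoc 8]; omega
    · omega
  m_eq r hr := by
    have hr' : maxScale c n < r := hr
    simp only [lshParams]
    rw [if_neg (by omega)]

/-! ### The query time -/

/-- The scale may exceed every power of `log n`, so the polynomial factor in `r` of the query time
cannot always be hidden in logarithms. Past `maxScale` it is paid from the factor `3 ^ r`, because
the work with the tables no longer grows. -/
theorem sq_le_four_mul_three_pow (s : ℕ) : (s + 2) ^ 2 ≤ 4 * 3 ^ s := by
  induction s with
  | zero => norm_num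
  | succ s ih =>
    calc (s + 1 + 2) ^ 2 ≤ 3 * (s + 2) ^ 2 := by nlinarith [Nat.zero_le s, Nat.zero_le (s ^ 2)]
      _ ≤ 3 * (4 * 3 ^ s) := Nat.mul_le_mul_left _ ih
      _ = _ := by ring

/-- The time for the scales `0, …, r`. -/
noncomputable def scaleTime (p : Params) (lq r : ℕ) : ℕ :=
  (∑ b ∈ Finset.range ((r + 1) * p.G), (WordRAM.blockTime (p.m (b / p.G)) (p.L (b / p.G))
    (p.R (b / p.G)) (p.cap (b / p.G)) lq + 10)) + 100 * (p.d + 1)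

theorem blockTime_le (hc : 1 ≤ c) (hd : 0 < d) {lq r r' Y l : ℕ} (hl : l = Nat.log 2 n + 1)
    (hlq : lq ≤ d) (hr : r' ≤ r) (hY : 0 < Y)
    (hL : (lshParams c n d P α).L r' ≤ 8 * Y) (hcap : (lshParams c n d P α).cap r' ≤ 97 * Y) :
    WordRAM.blockTime ((lshParams c n d P α).m r') ((lshParams c n d P α).L r')
      ((lshParams c n d P α).R r') ((lshParams c n d P α).cap r') lq + 10 ≤
      400000 * (⌈c⌉₊ * (Y * (d * (l * (r + 1))))) := by
  have hc1 : 1 ≤ ⌈c⌉₊ := Nat.one_le_ceil_iff.2 (by linarith)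
  have hl1 : 1 ≤ l := by omega
  have hR : (lshParams c n d P α).R r' ≤ ⌈c⌉₊ * (r + 1) :=
    (radius_le_nat hc r').trans (Nat.mul_le_mul_left _ (by omega))
  have hm : (lshParams c n d P α).m r' ≤ 8 * (d * l) := by
    have : d ≤ d * l := Nat.le_mul_of_pos_right _ hl1
    have : l ≤ d * l := Nat.le_mul_of_pos_left _ hd
    simp only [lshParams]
    split <;> omega
  set C := ⌈c⌉₊
  set u := C * (r + 1) with hu
  have hu1 : 1 ≤ u := Nat.mul_pos hc1 (by omega)
  have hdl : 1 ≤ d * l := Nat.mul_pos hd hl1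
  have hct : WordRAM.checkTime ((lshParams c n d P α).R r') lq ≤ 3700 * (d * u) := by
    unfold WordRAM.checkTime
    have h1 : (lq + 1) * (2 * (lshParams c n d P α).R r' + 4) ≤ (2 * d) * (6 * u) :=
      Nat.mul_le_mul (by omega) (by omega)
    have h2 : 2 * d * (6 * u) = 12 * (d * u) := by ring
    have h3 : 1 ≤ d * u := Nat.mul_pos hd hu1
    omega
  unfold WordRAM.blockTime
  have h1 : (lshParams c n d P α).L r' * (120 * ((lshParams c n d P α).m r' + 1) + 200) ≤
      (8 * Y) * (1280 * (d * l)) := Nat.mul_le_mul hL (by omega)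
  have h2 : ((lshParams c n d P α).cap r' + 1) *
      WordRAM.checkTime ((lshParams c n d P α).R r') lq ≤ (98 * Y) * (3700 * (d * u)) :=
    Nat.mul_le_mul (by omega) hct
  set Z := C * (Y * (d * (l * (r + 1)))) with hZ
  have h3 : (8 * Y) * (1280 * (d * l)) ≤ 10240 * Z := by
    have : Z = Y * (d * l) * u := by rw [hZ, hu]; ring
    rw [this]
    calc 8 * Y * (1280 * (d * l)) = 10240 * (Y * (d * l) * 1) := by ring
      _ ≤ _ := by gcongr
  have h4 : (98 * Y) * (3700 * (d * u)) ≤ 362600 * Z := by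
    have : Z = Y * (d * u) * l := by rw [hZ, hu]; ring
    rw [this]
    calc 98 * Y * (3700 * (d * u)) = 362600 * (Y * (d * u) * 1) := by ring
      _ ≤ _ := by gcongr
  have h5 : 1 ≤ Z := Nat.mul_pos hc1 (Nat.mul_pos hY (Nat.mul_pos hd (Nat.mul_pos hl1 (by omega))))
  clear_value Z
  calc _ ≤ 10240 * Z + 362600 * Z + 100 + 10 :=
        Nat.add_le_add_right (Nat.add_le_add_right
          (Nat.add_le_add (h1.trans h3) (h2.trans h4)) _) _
    _ ≤ 400000 * Z := by omega

/-- There are `(r + 1) * 2 l` blocks, and the width of the band contributes another factor `r + 1`;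
this leads to `(r + 1)² Y`. For hashed scales `r + 1 ≤ l`; for larger ones `Y = n` and only the
excess over `maxScale` has to be paid. -/
theorem scaleTime_le (hc : 1 ≤ c) (hn : 0 < n) (hd : 0 < d) {lq l : ℕ} (hl : l = Nat.log 2 n + 1)
    (hlq : lq ≤ d) (r : ℕ) : scaleTime (lshParams c n d P α) lq r ≤
      4000000 * (⌈c⌉₊ * (d * (3 ^ r * width c n) * l ^ 4)) := by
  have hc1 : 1 ≤ ⌈c⌉₊ := Nat.one_le_ceil_iff.2 (by linarith)
  have hl1 : 1 ≤ l := by omega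
  have hr₀ : maxScale c n + 1 ≤ l := by have := maxScale_le (c := c) (n := n); omega
  -- `Y` bounds the number of tables
  obtain ⟨Y, hY, hYL, hYr⟩ : ∃ Y, 0 < Y ∧ (∀ r' ≤ r, (lshParams c n d P α).L r' ≤ 8 * Y ∧
      (lshParams c n d P α).cap r' ≤ 97 * Y) ∧ (r + 1) ^ 2 * Y ≤ 4 * (l ^ 2 * (3 ^ r * width c n)) := by
    rcases Nat.lt_or_ge (maxScale c n) r with h | h
    · refine ⟨n, hn, fun r' hr' => ?_, ?_⟩
      · simp only [lshParams]
        split_ifs with h'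
        · have := three_pow_mul_width_le hc hn h'
          rw [mul_assoc 8]
          constructor <;> omega
        · constructor <;> omega
      · obtain ⟨s, rfl⟩ : ∃ s, r = maxScale c n + 1 + s := ⟨r - (maxScale c n + 1), by omega⟩
        -- With `u = maxScale c n + 1 ≤ l` the left side is `u + s + 1`, and `l ≥ 1`.
        have h1 : maxScale c n + 1 + s + 1 ≤ l * (s + 2) := by nlinarith
        have h2 := (lt_three_pow_maxScale_succ_mul (c := c) hn).le
        calc (maxScale c n + 1 + s + 1) ^ 2 * n ≤
            (l * (s + 2)) ^ 2 * (3 ^ (maxScale c n + 1) * width c n) := by gcongr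
          _ = l ^ 2 * (3 ^ (maxScale c n + 1) * width c n) * (s + 2) ^ 2 := by ring
          _ ≤ l ^ 2 * (3 ^ (maxScale c n + 1) * width c n) * (4 * 3 ^ s) := by
            gcongr; exact sq_le_four_mul_three_pow s
          _ = _ := by rw [pow_add _ _ s]; ring
    · refine ⟨3 ^ r * width c n, Nat.mul_pos (by positivity) (width_pos hn), fun r' hr' => ?_, ?_⟩
      · have h1 : 3 ^ r' * width c n ≤ 3 ^ r * width c n :=
          Nat.mul_le_mul_right _ (Nat.pow_le_pow_right (by norm_num) hr')
        have h2 : 0 < 3 ^ r' * width c n := Nat.mul_pos (by positivity) (width_pos hn)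
        simp only [lshParams]
        rw [if_pos (by omega), if_pos (by omega), mul_assoc 8]
        constructor <;> omega
      · have h1 : (r + 1) ^ 2 ≤ l ^ 2 := Nat.pow_le_pow_left (by omega) 2
        calc (r + 1) ^ 2 * (3 ^ r * width c n) ≤ l ^ 2 * (3 ^ r * width c n) :=
              Nat.mul_le_mul_right _ h1
          _ ≤ _ := by omega
  have hG : (lshParams c n d P α).G = 2 * l := by simp [lshParams, hl]
  have hdd : (lshParams c n d P α).d = d := rfl
  unfold scaleTime
  have hsum := Finset.sum_le_card_nsmul (Finset.range ((r + 1) * (lshParams c n d P α).G))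
    (fun b => WordRAM.blockTime ((lshParams c n d P α).m (b / (lshParams c n d P α).G))
      ((lshParams c n d P α).L (b / (lshParams c n d P α).G))
      ((lshParams c n d P α).R (b / (lshParams c n d P α).G))
      ((lshParams c n d P α).cap (b / (lshParams c n d P α).G)) lq + 10)
    (400000 * (⌈c⌉₊ * (Y * (d * (l * (r + 1)))))) (fun b hb => by
      have hr' : b / (lshParams c n d P α).G ≤ r := by
        have := (Nat.div_lt_iff_lt_mul (by rw [hG]; omega)).2 (Finset.mem_range.1 hb)
        omega
      exact blockTime_le hc hd hl hlq hr' hY (hYL _ hr').1 (hYL _ hr').2)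
  rw [Finset.card_range, smul_eq_mul] at hsum
  refine (Nat.add_le_add_right hsum _).trans ?_
  rw [hG, hdd]
  have e1 : (r + 1) * (2 * l) * (400000 * (⌈c⌉₊ * (Y * (d * (l * (r + 1)))))) =
      800000 * (⌈c⌉₊ * (d * ((r + 1) ^ 2 * Y) * l ^ 2)) := by ring
  have e2 : ⌈c⌉₊ * (d * ((r + 1) ^ 2 * Y) * l ^ 2) ≤
      ⌈c⌉₊ * (d * (4 * (l ^ 2 * (3 ^ r * width c n))) * l ^ 2) := by gcongr
  have e3 : ⌈c⌉₊ * (d * (4 * (l ^ 2 * (3 ^ r * width c n))) * l ^ 2) =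
      4 * (⌈c⌉₊ * (d * (3 ^ r * width c n) * l ^ 4)) := by ring
  have e4 : d ≤ ⌈c⌉₊ * (d * (3 ^ r * width c n) * l ^ 4) := by
    have h1 : 1 ≤ ⌈c⌉₊ * ((3 ^ r * width c n) * l ^ 4) :=
      Nat.mul_pos hc1 (Nat.mul_pos (Nat.mul_pos (by positivity) (width_pos hn)) (by positivity))
    calc d = d * 1 := by ring
      _ ≤ d * (⌈c⌉₊ * ((3 ^ r * width c n) * l ^ 4)) := by gcongr
      _ = _ := by ring
  omega

/-- This is the cost of running into the first exhaustive scale. Its factor `n` will cancel the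
failure probability `1/n`. -/
theorem scaleTime_maxScale_le (hc : 1 ≤ c) (hn : 0 < n) (hd : 0 < d) {lq l : ℕ}
    (hl : l = Nat.log 2 n + 1) (hlq : lq ≤ d) :
    scaleTime (lshParams c n d P α) lq (maxScale c n + 1) ≤
      12000000 * (⌈c⌉₊ * (d * l ^ 4)) * n := by
  refine (scaleTime_le hc hn hd hl hlq _).trans ?_
  have h1 := three_pow_maxScale_mul_le hc hn
  calc 4000000 * (⌈c⌉₊ * (d * (3 ^ (maxScale c n + 1) * width c n) * l ^ 4)) =
        12000000 * (⌈c⌉₊ * (d * l ^ 4)) * (3 ^ maxScale c n * width c n) := by rw [pow_succ]; ring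
    _ ≤ _ := by gcongr

/-! ### The space -/

/-- The quadratic terms are the random tables, of size about `l (d + l) σ`, the hash tables, with
about `l` scales, `2 l` groups, `8 n` tables and `n` entries each, and the strings themselves. Each
term is compared with `Z`. -/
theorem sectionSize_le (hc : 1 ≤ c) (hn : 0 < n) {σ l C : ℕ} (hl : l = Nat.log 2 n + 1)
    (hC : 1 ≤ C) (hdC : d ≤ C * n) (hσ : σ ≤ C * n) (hP : P ≤ 128 * n ^ 2) :
    16 * (lshParams c n d P α).sectionSize σ n (d + maxScale c n + 2)
      (⌈c⌉₊ * (d + maxScale c n + 2)) ≤ 6000 * (⌈c⌉₊ * C ^ 2) * n ^ 2 * l ^ 2 := by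
  have hc1 : 1 ≤ ⌈c⌉₊ := Nat.one_le_ceil_iff.2 (by linarith)
  have hl1 : 1 ≤ l := by omega
  have hr₀ : maxScale c n + 1 ≤ l := by have := maxScale_le (c := c) (n := n); omega
  set K := ⌈c⌉₊ with hK
  set Z := K * C ^ 2 * n ^ 2 * l ^ 2 with hZ
  have b1 : C * n * l ≤ Z := by
    calc C * n * l = 1 * (C * 1) * (n * 1) * (l * 1) := by ring
      _ ≤ K * (C * C) * (n * n) * (l * l) := by gcongr; omega
      _ = Z := by rw [hZ]; ring
  have b1' : K * (C * n * l) ≤ Z := by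
    calc K * (C * n * l) = K * (C * 1) * (n * 1) * (l * 1) := by ring
      _ ≤ K * (C * C) * (n * n) * (l * l) := by gcongr; omega
      _ = Z := by rw [hZ]; ring
  have b2 : C * n * l ^ 2 ≤ Z := by
    calc C * n * l ^ 2 = 1 * (C * 1) * (n * 1) * l ^ 2 := by ring
      _ ≤ K * (C * C) * (n * n) * l ^ 2 := by gcongr; omega
      _ = Z := by rw [hZ]; ring
  have b3 : n ^ 2 * l ^ 2 ≤ Z := by
    calc n ^ 2 * l ^ 2 = 1 * 1 * n ^ 2 * l ^ 2 := by ring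
      _ ≤ K * C ^ 2 * n ^ 2 * l ^ 2 := by gcongr; exact Nat.one_le_pow _ _ hC
      _ = Z := by rw [hZ]
  have b4 : n ^ 2 ≤ Z := le_trans (Nat.le_mul_of_pos_right _ (by positivity)) b3
  have b5 : C * n ^ 2 ≤ Z := by
    calc C * n ^ 2 = 1 * (C * 1) * n ^ 2 * 1 := by ring
      _ ≤ K * (C * C) * n ^ 2 * l ^ 2 := by gcongr; exact Nat.one_le_pow _ _ hl1
      _ = Z := by rw [hZ]; ring
  have b6 : C ^ 2 * n ^ 2 * l ^ 2 ≤ Z := by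
    calc C ^ 2 * n ^ 2 * l ^ 2 = 1 * C ^ 2 * n ^ 2 * l ^ 2 := by ring
      _ ≤ K * C ^ 2 * n ^ 2 * l ^ 2 := by gcongr
  have c1 : 1 ≤ C * n := Nat.mul_pos hC hn
  have c2 : C * n ≤ C * n * l := Nat.le_mul_of_pos_right _ hl1
  have c3 : l ≤ C * n * l := Nat.le_mul_of_pos_left _ c1
  have c4 : n ≤ C * n := Nat.le_mul_of_pos_left _ hC
  have hNS : d + maxScale c n + 2 ≤ 3 * (C * n * l) := by omega
  have hM : 5 * d + 3 * l ≤ 8 * (C * n * l) := by omega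
  have t1 : (d + maxScale c n + 2) * (2 * l) ≤ 6 * Z := by
    calc (d + maxScale c n + 2) * (2 * l) ≤ 3 * (C * n * l) * (2 * l) := by gcongr
      _ = 6 * (C * n * l ^ 2) := by ring
      _ ≤ _ := by omega
  have t2 : 2 * l * (5 * d + 3 * l) * (σ + 1) ≤ 32 * Z := by
    calc 2 * l * (5 * d + 3 * l) * (σ + 1) ≤ 2 * l * (8 * (C * n * l)) * (2 * (C * n)) := by
          gcongr; omega
      _ = 32 * (C ^ 2 * n ^ 2 * l ^ 2) := by ring
      _ ≤ _ := by omega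
  have t3 : (maxScale c n + 2) * (2 * l) * (8 * n) * n ≤ 32 * Z := by
    calc (maxScale c n + 2) * (2 * l) * (8 * n) * n ≤ (2 * l) * (2 * l) * (8 * n) * n := by
          gcongr; omega
      _ = 32 * (n ^ 2 * l ^ 2) := by ring
      _ ≤ _ := by omega
  have t4 : n * d ≤ Z := by
    calc n * d ≤ n * (C * n) := by gcongr
      _ = C * n ^ 2 := by ring
      _ ≤ _ := b5
  have t5 : K * (d + maxScale c n + 2) ≤ 3 * Z := by
    calc K * (d + maxScale c n + 2) ≤ K * (3 * (C * n * l)) := by gcongr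
      _ = 3 * (K * (C * n * l)) := by ring
      _ ≤ _ := by omega
  have hZ' : 6000 * (K * C ^ 2) * n ^ 2 * l ^ 2 = 6000 * Z := by rw [hZ]; ring
  rw [hZ']
  simp only [Params.sectionSize, lshParams]
  rw [← hl]
  omega

/-- With `N = 2^l` one has `n² l² ≤ N⁴`, and a constant `D'` is less than `2^D' ≤ N^D'`. So `(4 +
D') l` bits suffice, both for addresses and for the unreduced values `A + j B`. -/
theorem word_size {l C : ℕ} (hn : n ≤ 2 ^ l) (hl : 0 < l) {s P : ℕ}
    (hs : s ≤ 6000 * (⌈c⌉₊ * C ^ 2) * n ^ 2 * l ^ 2) (hP : P ≤ 128 * n ^ 2) :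
    s + 16 ≤ 2 ^ ((4 + (6016 * (⌈c⌉₊ * C ^ 2) + 65536)) * l) ∧
      P + P * P < 2 ^ ((4 + (6016 * (⌈c⌉₊ * C ^ 2) + 65536)) * l) := by
  set D := ⌈c⌉₊ * C ^ 2 with hD
  have hll : l ≤ 2 ^ l := Nat.lt_two_pow_self.le
  set N := 2 ^ l with hN
  have hN1 : 1 ≤ N := Nat.one_le_two_pow
  have h1 : n ^ 2 * l ^ 2 ≤ N ^ 4 := by
    calc n ^ 2 * l ^ 2 ≤ N ^ 2 * N ^ 2 := by gcongr
      _ = N ^ 4 := by ring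
  have h2 : (6016 * D + 65536) * N ^ 4 < 2 ^ ((4 + (6016 * D + 65536)) * l) := by
    have e : 2 ^ ((4 + (6016 * D + 65536)) * l) = N ^ (6016 * D + 65536) * N ^ 4 := by
      rw [← pow_add, hN, ← pow_mul]
      congr 1
      ring
    rw [e]
    refine Nat.mul_lt_mul_of_pos_right ?_ (by positivity)
    calc 6016 * D + 65536 < 2 ^ (6016 * D + 65536) := Nat.lt_two_pow_self
      _ ≤ N ^ (6016 * D + 65536) := by
        refine Nat.pow_le_pow_left ?_ _
        calc 2 = 2 ^ 1 := rfl
          _ ≤ 2 ^ l := Nat.pow_le_pow_right (by norm_num) hl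
  have h4 : 1 ≤ N ^ 4 := Nat.one_le_pow _ _ hN1
  constructor
  · have h3 : 6000 * D * n ^ 2 * l ^ 2 ≤ 6000 * D * N ^ 4 := by
      rw [mul_assoc]; gcongr
    have h5 : (6016 * D + 65536) * N ^ 4 = 6000 * D * N ^ 4 + 16 * (D * N ^ 4) + 65536 * N ^ 4 := by
      ring
    omega
  · have h3 : P ≤ 128 * N ^ 2 := hP.trans (by gcongr)
    have h5 : P * P ≤ 128 * N ^ 2 * (128 * N ^ 2) := Nat.mul_le_mul h3 h3
    have h6 : 128 * N ^ 2 * (128 * N ^ 2) = 16384 * N ^ 4 := by ring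
    have h7 : N ^ 2 ≤ N ^ 4 := Nat.pow_le_pow_right hN1 (by norm_num)
    have h8 : (6016 * D + 65536) * N ^ 4 = 6016 * D * N ^ 4 + 65536 * N ^ 4 := by ring
    omega

end Parameters

/-! ### Uniformly distributed data -/

section Uniform

variable {Ω β : Type*}

theorem tsum_map_mul (U : PMF Ω) (f : Ω → β) (g : β → ℝ≥0∞) :
    ∑' m, U.map f m * g m = ∑' ω, U ω * g (f ω) := by
  classical
  simp_rw [PMF.map_apply, ← ENNReal.tsum_mul_right]
  rw [ENNReal.tsum_comm]
  refine tsum_congr fun ω => ?_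
  rw [tsum_eq_single (f ω)]
  · simp
  · intro m hm
    simp [hm]

variable [Fintype Ω] [Nonempty Ω] {N : ℕ} {p : Ω → Prop}

theorem uniformOfFintype_not_le (hN : 0 < N)
    (h : N * Nat.card {ω // ¬ p ω} ≤ Fintype.card Ω) :
    (PMF.uniformOfFintype Ω).toOuterMeasure {ω | ¬ p ω} ≤ 1 / (N : ℝ≥0∞) := by
  classical
  rw [PMF.toOuterMeasure_uniformOfFintype_apply, ← Nat.card_eq_fintype_card]
  refine ENNReal.div_le_of_le_mul ?_
  rw [one_div, mul_comm, ← div_eq_mul_inv]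
  refine (ENNReal.le_div_iff_mul_le (.inl (by exact_mod_cast hN.ne')) (.inl (by simp))).2 ?_
  rw [mul_comm]
  exact_mod_cast h

theorem one_sub_le_toOuterMeasure_map_uniformOfFintype (hN : 0 < N)
    (h : N * Nat.card {ω // ¬ p ω} ≤ Fintype.card Ω) {f : Ω → β} {s : Set β}
    (hs : ∀ ω, p ω → f ω ∈ s) :
    1 - 1 / (N : ℝ≥0∞) ≤ ((PMF.uniformOfFintype Ω).map f).toOuterMeasure s := by
  rw [PMF.toOuterMeasure_map_apply, tsub_le_iff_right]
  have h1 : (PMF.uniformOfFintype Ω).toOuterMeasure Set.univ = 1 :=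
    (PMF.toOuterMeasure_apply_eq_one_iff _ _).2 (Set.subset_univ _)
  refine h1.symm.le.trans (le_trans ?_ ((MeasureTheory.measure_union_le (f ⁻¹' s)
    {ω | ¬ p ω}).trans (by gcongr; exact uniformOfFintype_not_le hN h)))
  refine MeasureTheory.measure_mono fun ω _ => ?_
  by_cases hω : p ω
  · exact .inl (hs ω hω)
  · exact .inr hω

/-- The exceptional outcomes have total weight at most `1/N`; the others are charged with `a` in
full. -/
theorem tsum_map_uniformOfFintype_mul_le (hN : 0 < N)
    (h : N * Nat.card {ω // ¬ p ω} ≤ Fintype.card Ω) {f : Ω → β} {g : β → ℝ≥0∞} {a b : ℝ≥0∞}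
    (ha : ∀ ω, p ω → g (f ω) ≤ a) (hb : ∀ ω, ¬ p ω → g (f ω) ≤ b) :
    ∑' m, (PMF.uniformOfFintype Ω).map f m * g m ≤ a + 1 / (N : ℝ≥0∞) * b := by
  classical
  rw [tsum_map_mul]
  calc ∑' ω, PMF.uniformOfFintype Ω ω * g (f ω) ≤
        ∑' ω, (PMF.uniformOfFintype Ω ω * a +
          {ω | ¬ p ω}.indicator (PMF.uniformOfFintype Ω) ω * b) := by
        refine ENNReal.tsum_le_tsum fun ω => ?_
        by_cases hω : p ω
        · exact (mul_le_mul_right (ha ω hω) _).trans le_self_add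
        · rw [Set.indicator_of_mem (by exact hω)]
          exact (mul_le_mul_right (hb ω hω) _).trans le_add_self
    _ = a + (PMF.uniformOfFintype Ω).toOuterMeasure {ω | ¬ p ω} * b := by
        rw [ENNReal.tsum_add, ENNReal.tsum_mul_right, ENNReal.tsum_mul_right, PMF.tsum_coe,
          one_mul, PMF.toOuterMeasure_apply]
    _ ≤ _ := by
        gcongr
        exact uniformOfFintype_not_le hN h

end Uniform

/-! ### Good groups -/

instance Seed.fintype {β : Type*} [Fintype β] [DecidableEq β] {M P N : ℕ} [NeZero P] [NeZero N] :
    Fintype (Seed β M P N) :=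
  inferInstance

/-- All strings share the fingerprint `0`, so every string is a hit candidate, and one table has at
most `N` false hits. -/
theorem Seed.good_zero {β : Type*} [DecidableEq β] {M P N : ℕ} (γ : Seed β M P N) {α R : ℕ}
    {str : ℕ → List β} {q : List β} (h : ∃ y < N, editDist q (str y) ≤ R) :
    γ.Good α 0 1 R (N + 1) str q := by
  obtain ⟨y, hy, hyR⟩ := h
  refine ⟨⟨0, one_pos, y, hy, rfl, hyR⟩, Nat.lt_succ_of_le ?_⟩
  refine (Finset.card_filter_le _ _).trans ?_
  simp

/-! ### Runs on the built data -/

namespace Params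

variable {σ n : ℕ} (p : Params)

/-- The memory with the static data. -/
noncomputable def memory (γ : ℕ → Seed (Fin σ) p.M p.P n) (str : ℕ → List (Fin σ)) (s w : ℕ) :
    Memory s w :=
  fun i => ⟨p.cell γ str i % 2 ^ w, Nat.mod_lt _ (by positivity)⟩

/-- The seeds of all groups; those from `p.G` on are irrelevant. -/
def extend (ω : Fin p.G → Seed (Fin σ) p.M p.P n) (g : ℕ) : Seed (Fin σ) p.M p.P n :=
  if h : g < p.G then ω ⟨g, h⟩ else 0

/-- The random memory built for a set of strings. -/
noncomputable def build (n s w : ℕ) [NeZero n] [NeZero p.P] (S : Finset (List (Fin σ))) :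
    PMF (Memory s w) :=
  (PMF.uniformOfFintype (Fin p.G → Seed (Fin σ) p.M p.P n)).map fun ω =>
    p.memory (p.extend ω) (fun y => (S.toList[y]?).getD []) s w

variable {p} {NS Rmax : ℕ}

/-- Blocks are ordered by scale and then by group: group `g` of scale `r` has number `r * G + g`.
All blocks searched before it belong to scales up to `r`. -/
theorem Consistent.runs (h : p.Consistent n NS Rmax) [Fact p.P.Prime] [NeZero n] {w : ℕ}
    {γ : ℕ → Seed (Fin σ) p.M p.P n} {str : ℕ → List (Fin σ)}
    (hstr : ∀ y, (str y).length ≤ p.d)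
    (hw : 16 * p.sectionSize σ n NS Rmax + 16 ≤ 2 ^ w) (hw' : p.P + p.P * p.P < 2 ^ w)
    {q : List (Fin σ)} (hq : q.length ≤ p.d) {r g : ℕ} (hr : r < NS) (hg : g < p.G)
    (hgood : (γ g).Good (p.α r) (p.m r) (p.L r) (p.R r) (p.cap r) str q) :
    WordRAM.Runs (queryEnv (p.memory γ str (16 * p.sectionSize σ n NS Rmax) w) q)
      WordRAM.nearestProg (queryStart w q) fun s' T => ∃ r' ≤ r, ∃ y < n,
        editDist q (str y) ≤ p.R r' ∧ s'.output = (str y).map Fin.val ∧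
        T ≤ scaleTime p q.length r := by
  have hσ := h.sub_le (σ := σ)
  have hS : p.sectionSize σ n NS Rmax = 10 + NS * p.G + p.M + p.P + 3 * n +
    p.G * p.M * (σ + 1) + 13 * p.W + (p.r₀ + 2) * p.G * p.W * n + n * p.d + 2 * p.d + 2 * Rmax := rfl
  have hqE : WordRAM.HoldsQuery
      (queryEnv (p.memory γ str (16 * p.sectionSize σ n NS Rmax) w) q) q := by
    refine ⟨fun i hi => ?_⟩
    have : (q[i] : ℕ) < σ := q[i].2
    simp only [queryEnv]
    rw [dif_pos hi, Nat.mod_eq_of_lt (by omega)]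
  have hb₀ : r * p.G + g < (r + 1) * p.G := by rw [add_mul]; omega
  have hNS : (r + 1) * p.G ≤ NS * p.G := Nat.mul_le_mul_right _ hr
  have hrun := WordRAM.nearestProg_runs (g := r * p.G + g) (d := p.d)
    (γ := fun b => γ (b % p.G)) (α := fun b => p.α (b / p.G)) (m := fun b => p.m (b / p.G))
    (L := fun b => p.L (b / p.G)) (R := fun b => p.R (b / p.G)) (cap := fun b => p.cap (b / p.G))
    (s := queryStart w q) (str := str) hqE
    (fun b hb => h.holdsBlock hstr hw hw' rfl (fun a ha ha' => by
      simp only [queryEnv, memory]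
      rw [dif_pos ha, Nat.mod_eq_of_lt (h.cell_lt hw hstr ha')]) hq (by omega))
    (fun y _ => hstr y) (by simpa only [mul_add_div_of_lt hg, mul_add_mod_of_lt hg] using hgood)
    (by simp only [queryStart, if_pos]; exact Nat.mod_eq_of_lt (by omega)) rfl rfl
  obtain ⟨s', T, hexec, b, hb, y, hy, hyR, hout, hT⟩ := hrun
  refine ⟨s', T, hexec, b / p.G, ?_, y, hy, hyR, hout, hT.trans ?_⟩
  · have := (Nat.div_lt_iff_lt_mul h.G_pos).2 (hb.trans_lt hb₀)
    omega
  · refine Nat.add_le_add_right (Finset.sum_le_sum_of_subset ?_) _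
    exact Finset.range_subset_range.2 hb₀

end Params

theorem queryTime_le {s w σ : ℕ} {P : WordRAM.Prog} {m : Memory s w} {q : List (Fin σ)}
    {st : WordRAM.State} {t T : ℕ}
    (h : WordRAM.Exec (queryEnv m q) P (queryStart w q) st t) (ht : t ≤ T) :
    queryTime P m q ≤ T :=
  (iInf_le_of_le st (iInf_le_of_le t (iInf_le _ h))).trans (by exact_mod_cast ht)

/-! ### Parameters with all required properties -/

section Search

variable {c : ℝ} {n d σ : ℕ}

/-- In the last conclusion, failure of some seed at scale `r` is the signal that `r` is hashed. Then
the exhaustive scale `r₁` lies above `r` and finds the near string with every seed. -/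
theorem exists_params (hc : 1 ≤ c) (hn : 0 < n) (hd : 0 < d) {l C : ℕ} (hl : l = Nat.log 2 n + 1)
    (hC : 1 ≤ C) (hdC : d ≤ C * n) (hσ : σ ≤ C * n) :
    ∃ (p : Params) (NS Rmax r₁ : ℕ), p.P.Prime ∧ p.d = d ∧ p.G = 2 * l ∧ p.Consistent n NS Rmax ∧
      16 * p.sectionSize σ n NS Rmax ≤ 6000 * (⌈c⌉₊ * C ^ 2) * n ^ 2 * l ^ 2 ∧
      16 * p.sectionSize σ n NS Rmax + 16 ≤ 2 ^ ((4 + (6016 * (⌈c⌉₊ * C ^ 2) + 65536)) * l) ∧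
      p.P + p.P * p.P < 2 ^ ((4 + (6016 * (⌈c⌉₊ * C ^ 2) + 65536)) * l) ∧
      d < NS ∧ r₁ < NS ∧ (∀ r, (p.R r : ℝ) ≤ c * r) ∧
      (∀ lq ≤ d, ∀ r, scaleTime p lq r ≤
        4000000 * (⌈c⌉₊ * (d * (3 ^ r * width c n) * l ^ 4))) ∧
      (∀ lq ≤ d, scaleTime p lq r₁ ≤ 12000000 * (⌈c⌉₊ * (d * l ^ 4)) * n) ∧
      ∀ [Fact p.P.Prime] [NeZero n] (str : ℕ → List (Fin σ)) (q : List (Fin σ)) (r : ℕ),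
        (∀ y < n, (str y).length ≤ d) → q.length ≤ d → (∃ y < n, editDist q (str y) ≤ r) →
        2 ^ p.G * Nat.card {ω : Fin p.G → Seed (Fin σ) p.M p.P n // ∀ g, ¬ (ω g).Good
          (p.α r) (p.m r) (p.L r) (p.R r) (p.cap r) str q} ≤
            Fintype.card (Fin p.G → Seed (Fin σ) p.M p.P n) ∧
        ((∃ γ : Seed (Fin σ) p.M p.P n, ¬ γ.Good
          (p.α r) (p.m r) (p.L r) (p.R r) (p.cap r) str q) →
        ∀ γ : Seed (Fin σ) p.M p.P n, γ.Good
          (p.α r₁) (p.m r₁) (p.L r₁) (p.R r₁) (p.cap r₁) str q) := by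
  have hn2 : n < 2 ^ l := by rw [hl]; exact Nat.lt_pow_succ_log_self (by norm_num) _
  have hnn : n ≤ n ^ 2 := Nat.le_self_pow (by norm_num) _
  -- By Bertrand's postulate there is a prime of order `n²`: at least the `12 n²` needed for
  -- rounding the threshold and the `8 n` needed for distinct tables, yet small enough for a word.
  obtain ⟨P, hP, hPlt, hPle⟩ := Nat.exists_prime_lt_and_le_two_mul (64 * n ^ 2) (by positivity)
  have hex : ∀ r, ∃ α : ℕ, r ≤ n → 2 * α ≤ P ∧
      4 ≤ ((8 * 3 ^ r * ⌈(n : ℝ) ^ (1 / c)⌉₊ : ℕ) : ℝ) *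
        ((α / P : ℝ) ^ 2 / (1 - (α / P : ℝ) ^ 2)) ^ r ∧
      (3 * (α / P : ℝ) ^ 2 / (1 - (α / P : ℝ) ^ 2)) ^ (⌊c * r⌋₊ + 1) ≤ 1 / n := fun r => by
    by_cases hr : r ≤ n
    · obtain ⟨α, hα⟩ := exists_threshold hc hn hr (P := P) (by omega)
      exact ⟨α, fun _ => hα⟩
    · exact ⟨0, fun h => absurd h hr⟩
  choose α hα using hex
  have hmax : maxScale c n ≤ n := maxScale_le.trans (Nat.log_le_self 2 n)
  have hcons := lshParams_consistent (c := c) (n := n) hc hn hd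
    (fun r hr => (hα r hr).1) (by omega)
  have hsize := sectionSize_le (c := c) (n := n) (d := d) (P := P) (α := α) hc hn hl hC hdC hσ
    (by omega)
  have hword := word_size (c := c) hn2.le (by omega) hsize (P := P) (by omega)
  refine ⟨lshParams c n d P α, d + maxScale c n + 2, ⌈c⌉₊ * (d + maxScale c n + 2),
    maxScale c n + 1, hP, rfl, by simp [lshParams, hl], hcons, hsize, hword.1, hword.2, by omega,
    by omega, fun r => radius_le hc r, fun lq hlq r => scaleTime_le hc hn hd hl hlq r,
    fun lq hlq => scaleTime_maxScale_le hc hn hd hl hlq, ?_⟩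
  intro _ _ str q r hstr hq hy
  -- Scales that search exhaustively are good for every seed as soon as their radius reaches `r`.
  have hlarge : ∀ r', maxScale c n < r' → r ≤ r' →
      ∀ γ : Seed (Fin σ) (lshParams c n d P α).M (lshParams c n d P α).P n,
        γ.Good ((lshParams c n d P α).α r') ((lshParams c n d P α).m r')
          ((lshParams c n d P α).L r') ((lshParams c n d P α).R r')
          ((lshParams c n d P α).cap r') str q := by
    intro r' hr' hrr' γ
    obtain ⟨y, hy, hyr⟩ := hy
    have := γ.good_zero (α := 0) (R := r') (str := str) (q := q) ⟨y, hy, hyr.trans hrr'⟩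
    simpa only [lshParams, if_neg (not_le.2 hr')] using this
  rcases Nat.lt_or_ge (maxScale c n) r with hr | hr
  · refine ⟨?_, fun ⟨γ, hγ⟩ => absurd (hlarge r hr le_rfl γ) hγ⟩
    have : IsEmpty {ω : Fin (lshParams c n d P α).G →
        Seed (Fin σ) (lshParams c n d P α).M (lshParams c n d P α).P n // ∀ g, ¬ (ω g).Good
          ((lshParams c n d P α).α r) ((lshParams c n d P α).m r)
          ((lshParams c n d P α).L r) ((lshParams c n d P α).R r)
          ((lshParams c n d P α).cap r) str q} :=
      ⟨fun ω => ω.2 ⟨0, hcons.G_pos⟩ (hlarge r hr le_rfl _)⟩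
    rw [Nat.card_of_isEmpty]
    omega
  · refine ⟨?_, fun _ => hlarge _ (by omega) (by omega)⟩
    refine two_pow_mul_card_forall_not_le
      (Γ := Seed (Fin σ) (lshParams c n d P α).M (lshParams c n d P α).P n) _
      (fun γ => γ.Good ((lshParams c n d P α).α r) ((lshParams c n d P α).m r)
        ((lshParams c n d P α).L r) ((lshParams c n d P α).R r)
        ((lshParams c n d P α).cap r) str q) ?_
    have hrn := hα r (hr.trans hmax)
    have hL : (lshParams c n d P α).L r = 8 * 3 ^ r * width c n := if_pos hr
    have hcap : (lshParams c n d P α).cap r = 12 * (lshParams c n d P α).L r + 1 := by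
      rw [hL]; exact if_pos hr
    have hm : (lshParams c n d P α).m r = (lshParams c n d P α).M := by
      simp [lshParams, hr]
    have hα' : (lshParams c n d P α).α r = α r := if_pos hr
    rw [hcap, hm]
    have hPP : (lshParams c n d P α).P = P := rfl
    refine two_mul_card_not_good_le (r := r) (d := d) (hcons.α_le r) ?_
      ((hcons.L_le r).trans hcons.W_le) (le_radius hc r) hq hstr hy ?_ ?_ ?_
    · rw [hL]
      exact Nat.mul_pos (by positivity) (width_pos hn)
    · rw [hL, hα', hPP]
      exact hrn.2.1
    · rw [hα', hPP, show (lshParams c n d P α).R r = ⌊c * r⌋₊ from if_pos hr]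
      exact hrn.2.2
    · exact (congrArg (fun x => (2 : ℝ) ^ (d + d) * (3 / 4) ^ (5 * d + 3 * x) ≤ 1 / (n : ℝ))
        hl).mp (two_pow_mul_pow_le hn hn2.le)

end Search

/-! ### The main theorem -/

/-- If some group is good at scale `r`, the query stops by then, and any earlier answer is even
closer to `q` than required. If none is, scale `r` is hashed and the query still halts at scale
`r₁`, which bounds the expected time. -/
theorem Params.Consistent.build_spec {n σ NS Rmax : ℕ} {p : Params} {c : ℝ} (hc : 1 ≤ c)
    (h : p.Consistent n NS Rmax) [Fact p.P.Prime] [NeZero n] {w : ℕ}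
    (hw : 16 * p.sectionSize σ n NS Rmax + 16 ≤ 2 ^ w) (hw' : p.P + p.P * p.P < 2 ^ w)
    {S : Finset (List (Fin σ))} (hS : S.card = n) (hSd : ∀ y ∈ S, y.length ≤ p.d)
    {q : List (Fin σ)} (hq : q.length ≤ p.d) {r r₁ : ℕ} (hr : r < NS) (hr₁ : r₁ < NS)
    (hR : ∀ r, (p.R r : ℝ) ≤ c * r) (hG : 2 ≤ 2 ^ p.G) (hGn : n ≤ 2 ^ p.G)
    (hprob : ∀ str : ℕ → List (Fin σ), (∀ y < n, (str y).length ≤ p.d) →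
      (∃ y < n, editDist q (str y) ≤ r) →
        2 ^ p.G * Nat.card {ω : Fin p.G → Seed (Fin σ) p.M p.P n // ∀ g, ¬ (ω g).Good
          (p.α r) (p.m r) (p.L r) (p.R r) (p.cap r) str q} ≤
            Fintype.card (Fin p.G → Seed (Fin σ) p.M p.P n) ∧
        ((∃ γ : Seed (Fin σ) p.M p.P n, ¬ γ.Good
          (p.α r) (p.m r) (p.L r) (p.R r) (p.cap r) str q) →
        ∀ γ : Seed (Fin σ) p.M p.P n, γ.Good
          (p.α r₁) (p.m r₁) (p.L r₁) (p.R r₁) (p.cap r₁) str q))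
    (hy : ∃ y ∈ S, editDist q y ≤ r) :
    1 / 10 < (p.build n (16 * p.sectionSize σ n NS Rmax) w S).toOuterMeasure
      {m | ∃ y ∈ S, (editDist q y : ℝ) ≤ c * r ∧ Returns WordRAM.nearestProg m q y} ∧
    1 - 1 / (n : ℝ≥0∞) ≤ (p.build n (16 * p.sectionSize σ n NS Rmax) w S).toOuterMeasure
      {m | (queryTime WordRAM.nearestProg m q : ℝ≥0∞) ≤ (scaleTime p q.length r : ℝ≥0∞)} ∧
    ∑' m, p.build n (16 * p.sectionSize σ n NS Rmax) w S m *
      (queryTime WordRAM.nearestProg m q : ℝ≥0∞) ≤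
        (scaleTime p q.length r : ℝ≥0∞) + 1 / (n : ℝ≥0∞) * (scaleTime p q.length r₁ : ℝ≥0∞) := by
  set str : ℕ → List (Fin σ) := fun y => (S.toList[y]?).getD [] with hstr_def
  have hlen : S.toList.length = n := by rw [Finset.length_toList, hS]
  have hmem : ∀ y < n, str y ∈ S := fun y hy => by
    have hy' : y < S.toList.length := by omega
    simp only [hstr_def, List.getElem?_eq_getElem hy', Option.getD_some]
    exact Finset.mem_toList.1 (List.getElem_mem hy')
  have hstr : ∀ y, (str y).length ≤ p.d := fun y => by
    rcases Nat.lt_or_ge y n with hy | hy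
    · exact hSd _ (hmem y hy)
    · simp only [hstr_def, List.getElem?_eq_none (show S.toList.length ≤ y by omega),
        Option.getD_none, List.length_nil, Nat.zero_le]
  have hyr : ∃ y < n, editDist q (str y) ≤ r := by
    obtain ⟨x, hx, hxr⟩ := hy
    obtain ⟨i, hi, rfl⟩ := List.getElem_of_mem (Finset.mem_toList.2 hx)
    refine ⟨i, by omega, ?_⟩
    simpa only [hstr_def, List.getElem?_eq_getElem hi, Option.getD_some] using hxr
  obtain ⟨hcard, hfall⟩ := hprob str (fun y _ => hstr y) hyr
  let good : (Fin p.G → Seed (Fin σ) p.M p.P n) → Prop := fun ω =>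
    ∃ g, (ω g).Good (p.α r) (p.m r) (p.L r) (p.R r) (p.cap r) str q
  have hcard' : ∀ N ≤ 2 ^ p.G, N * Nat.card {ω // ¬ good ω} ≤
      Fintype.card (Fin p.G → Seed (Fin σ) p.M p.P n) := fun N hN => by
    simp only [good, not_exists]
    exact (Nat.mul_le_mul_right _ hN).trans hcard
  have hext : ∀ (ω : Fin p.G → Seed (Fin σ) p.M p.P n) (g : Fin p.G), p.extend ω g = ω g :=
    fun ω g => dif_pos g.2
  have hgood : ∀ ω, good ω → ∃ (st : WordRAM.State) (t : ℕ), WordRAM.Exec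
      (queryEnv (p.memory (p.extend ω) str (16 * p.sectionSize σ n NS Rmax) w) q)
      WordRAM.nearestProg (queryStart w q) st t ∧ t ≤ scaleTime p q.length r ∧
      ∃ y ∈ S, (editDist q y : ℝ) ≤ c * r ∧ st.output = y.map Fin.val := by
    rintro ω ⟨g, hg⟩
    rw [← hext ω g] at hg
    obtain ⟨st, t, hexec, r', hr', y, hy, hyR, hout, ht⟩ := h.runs hstr hw hw' hq hr g.2 hg
    refine ⟨st, t, hexec, ht, str y, hmem y hy, ?_, hout⟩
    calc (editDist q (str y) : ℝ) ≤ p.R r' := by exact_mod_cast hyR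
      _ ≤ c * r' := hR r'
      _ ≤ c * r := by gcongr
  have hbad : ∀ ω, ¬ good ω → ∃ (st : WordRAM.State) (t : ℕ), WordRAM.Exec
      (queryEnv (p.memory (p.extend ω) str (16 * p.sectionSize σ n NS Rmax) w) q)
      WordRAM.nearestProg (queryStart w q) st t ∧ t ≤ scaleTime p q.length r₁ := by
    intro ω hω
    have hg := hfall ⟨ω ⟨0, h.G_pos⟩, fun hg => hω ⟨_, hg⟩⟩ (p.extend ω 0)
    obtain ⟨st, t, hexec, -, -, -, -, -, -, ht⟩ := h.runs hstr hw hw' hq hr₁ h.G_pos hg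
    exact ⟨st, t, hexec, ht⟩
  have hcast : ∀ {a : ℕ∞} {b : ℕ}, a ≤ b → (a : ℝ≥0∞) ≤ (b : ℝ≥0∞) := fun {a b} hab => by
    exact_mod_cast ENat.toENNReal_le.2 hab
  refine ⟨?_, ?_, ?_⟩
  -- The bound `1 - 1/n` is void for `n = 1`, so failure probability `1/2` is used here, which
  -- suffices for `1/10`.
  · refine lt_of_lt_of_le ?_ (one_sub_le_toOuterMeasure_map_uniformOfFintype two_pos
      (hcard' 2 hG) fun ω hω => ?_)
    · rw [Nat.cast_ofNat, one_div, one_div, ENNReal.one_sub_inv_two, ENNReal.inv_lt_inv]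
      norm_num
    · obtain ⟨st, t, hexec, -, y, hy, hyr, hout⟩ := hgood ω hω
      exact ⟨y, hy, hyr, st, t, hexec, hout⟩
  · refine one_sub_le_toOuterMeasure_map_uniformOfFintype h.n_pos (hcard' n hGn) fun ω hω => ?_
    obtain ⟨st, t, hexec, ht, -⟩ := hgood ω hω
    exact hcast (queryTime_le hexec ht)
  · refine tsum_map_uniformOfFintype_mul_le h.n_pos (hcard' n hGn) (fun ω hω => ?_) fun ω hω => ?_
    · obtain ⟨st, t, hexec, ht, -⟩ := hgood ω hω
      exact hcast (queryTime_le hexec ht)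
    · obtain ⟨st, t, hexec, ht⟩ := hbad ω hω
      exact hcast (queryTime_le hexec ht)

/-- The factor `2` is available since `log 2 > 1/2`. -/
theorem natLog_add_one_le (n : ℕ) :
    ((Nat.log 2 n + 1 : ℕ) : ℝ) ≤ 2 * (1 + Real.log n) := by
  have h0 : 0 ≤ Real.log n := Real.log_natCast_nonneg n
  have h1 : (Nat.log 2 n : ℝ) ≤ Real.logb 2 n := by exact_mod_cast Real.natLog_le_logb n 2
  have h2 : Real.logb 2 n ≤ 2 * Real.log n := by
    rw [Real.logb, div_le_iff₀ (Real.log_pos one_lt_two)]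
    nlinarith [Real.log_two_gt_d9]
  push_cast
  linarith

theorem mainTheorem2 (c : ℝ) (hc : 1 ≤ c) (C : ℝ) :
    ∃ (P : WordRAM.Prog) (κ A k : ℕ),
      ∀ n d σ : ℕ, 0 < n → 0 < d → (d : ℝ) ≤ C * n → (σ : ℝ) ≤ C * n →
        ∃ s : ℕ, (s : ℝ) ≤ A * (n : ℝ) ^ 2 * (1 + Real.log n) ^ k ∧
          ∃ build : Finset (List (Fin σ)) → PMF (Memory s (κ * (Nat.log 2 n + 1))),
            ∀ S : Finset (List (Fin σ)), S.card = n → (∀ y ∈ S, y.length ≤ d) →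
              ∀ q : List (Fin σ), q.length ≤ d →
                ∀ r : ℕ, IsLeast {r : ℕ | ∃ y ∈ S, editDist q y ≤ r} r →
                  ∀ T : ℝ, T = A * (d * 3 ^ r * (n : ℝ) ^ (1 / c)) * (1 + Real.log n) ^ k →
                    -- the answer is a `c`-approximate nearest neighbour
                    1 / 10 < (build S).toOuterMeasure
                      {m | ∃ y ∈ S, (editDist q y : ℝ) ≤ c * r ∧ Returns P m q y} ∧
                    -- the query time is at most `T` with high probability
                    1 - 1 / (n : ℝ≥0∞) ≤ (build S).toOuterMeasure
                      {m | (queryTime P m q : ℝ≥0∞) ≤ ENNReal.ofReal T} ∧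
                    -- and in expectation
                    ∑' m, build S m * (queryTime P m q : ℝ≥0∞) ≤ ENNReal.ofReal T := by
  obtain ⟨K, hK⟩ : ∃ K, K = ⌈c⌉₊ := ⟨_, rfl⟩
  obtain ⟨B, hB⟩ : ∃ B, B = ⌈C⌉₊ + 1 := ⟨_, rfl⟩
  -- The factor `κ` comes from `word_size`. In `A`, `24000 = 6000 * 4` stems from the space with `l²
  -- ≤ 4 u⁴`, and `512000000 = 16000000 * 2 * 16` from the time with `width c n ≤ 2 n^(1/c)` and `l⁴
  -- ≤ 16 u⁴`.
  refine ⟨WordRAM.nearestProg, 4 + (6016 * (K * B ^ 2) + 65536),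
    24000 * (K * B ^ 2) + 512000000 * K, 4, fun n d σ hn hd hdC hσC => ?_⟩
  have hCB : ∀ k : ℕ, (k : ℝ) ≤ C * n → k ≤ B * n := fun k hk => by
    have h1 : C ≤ B := by
      rw [hB]; push_cast
      linarith [Nat.le_ceil C]
    have h2 : (k : ℝ) ≤ B * n := hk.trans (by gcongr)
    exact_mod_cast h2
  obtain ⟨l, hl⟩ : ∃ l, l = Nat.log 2 n + 1 := ⟨_, rfl⟩
  have hu := natLog_add_one_le n
  rw [← hl] at hu ⊢
  obtain ⟨u, hu_def⟩ : ∃ u, u = 1 + Real.log n := ⟨_, rfl⟩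
  have hu1 : 1 ≤ u := by
    have : 0 ≤ Real.log n := Real.log_natCast_nonneg n
    linarith
  rw [← hu_def] at hu ⊢
  have hl2 : (l : ℝ) ^ 2 ≤ 4 * u ^ 4 := by
    calc (l : ℝ) ^ 2 ≤ (2 * u) ^ 2 := by gcongr
      _ = 4 * u ^ 2 := by ring
      _ ≤ 4 * u ^ 4 := by gcongr; norm_num
  have hl4 : (l : ℝ) ^ 4 ≤ 16 * u ^ 4 := by
    calc (l : ℝ) ^ 4 ≤ (2 * u) ^ 4 := by gcongr
      _ = 16 * u ^ 4 := by ring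
  obtain ⟨p, NS, Rmax, r₁, hP, hpd, hpG, hcons, hsize, hw, hw', hdNS, hr₁, hR, htime, htime₁, hprob⟩ :=
    exists_params (c := c) hc hn hd hl (show 1 ≤ B by omega) (hCB d hdC) (hCB σ hσC)
  rw [← hK] at hsize hw hw' htime htime₁
  have : Fact p.P.Prime := ⟨hP⟩
  have : NeZero n := ⟨hn.ne'⟩
  refine ⟨16 * p.sectionSize σ n NS Rmax, ?_, p.build n _ _, ?_⟩
  · calc ((16 * p.sectionSize σ n NS Rmax : ℕ) : ℝ) ≤
          ((6000 * (K * B ^ 2) * n ^ 2 * l ^ 2 : ℕ) : ℝ) := by exact_mod_cast hsize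
      _ = 6000 * (K * B ^ 2) * n ^ 2 * l ^ 2 := by push_cast; ring
      _ ≤ 6000 * (K * B ^ 2) * n ^ 2 * (4 * u ^ 4) := by gcongr
      _ = 24000 * (K * B ^ 2) * (n ^ 2 * u ^ 4) := by ring
      _ ≤ (24000 * (K * B ^ 2) + 512000000 * K) * (n ^ 2 * u ^ 4) := by
          gcongr
          exact le_add_of_nonneg_right (by positivity)
      _ = _ := by push_cast; ring
  · intro S hS hSd q hq r hr T hT
    obtain ⟨x, hx, hxr⟩ := hr.1
    -- Two strings of length at most `d` have distance at most `d`, so scale `r` is among those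
    -- stored.
    have hrd : r ≤ d := (hr.2 ⟨x, hx, le_rfl⟩).trans
      ((editDist_le_max_length q x).trans (max_le hq (hSd x hx)))
    have hGn : n < 2 ^ p.G := by
      calc n < 2 ^ l := by rw [hl]; exact Nat.lt_pow_succ_log_self (by norm_num) _
        _ ≤ 2 ^ p.G := Nat.pow_le_pow_right (by norm_num) (by omega)
    obtain ⟨h1, h2, h3⟩ := hcons.build_spec hc hw hw' hS (fun y hy => hpd ▸ hSd y hy) (hpd ▸ hq)
      (r := r) (by omega) hr₁ hR (by omega) hGn.le
      (fun str hstr hy => hprob str q r (hpd ▸ hstr) hq hy) hr.1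
    -- The second summand is the time of a failed search, already multiplied by its probability
    -- `1/n`; it needs no factor `3 ^ r`.
    have hsum : scaleTime p q.length r + 12000000 * (K * (d * l ^ 4)) ≤
        16000000 * (K * (d * (3 ^ r * width c n) * l ^ 4)) := by
      have h4 := htime q.length hq r
      have h5 : K * (d * l ^ 4) ≤ K * (d * (3 ^ r * width c n) * l ^ 4) := by
        gcongr
        exact Nat.le_mul_of_pos_right _ (Nat.mul_pos (by positivity) (width_pos hn))
      omega
    have hbound : ((scaleTime p q.length r + 12000000 * (K * (d * l ^ 4)) : ℕ) : ℝ) ≤ T := by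
      calc ((scaleTime p q.length r + 12000000 * (K * (d * l ^ 4)) : ℕ) : ℝ) ≤
            ((16000000 * (K * (d * (3 ^ r * width c n) * l ^ 4)) : ℕ) : ℝ) := by
            exact_mod_cast hsum
        _ = 16000000 * (K * (d * (3 ^ r * width c n) * l ^ 4)) := by push_cast; ring
        _ ≤ 16000000 * (K * (d * (3 ^ r * (2 * (n : ℝ) ^ (1 / c))) * (16 * u ^ 4))) := by
            gcongr
            exact width_le_two_mul hc hn
        _ = 512000000 * K * (d * 3 ^ r * (n : ℝ) ^ (1 / c) * u ^ 4) := by ring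
        _ ≤ (24000 * (K * B ^ 2) + 512000000 * K) * (d * 3 ^ r * (n : ℝ) ^ (1 / c) * u ^ 4) := by
            gcongr
            exact le_add_of_nonneg_left (by positivity)
        _ = T := by rw [hT]; push_cast; ring
    have hbound' : ((scaleTime p q.length r : ℕ) : ℝ≥0∞) +
        ((12000000 * (K * (d * l ^ 4)) : ℕ) : ℝ≥0∞) ≤ ENNReal.ofReal T := by
      rw [← Nat.cast_add, ← ENNReal.ofReal_natCast]
      exact ENNReal.ofReal_le_ofReal hbound
    refine ⟨h1, h2.trans (MeasureTheory.measure_mono fun m hm =>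
      le_trans hm (le_self_add.trans hbound')), h3.trans (le_trans ?_ hbound')⟩
    gcongr
    calc 1 / (n : ℝ≥0∞) * (scaleTime p q.length r₁ : ℝ≥0∞) ≤
          1 / (n : ℝ≥0∞) * ((12000000 * (K * (d * l ^ 4)) * n : ℕ) : ℝ≥0∞) := by
          gcongr
          exact htime₁ q.length hq
      _ = _ := by
          rw [Nat.cast_mul _ n, mul_comm, mul_assoc, one_div, ENNReal.mul_inv_cancel
            (by exact_mod_cast hn.ne') (by simp), mul_one]
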